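/- **Theorem 3.** Let $k\ge 1$. A *$k$-labeled graph* is a finite simple graph whose vertices carry labels from $\{1,\dots,k\}$. A *$k$-expression* builds a $k$-labeled graph with the following operations: creation of one vertex with a given label; disjoint union of two $k$-labeled graphs; for labels $i\ne j$, the join, which adds all missing edges between the vertices of label $i$ and the vertices of label $j$; and renaming a label $i$ to a label $j$. Its *size* is its number of operations. An *odd cycle transversal* of a graph $G$ is a set of vertices that meets every odd cycle of $G$. (a) There is an algorithm that, given $k$, a $k$-expression of size $n$ of a graph $G$, and vertex weights $c:V(G)\to\mathbb Z\cup\{+\infty\}$, computes the minimum of $c(X)=\sum_{v\in X}c(v)$ over all odd cycle transversals $X$ of $G$ in time $4^k\cdot k^{\mathcal O(1)}\cdot n$. (b) If for some constant $0<\varepsilon<4$ there is an algorithm that performs the task of (a) in time $(4-\varepsilon)^k\cdot n^{\mathcal O(1)}$, then the Strong Exponential Time Hypothesis fails. The same conclusion holds if for some constant $0<\varepsilon<4$ there is an algorithm that only solves the unweighted decision problem in time $(4-\varepsilon)^k\cdot n^{\mathcal O(1)}$: given $k$, a $k$-expression of size $n$ of a graph $G$, and $p\in\mathbb N$, decide whether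 $G$ has an odd cycle transversal with at most $p$ vertices. Here algorithms are deterministic programs of a word RAM: arithmetic operations, comparisons and memory accesses on words take unit time, and a word has $\mathcal O(\log(T+M))$ bits, where $T$ is the time bound and $M$ is the length of the input plus the sum of the absolute values of the input numbers. The Strong Exponential Time Hypothesis says that for every $0<\delta<1$ there is a $q$ such that the satisfiability of CNF formulas with $n$ variables and at most $q$ literals in each clause cannot be decided in time $2^{(1-\delta)n}$ times a polynomial in the size of the formula. -/

import Mathlib

namespace OCT

/-! ### The machine model: a word RAM with structured programs -/

/-- The arithmetic operations of the machine. -/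
inductive Op
  | add
  | sub
  | mul
  | div

/-- The value of an operation (`div` is integer division; the quotient by zero is zero). -/
def Op.eval : Op → ℤ → ℤ → ℤ
  | .add, a, b => a + b
  | .sub, a, b => a - b
  | .mul, a, b => a * b
  | .div, a, b => a / b

/-- Programs.  A program is a finite text, so it mentions only finitely many registers and finitely
many arrays; the arrays are unbounded and are accessed by indirect addressing. -/
inductive Prog
  /-- `x := a` -/
  | const (x : ℕ) (a : ℤ)
  /-- `x := y o z` -/
  | op (o : Op) (x y z : ℕ)
  /-- `x := A[y]`, where `A` is the array number `a` -/
  | load (x a y : ℕ)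
  /-- `A[y] := x`, where `A` is the array number `a` -/
  | store (a y x : ℕ)
  /-- first `p`, then `q` -/
  | seq (p q : Prog)
  /-- `if y < z then p else q` -/
  | ite (y z : ℕ) (p q : Prog)
  /-- `while y < z do p` -/
  | loop (y z : ℕ) (p : Prog)

/-- The contents of the registers and of the arrays. -/
structure State where
  /-- registers -/
  reg : ℕ → ℤ
  /-- arrays: `arr a i` is the cell `i` of the array `a` -/
  arr : ℕ → ℤ → ℤ

/-- Assign `v` to the register `x`. -/
def State.setReg (s : State) (x : ℕ) (v : ℤ) : State :=
  { s with reg := Function.update s.reg x v }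

/-- Assign `v` to the cell `i` of the array `a`. -/
def State.setArr (s : State) (a : ℕ) (i v : ℤ) : State :=
  { s with arr := Function.update s.arr a (Function.update (s.arr a) i v) }

/-- `Exec B p s t s'`: on machine words that hold the integers of absolute value at most `B`, the
program `p`, started in the state `s`, halts after exactly `t` steps in the state `s'`, and no
overflow occurs.  Every assignment, every memory access and every evaluation of a test is one
step. -/
inductive Exec (B : ℕ) : Prog → State → ℕ → State → Prop
  | const {s : State} {x : ℕ} {a : ℤ} (h : |a| ≤ B) :
      Exec B (.const x a) s 1 (s.setReg x a)
  | op {s : State} {o : Op} {x y z : ℕ} (h : |o.eval (s.reg y) (s.reg z)| ≤ B) :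
      Exec B (.op o x y z) s 1 (s.setReg x (o.eval (s.reg y) (s.reg z)))
  | load {s : State} {x a y : ℕ} :
      Exec B (.load x a y) s 1 (s.setReg x (s.arr a (s.reg y)))
  | store {s : State} {a y x : ℕ} :
      Exec B (.store a y x) s 1 (s.setArr a (s.reg y) (s.reg x))
  | seq {s s' s'' : State} {p q : Prog} {t t' : ℕ} (h : Exec B p s t s')
      (h' : Exec B q s' t' s'') : Exec B (.seq p q) s (t + t') s''
  | ite_true {s s' : State} {y z : ℕ} {p q : Prog} {t : ℕ} (hc : s.reg y < s.reg z)
      (h : Exec B p s t s') : Exec B (.ite y z p q) s (t + 1) s'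
  | ite_false {s s' : State} {y z : ℕ} {p q : Prog} {t : ℕ} (hc : ¬ s.reg y < s.reg z)
      (h : Exec B q s t s') : Exec B (.ite y z p q) s (t + 1) s'
  | loop_true {s s' s'' : State} {y z : ℕ} {p : Prog} {t t' : ℕ} (hc : s.reg y < s.reg z)
      (h : Exec B p s t s') (h' : Exec B (.loop y z p) s' t' s'') :
      Exec B (.loop y z p) s (t + t' + 1) s''
  | loop_false {s : State} {y z : ℕ} {p : Prog} (hc : ¬ s.reg y < s.reg z) :
      Exec B (.loop y z p) s 1 s

/-- The initial state: the input words stand in the array `0`, from cell `0` on, their number stands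
in the register `0`, and everything else is zero. -/
def initState (x : List ℤ) : State where
  reg := fun r => if r = 0 then (x.length : ℤ) else 0
  arr := fun a i => if a = 0 ∧ 0 ≤ i then x.getD i.toNat 0 else 0

/-- The number of input words plus the sum of their absolute values. -/
def magnitude (x : List ℤ) : ℕ := x.length + (x.map Int.natAbs).sum

/-- A computational task: instances, their representation as input words, and the final states that
carry a correct answer. -/
structure Task where
  /-- instances -/
  Inst : Type
  /-- the input words of an instance -/
  input : Inst → List ℤ
  /-- the final state carries a correct answer -/
  Correct : Inst → State → Prop

/-- The program `P` solves the task `τ` in time `T`: on every instance `I` it halts after at most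
`T I` steps with a correct answer, on words of `O(log (T I + magnitude of the input))` bits. -/
def Task.SolvedBy (τ : Task) (P : Prog) (T : τ.Inst → ℝ) : Prop :=
  ∃ d : ℕ, ∀ I : τ.Inst, ∃ (t B : ℕ) (s : State),
    (t : ℝ) ≤ T I ∧ (B : ℝ) ≤ (T I + magnitude (τ.input I) + 2) ^ d ∧
      Exec B P (initState (τ.input I)) t s ∧ τ.Correct I s

/-! ### Expressions of clique-width -/

/-- `k`-expressions over the label set `Fin k`. -/
inductive KExpr (k : ℕ) : Type
  /-- creation of a vertex with label `i` -/
  | vertex (i : Fin k)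
  /-- disjoint union -/
  | union (e₁ e₂ : KExpr k)
  /-- join of two distinct labels `i` and `j` -/
  | join (i j : Fin k) (hij : i ≠ j) (e : KExpr k)
  /-- renaming of the label `i` to `j` -/
  | rename (i j : Fin k) (e : KExpr k)

namespace KExpr

variable {k : ℕ}

/-- The size of an expression: the number of its operations. -/
def size : KExpr k → ℕ
  | .vertex _ => 1
  | .union e₁ e₂ => e₁.size + e₂.size + 1
  | .join _ _ _ e => e.size + 1
  | .rename _ _ e => e.size + 1

/-- The vertices of the graph that an expression constructs: one for each vertex creation. -/
def Vert : KExpr k → Type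
  | .vertex _ => Unit
  | .union e₁ e₂ => e₁.Vert ⊕ e₂.Vert
  | .join _ _ _ e => e.Vert
  | .rename _ _ e => e.Vert

/-- The labelling of the graph that an expression constructs. -/
def label : (e : KExpr k) → e.Vert → Fin k
  | .vertex i, _ => i
  | .union e₁ e₂, v => Sum.elim e₁.label e₂.label v
  | .join _ _ _ e, v => e.label v
  | .rename i j e, v => if e.label v = i then j else e.label v

/-- The graph that an expression constructs. -/
def graph : (e : KExpr k) → SimpleGraph e.Vert
  | .vertex _ => (⊥ : SimpleGraph Unit)
  | .union e₁ e₂ => e₁.graph ⊕g e₂.graph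
  | .join i j _ e => e.graph ⊔ SimpleGraph.fromRel fun u v => e.label u = i ∧ e.label v = j
  | .rename _ _ e => e.graph

end KExpr

/-- A weight in `ℤ ∪ {+∞}` as two words: the first is `1` for `+∞` and `0` otherwise, the second is
the weight if it is finite. -/
def weightWords (w : WithTop ℤ) : ℤ × ℤ := (if w = ⊤ then 1 else 0, w.untopD 0)

/-- A vertex-weighted expression as a sequence of operations, in postfix order, four words for each
operation; the weight of a vertex is written with its creation. -/
def KExpr.encode {k : ℕ} : (e : KExpr k) → (e.Vert → WithTop ℤ) → List ℤ
  | .vertex i, c => [0, ((i : ℕ) : ℤ), (weightWords (c ())).1, (weightWords (c ())).2]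
  | .union e₁ e₂, c =>
      e₁.encode (fun v => c (Sum.inl v)) ++ e₂.encode (fun v => c (Sum.inr v)) ++ [1, 0, 0, 0]
  | .join i j _ e, c => KExpr.encode e c ++ [2, ((i : ℕ) : ℤ), ((j : ℕ) : ℤ), 0]
  | .rename i j e, c => KExpr.encode e c ++ [3, ((i : ℕ) : ℤ), ((j : ℕ) : ℤ), 0]

/-! ### Odd cycle transversals -/

/-- `X` is an odd cycle transversal of `G`: it meets every odd cycle of `G`. -/
def IsOCT {V : Type} (G : SimpleGraph V) (X : Finset V) : Prop :=
  ∀ (v : V) (p : G.Walk v v), p.IsCycle → Odd p.length → ∃ u ∈ p.support, u ∈ X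

/-- Instances of the weighted problem: a number `k`, a `k`-expression, and vertex weights. -/
structure WeightedInst where
  /-- number of labels -/
  k : ℕ
  /-- the expression -/
  e : KExpr k
  /-- the weights -/
  c : e.Vert → WithTop ℤ

/-- Weighted odd cycle transversal: compute the minimum weight of an odd cycle transversal of the
graph that is given by the expression (answer in the registers `0` and `1`). -/
def weightedOCT : Task where
  Inst := WeightedInst
  input := fun I => (I.k : ℤ) :: I.e.encode I.c
  Correct := fun I s => ∃ m : WithTop ℤ,
    IsLeast {w : WithTop ℤ | ∃ X : Finset I.e.Vert, IsOCT I.e.graph X ∧ w = ∑ v ∈ X, I.c v} m ∧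
      (s.reg 0, s.reg 1) = weightWords m

/-- Instances of the unweighted decision problem: a number `k`, a `k`-expression, and a budget. -/
structure DecisionInst where
  /-- number of labels -/
  k : ℕ
  /-- the expression -/
  e : KExpr k
  /-- the budget -/
  p : ℕ

/-- Odd cycle transversal (all weights are `1`): decide whether the graph that is given by the
expression has an odd cycle transversal of at most `p` vertices (`1` in the register `0` means
yes). -/
def decisionOCT : Task where
  Inst := DecisionInst
  input := fun I => (I.k : ℤ) :: (I.p : ℤ) :: I.e.encode (fun _ => 1)
  Correct := fun I s => s.reg 0 = 1 ↔ ∃ X : Finset I.e.Vert, IsOCT I.e.graph X ∧ X.card ≤ I.p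

/-! ### The Strong Exponential Time Hypothesis -/

/-- Instances of `q`-SAT: a list of clauses over `n` Boolean variables, each a list of at most `q`
literals; the literal `(x, b)` is satisfied if the variable `x` has the value `b`. -/
structure CNF (q : ℕ) where
  /-- number of variables -/
  n : ℕ
  /-- the clauses -/
  clauses : List (List (Fin n × Bool))
  /-- every clause has at most `q` literals -/
  width : ∀ K ∈ clauses, K.length ≤ q

/-- Satisfiability of a formula. -/
def CNF.Satisfiable {q : ℕ} (φ : CNF q) : Prop :=
  ∃ a : Fin φ.n → Bool, ∀ K ∈ φ.clauses, ∃ l ∈ K, a l.1 = l.2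

/-- The words of a formula: the number of variables, the number of clauses, and for each clause its
length followed by its literals. -/
def CNF.encode {q : ℕ} (φ : CNF q) : List ℤ :=
  (φ.n : ℤ) :: (φ.clauses.length : ℤ) :: φ.clauses.flatMap fun K =>
    (K.length : ℤ) :: K.map fun l => 2 * ((l.1 : ℕ) : ℤ) + (if l.2 then 1 else 0)

/-- `q`-SAT (`1` in the register `0` means satisfiable). -/
def qSAT (q : ℕ) : Task where
  Inst := CNF q
  input := CNF.encode
  Correct := fun φ s => s.reg 0 = 1 ↔ φ.Satisfiable

/-- The Strong Exponential Time Hypothesis: for every `δ > 0` there is a `q` such that `q`-SAT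
cannot be solved in time `2 ^ ((1 - δ) n)` times a polynomial in the size of the formula. -/
def SETH : Prop :=
  ∀ δ : ℝ, 0 < δ → δ < 1 → ∃ q : ℕ, ¬ ∃ (P : Prog) (C d : ℕ),
    (qSAT q).SolvedBy P fun φ : CNF q =>
      C * (2 : ℝ) ^ ((1 - δ) * φ.n) * ((φ.n : ℝ) + φ.encode.length) ^ d

end OCT

/-!
# Odd cycle transversals of graphs of bounded clique-width

A set of vertices is an odd cycle transversal if and only if the remaining graph is bipartite, because
an odd closed walk passes through an odd cycle (`isOCT_iff_exists_proper`). So everything is about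
partial colourings with two colours, in which the vertices without a colour are deleted.

**The algorithm.** A constraint `S`, a number below `4 ^ k`, tells for each label and each colour
whether vertices with this label may have this colour. The table of an expression lists, for all `S`,
the least weight `KExpr.opt` that has to be deleted to get a proper colouring that obeys `S`. Working
with allowed instead of used colours makes a disjoint union the pointwise sum of two tables
(`KExpr.opt_union`) and a renaming a rearrangement of the table (`KExpr.opt_rename`). For a join of `i`
and `j`, the table does not change at `S` if no colour is allowed at both labels, and otherwise one of
the two labels forgoes the common colour, so that the entry is the minimum of two entries at smaller
numbers (`KExpr.opt_join_of_disjoint`, `KExpr.opt_join_of_common`). Each operation thus takes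
`O(4 ^ k)` steps (`reaches_expr`). Infinite weights are replaced by a finite weight that exceeds twice
the sum of the absolute values of all input words (`exists_isLeast_weight`).

**The lower bound.** A formula with `n` variables and `L` literal occurrences is turned into an
expression with `n / 2 + O(1)` labels whose graph has an odd cycle transversal of at most
`p = 2 h + 2 L` vertices, where `h` is `n / 2` rounded up, if and only if the formula is satisfiable
(`exists_reduction`). Since `(4 - ε) ^ (n / 2) = 2 ^ ((1 - δ) n)` for some `δ > 0` if `ε < 2`
(`exists_delta`; a larger `ε` only makes the hypothesis stronger), a fast algorithm for odd cycle
transversals contradicts the Strong Exponential Time Hypothesis (`not_seth`).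

The expression adds one vertex or performs one join or renaming at a time, so it can be read as a
nondeterministic process that guesses the colour of each vertex and remembers only which label uses
which colour and how many vertices are deleted (`Steps`, `KExpr.exists_of_steps`). Two classes of
reference vertices, too many to delete, fix the two colours. Each pair of variables shares a label,
whose four possible sets of used colours encode the values of the two variables. Once used, a colour
stays used at this label, so that the values can only grow during the process. Vertices before and
after all clauses cost `2 h` deletions if the values stay the same, and more if they grow
(`init_sound`, `final_sound`). A literal gadget reads the value of its variable and costs two deletions,
or one if its clause gets satisfied by this literal (`literal_sound`), which can happen once for each
clause. With one forced deletion for each clause, the budget `p` is met if and only if the values are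
constant and satisfy every clause.

The reduction is performed by a program for the word RAM (`runs_reductionProg`), which writes the words
of the expression into an array; the given program is then run on a copy of the machine with shifted
registers and arrays (`Exec.shift`).
-/

namespace OCT

/-! ### Odd cycles and proper partial colourings -/

section OddCycle

variable {V : Type*} {G : SimpleGraph V}

/-- Either the walk meets an odd cycle on its own vertices, or removing its loops does not change
the parity of its length. -/
theorem exists_odd_cycle_or_even_bypass [DecidableEq V] {u v : V} (p : G.Walk u v) :
    (∃ (w : V) (c : G.Walk w w), c.IsCycle ∧ Odd c.length ∧ c.support ⊆ p.support) ∨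
      (Even p.bypass.length ↔ Even p.length) := by
  induction p with
  | nil => right; simp [SimpleGraph.Walk.bypass]
  | @cons u w v h p ih =>
    rcases ih with ⟨x, c, hc, ho, hs⟩ | ih
    · exact Or.inl ⟨x, c, hc, ho, fun y hy => by simp [hs hy]⟩
    · by_cases hu : u ∈ p.bypass.support
      · have hsplit : (p.bypass.takeUntil u hu).length + (p.bypass.dropUntil u hu).length
            = p.bypass.length := by
          rw [← SimpleGraph.Walk.length_append, SimpleGraph.Walk.take_spec]
        have hlen : (SimpleGraph.Walk.cons h p).bypass.length
            = (p.bypass.dropUntil u hu).length := by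
          simp [SimpleGraph.Walk.bypass, hu]
        have hpath : (p.bypass.takeUntil u hu).IsPath := (p.bypass_isPath).takeUntil hu
        by_cases ho : Odd (p.bypass.takeUntil u hu).length
        · right
          rw [hlen, SimpleGraph.Walk.length_cons]
          rw [Nat.odd_iff] at ho
          rw [Nat.even_iff, Nat.even_iff] at ih ⊢
          omega
        · left
          refine ⟨u, SimpleGraph.Walk.cons h (p.bypass.takeUntil u hu), ?_, ?_, ?_⟩
          · rw [SimpleGraph.Walk.cons_isCycle_iff]
            refine ⟨hpath, fun he => ho ?_⟩
            -- a path that contains the edge between its ends consists of this edge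
            have : (p.bypass.takeUntil u hu).length = 1 := by
              revert he hpath
              generalize p.bypass.takeUntil u hu = q
              intro hpath he
              cases q with
              | nil => simp at he
              | @cons _ x _ h' q =>
                rw [SimpleGraph.Walk.cons_isPath_iff] at hpath
                simp only [SimpleGraph.Walk.edges_cons, List.mem_cons] at he
                rcases he with he | he
                · have hx : x = u := by
                    rcases Sym2.eq_iff.1 he with ⟨h1, h2⟩ | ⟨h1, h2⟩
                    · exact absurd h1 h.ne
                    · exact h1.symm
                  subst hx
                  have hnil := SimpleGraph.Walk.isPath_iff_nil.1 hpath.1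
                  simp [SimpleGraph.Walk.length_eq_zero_iff.2 hnil]
                · exact absurd (SimpleGraph.Walk.snd_mem_support_of_mem_edges _ he) hpath.2
            rw [this]; exact odd_one
          · rw [SimpleGraph.Walk.length_cons]
            exact (Nat.not_odd_iff_even.1 ho).add_one
          · intro y hy
            simp only [SimpleGraph.Walk.support_cons, List.mem_cons] at hy ⊢
            rcases hy with hy | hy
            · exact Or.inl hy
            · exact Or.inr (p.support_bypass_subset_support
                (SimpleGraph.Walk.support_takeUntil_subset_support _ hu hy))
      · right
        simp only [SimpleGraph.Walk.bypass, hu, dite_false, SimpleGraph.Walk.length_cons]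
        rw [Nat.even_add_one, Nat.even_add_one, ih]

/-- Every odd closed walk passes through an odd cycle. -/
theorem exists_odd_cycle_of_odd_closed_walk {u : V} (p : G.Walk u u) (hp : Odd p.length) :
    ∃ (w : V) (c : G.Walk w w), c.IsCycle ∧ Odd c.length ∧ c.support ⊆ p.support := by
  classical
  rcases exists_odd_cycle_or_even_bypass p with h | h
  · exact h
  · have hnil := SimpleGraph.Walk.length_eq_zero_iff.2
      (SimpleGraph.Walk.isPath_iff_nil.1 p.bypass_isPath)
    rw [hnil] at h
    exact absurd (h.1 (by simp)) (Nat.not_even_iff_odd.2 hp)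

end OddCycle

/-- A partial colouring with two colours (`none` means that the vertex is deleted) is proper if no
edge has two ends of the same colour. -/
def Proper {V : Type*} (G : SimpleGraph V) (f : V → Option Bool) : Prop :=
  ∀ u v, G.Adj u v → ∀ a, f u = some a → f v ≠ some a

/-- Along a walk that avoids the deleted vertices the two colours alternate. -/
theorem Proper.parity {V : Type*} {G : SimpleGraph V} {f : V → Option Bool} (hf : Proper G f)
    {u v : V} (p : G.Walk u v) (hp : ∀ w ∈ p.support, f w ≠ none) :
    Even p.length ↔ f u = f v := by
  induction p with
  | nil => simp
  | @cons u w v h p ih =>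
    have ih := ih fun x hx => hp x (by simp [hx])
    rw [SimpleGraph.Walk.length_cons, Nat.even_add_one, ih]
    have hu := hp u (by simp)
    have hw := hp w (by simp)
    have hv := hp v (by simp)
    have hne := hf u w h
    revert hu hw hv hne
    generalize f u = a; generalize f w = b; generalize f v = c
    revert a b c
    decide

/-- Odd cycle transversals are the sets of deleted vertices of proper partial colourings. -/
theorem isOCT_iff_exists_proper {V : Type} {G : SimpleGraph V} {X : Finset V} :
    IsOCT G X ↔ ∃ f : V → Option Bool, Proper G f ∧ ∀ v, f v = none ↔ v ∈ X := by
  classical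
  constructor
  · intro hX
    have hcol : (G.induce {v | v ∉ X}).Colorable 2 := by
      rw [SimpleGraph.two_colorable_iff_forall_loop_even]
      intro u p
      by_contra hodd
      rw [Nat.not_even_iff_odd] at hodd
      let φ : G.induce {v | v ∉ X} →g G := (SimpleGraph.Embedding.induce _).toHom
      obtain ⟨w, c, hc, ho, hs⟩ :=
        exists_odd_cycle_of_odd_closed_walk (p.map φ) (by simpa using hodd)
      obtain ⟨x, hx, hxX⟩ := hX w c hc ho
      have := hs hx
      rw [SimpleGraph.Walk.support_map, List.mem_map] at this
      obtain ⟨y, -, rfl⟩ := this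
      exact y.2 hxX
    obtain ⟨g⟩ := hcol
    refine ⟨fun v => if h : v ∈ X then none else some (decide (g ⟨v, h⟩ = 0)), ?_, ?_⟩
    · intro u v huv a hu hv
      by_cases h1 : u ∈ X
      · simp [h1] at hu
      by_cases h2 : v ∈ X
      · simp [h2] at hv
      simp only [h1, h2, dite_false, Option.some.injEq] at hu hv
      have hne : g ⟨u, h1⟩ ≠ g ⟨v, h2⟩ := g.valid (by simpa using huv)
      rw [← hv] at hu
      revert hu hne
      generalize g ⟨u, h1⟩ = a; generalize g ⟨v, h2⟩ = b
      revert a b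
      decide
    · intro v
      by_cases h : v ∈ X <;> simp [h]
  · rintro ⟨f, hf, hX⟩ v p hp ho
    by_contra hcon
    push Not at hcon
    have := (hf.parity p fun w hw h => hcon w hw ((hX w).1 h)).2 rfl
    exact Nat.not_even_iff_odd.2 ho this

/-! ### Partial colourings of the graph of an expression -/

namespace KExpr

variable {k : ℕ}

/-- An expression creates finitely many vertices. -/
instance vertFintype : (e : KExpr k) → Fintype e.Vert
  | .vertex _ => inferInstanceAs (Fintype Unit)
  | .union e₁ e₂ =>
      haveI := vertFintype e₁
      haveI := vertFintype e₂
      inferInstanceAs (Fintype (e₁.Vert ⊕ e₂.Vert))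
  | .join _ _ _ e => vertFintype e
  | .rename _ _ e => vertFintype e

/-- The total weight of the vertices that a partial colouring deletes. -/
def cost {M : Type*} [AddCommMonoid M] (e : KExpr k) (c : e.Vert → M)
    (f : e.Vert → Option Bool) : M :=
  ∑ v, if f v = none then c v else 0

/-- The label `l` carries a vertex of colour `a`. -/
def Uses (e : KExpr k) (f : e.Vert → Option Bool) (l : Fin k) (a : Bool) : Prop :=
  ∃ v, e.label v = l ∧ f v = some a

theorem cost_union {M : Type*} [AddCommMonoid M] (e₁ e₂ : KExpr k) (c : (union e₁ e₂).Vert → M)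
    (f : (union e₁ e₂).Vert → Option Bool) :
    (union e₁ e₂).cost c f =
      e₁.cost (fun v => c (Sum.inl v)) (fun v => f (Sum.inl v)) +
        e₂.cost (fun v => c (Sum.inr v)) (fun v => f (Sum.inr v)) :=
  Fintype.sum_sum_type _

theorem proper_union (e₁ e₂ : KExpr k) (f : (union e₁ e₂).Vert → Option Bool) :
    Proper (union e₁ e₂).graph f ↔
      Proper e₁.graph (fun v => f (Sum.inl v)) ∧ Proper e₂.graph (fun v => f (Sum.inr v)) := by
  constructor
  · intro h
    exact ⟨fun u v huv => h (Sum.inl u) (Sum.inl v) huv,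
      fun u v huv => h (Sum.inr u) (Sum.inr v) huv⟩
  · rintro ⟨h₁, h₂⟩ (u | u) (v | v) huv
    · exact h₁ u v huv
    · simp [graph] at huv
    · simp [graph] at huv
    · exact h₂ u v huv

theorem proper_join (i j : Fin k) (hij : i ≠ j) (e : KExpr k) (f : e.Vert → Option Bool) :
    Proper (join i j hij e).graph f ↔
      Proper e.graph f ∧ ∀ a, ¬ (e.Uses f i a ∧ e.Uses f j a) := by
  constructor
  · intro h
    refine ⟨fun u v huv => h u v (Or.inl huv), ?_⟩
    rintro a ⟨⟨u, hu, hua⟩, v, hv, hva⟩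
    have hadj : (SimpleGraph.fromRel fun u v => e.label u = i ∧ e.label v = j).Adj u v := by
      rw [SimpleGraph.fromRel_adj]
      exact ⟨fun huv => hij (by rw [← hu, ← hv, huv]), Or.inl ⟨hu, hv⟩⟩
    exact h u v (Or.inr hadj) a hua hva
  · rintro ⟨h, hu⟩ u v (huv | huv) a ha hb
    · exact h u v huv a ha hb
    · have huv := (SimpleGraph.fromRel_adj _ _ _).1 huv
      rcases huv.2 with ⟨h1, h2⟩ | ⟨h1, h2⟩
      · exact hu a ⟨⟨u, h1, ha⟩, v, h2, hb⟩
      · exact hu a ⟨⟨v, h1, hb⟩, u, h2, ha⟩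

/-- The proper partial colourings whose colours are allowed by `S`: the colour `a` is allowed at the
label `l` if the bit `2 * l + a` of `S` is set. -/
def Sol (e : KExpr k) (S : ℕ) (f : e.Vert → Option Bool) : Prop :=
  Proper e.graph f ∧ ∀ v a, f v = some a → S.testBit (2 * (e.label v : ℕ) + a.toNat) = true

theorem sol_none (e : KExpr k) (S : ℕ) : e.Sol S fun _ => none :=
  ⟨fun _ _ _ _ h => (Option.some_ne_none _ h.symm).elim,
    fun _ _ h => (Option.some_ne_none _ h.symm).elim⟩

/-- The minimum weight that is deleted by a proper partial colouring with colours allowed by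
`S`. -/
noncomputable def opt (e : KExpr k) (c : e.Vert → ℤ) (S : ℕ) : ℤ :=
  sInf {w | ∃ f, e.Sol S f ∧ w = e.cost c f}

theorem finite_costs (e : KExpr k) (c : e.Vert → ℤ) (p : (e.Vert → Option Bool) → Prop) :
    {w | ∃ f, p f ∧ w = e.cost c f}.Finite := by
  classical
  refine (Set.finite_range (e.cost c)).subset ?_
  rintro w ⟨f, -, rfl⟩
  exact ⟨f, rfl⟩

theorem exists_opt (e : KExpr k) (c : e.Vert → ℤ) (S : ℕ) :
    ∃ f, e.Sol S f ∧ e.opt c S = e.cost c f := by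
  have hne : {w | ∃ f, e.Sol S f ∧ w = e.cost c f}.Nonempty := ⟨_, fun _ => none, e.sol_none S, rfl⟩
  exact hne.csInf_mem (e.finite_costs c _)

theorem opt_le (e : KExpr k) (c : e.Vert → ℤ) {S : ℕ} {f : e.Vert → Option Bool}
    (hf : e.Sol S f) : e.opt c S ≤ e.cost c f :=
  csInf_le (e.finite_costs c _).bddBelow ⟨f, hf, rfl⟩

/-- Optima agree if the partial colourings of two graphs correspond. -/
theorem opt_congr {e e' : KExpr k} (c : e.Vert → ℤ) (c' : e'.Vert → ℤ) {S S' : ℕ}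
    (φ : (e'.Vert → Option Bool) → (e.Vert → Option Bool)) (hφ : Function.Surjective φ)
    (hS : ∀ f, e.Sol S (φ f) ↔ e'.Sol S' f) (hc : ∀ f, e.cost c (φ f) = e'.cost c' f) :
    e.opt c S = e'.opt c' S' := by
  unfold opt
  congr 1
  ext w
  constructor
  · rintro ⟨f, hf, rfl⟩
    obtain ⟨g, rfl⟩ := hφ f
    exact ⟨g, (hS g).1 hf, hc g⟩
  · rintro ⟨g, hg, rfl⟩
    exact ⟨φ g, (hS g).2 hg, (hc g).symm⟩

theorem cost_vertex {M : Type*} [AddCommMonoid M] (i : Fin k) (c : (vertex i).Vert → M)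
    (f : (vertex i).Vert → Option Bool) :
    (vertex i).cost c f = if f () = none then c () else 0 :=
  Fintype.sum_unique (ι := Unit) _

theorem opt_vertex (i : Fin k) (c : (vertex i).Vert → ℤ) (S : ℕ) :
    (vertex i).opt c S =
      if S.testBit (2 * (i : ℕ)) = true ∨ S.testBit (2 * (i : ℕ) + 1) = true
        then min 0 (c ()) else c () := by
  have hle : (vertex i).opt c S ≤ c () := by
    have := (vertex i).opt_le c ((vertex i).sol_none S)
    rwa [cost_vertex, if_pos rfl] at this
  have hle0 : ∀ a : Bool, S.testBit (2 * (i : ℕ) + a.toNat) = true → (vertex i).opt c S ≤ 0 := by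
    intro a ha
    have hs : (vertex i).Sol S fun _ => some a := by
      refine ⟨fun u v huv => (huv : False).elim, ?_⟩
      intro v b hb
      obtain rfl : a = b := by simpa using hb
      exact ha
    have := (vertex i).opt_le c hs
    rwa [cost_vertex, if_neg (by simp)] at this
  obtain ⟨f, hf, hopt⟩ := (vertex i).exists_opt c S
  rw [cost_vertex] at hopt
  split_ifs at hopt with hn
  · split_ifs with hS
    · have h0 : (vertex i).opt c S ≤ 0 := by
        rcases hS with hS | hS
        · exact hle0 false hS
        · exact hle0 true hS
      omega
    · exact hopt
  · obtain ⟨a, ha⟩ := Option.ne_none_iff_exists'.1 hn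
    have := hf.2 () a ha
    rw [if_pos]
    · omega
    · cases a
      · exact Or.inl this
      · exact Or.inr this

theorem sol_union (e₁ e₂ : KExpr k) (S : ℕ) (f : (union e₁ e₂).Vert → Option Bool) :
    (union e₁ e₂).Sol S f ↔
      e₁.Sol S (fun v => f (Sum.inl v)) ∧ e₂.Sol S (fun v => f (Sum.inr v)) := by
  unfold Sol
  rw [proper_union]
  constructor
  · rintro ⟨⟨h₁, h₂⟩, h⟩
    exact ⟨⟨h₁, fun v => h (Sum.inl v)⟩, h₂, fun v => h (Sum.inr v)⟩
  · rintro ⟨⟨h₁, h₃⟩, h₂, h₄⟩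
    exact ⟨⟨h₁, h₂⟩, fun v => Sum.rec h₃ h₄ v⟩

theorem opt_union (e₁ e₂ : KExpr k) (c : (union e₁ e₂).Vert → ℤ) (S : ℕ) :
    (union e₁ e₂).opt c S =
      e₁.opt (fun v => c (Sum.inl v)) S + e₂.opt (fun v => c (Sum.inr v)) S := by
  apply le_antisymm
  · obtain ⟨f₁, h₁, ho₁⟩ := e₁.exists_opt (fun v => c (Sum.inl v)) S
    obtain ⟨f₂, h₂, ho₂⟩ := e₂.exists_opt (fun v => c (Sum.inr v)) S
    have hs : (union e₁ e₂).Sol S (fun v => Sum.elim f₁ f₂ v) := by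
      rw [sol_union]; exact ⟨h₁, h₂⟩
    have := opt_le _ c hs
    rw [cost_union] at this
    rw [ho₁, ho₂]
    exact this
  · obtain ⟨f, hf, ho⟩ := (union e₁ e₂).exists_opt c S
    rw [sol_union] at hf
    rw [ho, cost_union]
    exact add_le_add (opt_le _ _ hf.1) (opt_le _ _ hf.2)

theorem sol_join (i j : Fin k) (hij : i ≠ j) (e : KExpr k) (S : ℕ) (f : e.Vert → Option Bool) :
    (join i j hij e).Sol S f ↔
      e.Sol S f ∧ ∀ a, ¬ (e.Uses f i a ∧ e.Uses f j a) := by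
  unfold Sol
  rw [proper_join]
  constructor
  · rintro ⟨⟨h₁, h₂⟩, h⟩
    exact ⟨⟨h₁, h⟩, h₂⟩
  · rintro ⟨⟨h₁, h⟩, h₂⟩
    exact ⟨⟨h₁, h₂⟩, h⟩

theorem Sol.testBit_of_uses {e : KExpr k} {S : ℕ} {f : e.Vert → Option Bool} (hf : e.Sol S f)
    {l : Fin k} {a : Bool} (h : e.Uses f l a) : S.testBit (2 * (l : ℕ) + a.toNat) = true := by
  obtain ⟨v, rfl, ha⟩ := h
  exact hf.2 v a ha

/-- If no colour is allowed at both joined labels, then the join imposes no constraint. -/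
theorem opt_join_of_disjoint (i j : Fin k) (hij : i ≠ j) (e : KExpr k) (c : e.Vert → ℤ) (S : ℕ)
    (hS : ∀ a : Bool, ¬ (S.testBit (2 * (i : ℕ) + a.toNat) = true ∧
      S.testBit (2 * (j : ℕ) + a.toNat) = true)) :
    (join i j hij e).opt c S = e.opt c S := by
  refine opt_congr (e := join i j hij e) (e' := e) c c (fun f => f) (fun f => ⟨f, rfl⟩)
    (fun f => ?_) (fun f => rfl)
  rw [sol_join]
  exact and_iff_left_of_imp fun h a ha =>
    hS a ⟨h.testBit_of_uses ha.1, h.testBit_of_uses ha.2⟩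

end KExpr

/-- Replacing the bit `d` of a number at the position `b` by the bit `d'`. -/
theorem testBit_replace {S S' b : ℕ} {d d' : Bool} (hd : S.testBit b = d)
    (hS : S' + d.toNat * 2 ^ b = S + d'.toNat * 2 ^ b) (m : ℕ) :
    S'.testBit m = if m = b then d' else S.testBit m := by
  have key : S = 2 ^ b * (2 * (S / 2 ^ b / 2) + d.toNat) + S % 2 ^ b := by
    have h1 : S / 2 ^ b % 2 = d.toNat := by rw [← hd, Nat.toNat_testBit]
    have h2 := Nat.div_add_mod (S / 2 ^ b) 2
    have h3 := Nat.div_add_mod S (2 ^ b)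
    rw [← h1, h2, h3]
  have hlt : S % 2 ^ b < 2 ^ b := Nat.mod_lt _ (by positivity)
  generalize S / 2 ^ b / 2 = q at key
  generalize S % 2 ^ b = r at key hlt
  have key' : S' = 2 ^ b * (2 * q + d'.toNat) + r := by
    have : S' + d.toNat * 2 ^ b = 2 ^ b * (2 * q + d'.toNat) + r + d.toNat * 2 ^ b := by
      rw [hS, key]; ring
    omega
  have h2 : ∀ (c : Bool) (n : ℕ), (2 * q + c.toNat).testBit (n + 1) = q.testBit n := by
    intro c n
    have := Bool.toNat_lt c
    rw [Nat.testBit_add_one, show (2 * q + c.toNat) / 2 = q by omega]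
  have h0 : ∀ c : Bool, (2 * q + c.toNat).testBit 0 = c := by
    intro c
    rw [Nat.testBit_zero]
    cases c <;> simp
  rw [key, key', Nat.testBit_two_pow_mul_add _ hlt, Nat.testBit_two_pow_mul_add _ hlt]
  rcases lt_trichotomy m b with hm | hm | hm
  · simp [hm, hm.ne]
  · simp [hm, h0]
  · obtain ⟨n, rfl⟩ : ∃ n, m = b + (n + 1) := ⟨m - b - 1, by omega⟩
    simp [h2]

theorem testBit_sub_two_pow {S b : ℕ} (h : S.testBit b = true) (m : ℕ) :
    (S - 2 ^ b).testBit m = (S.testBit m && decide (m ≠ b)) := by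
  have := Nat.ge_two_pow_of_testBit h
  rw [testBit_replace (d' := false) h (by simp; omega)]
  by_cases hm : m = b <;> simp [hm]

namespace KExpr

variable {k : ℕ}

/-- Clearing the bit of the colour `a` at the label `i` forbids to use this colour there. -/
theorem sol_sub_two_pow {e : KExpr k} {S : ℕ} (f : e.Vert → Option Bool) {i : Fin k} {a : Bool}
    (hS : S.testBit (2 * (i : ℕ) + a.toNat) = true) :
    e.Sol (S - 2 ^ (2 * (i : ℕ) + a.toNat)) f ↔ e.Sol S f ∧ ¬ e.Uses f i a := by
  unfold Sol
  simp only [testBit_sub_two_pow hS, Bool.and_eq_true, decide_eq_true_eq]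
  constructor
  · rintro ⟨h, h'⟩
    refine ⟨⟨h, fun v b hb => (h' v b hb).1⟩, ?_⟩
    rintro ⟨v, rfl, ha⟩
    exact (h' v a ha).2 rfl
  · rintro ⟨⟨h, h'⟩, hu⟩
    refine ⟨h, fun v b hb => ⟨h' v b hb, fun heq => hu ⟨v, ?_, ?_⟩⟩⟩
    · have h1 := Bool.toNat_lt a
      have h2 := Bool.toNat_lt b
      exact Fin.ext (by omega)
    · have h1 := Bool.toNat_lt a
      have h2 := Bool.toNat_lt b
      have : b.toNat = a.toNat := by omega
      rw [hb, show b = a by cases a <;> cases b <;> simp_all]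

/-- If the colour `a` is allowed at both joined labels, then one of the two has to forgo it. -/
theorem opt_join_of_common (i j : Fin k) (hij : i ≠ j) (e : KExpr k) (c : e.Vert → ℤ) (S : ℕ)
    (a : Bool) (hi : S.testBit (2 * (i : ℕ) + a.toNat) = true)
    (hj : S.testBit (2 * (j : ℕ) + a.toNat) = true) :
    (join i j hij e).opt c S = min ((join i j hij e).opt c (S - 2 ^ (2 * (i : ℕ) + a.toNat)))
      ((join i j hij e).opt c (S - 2 ^ (2 * (j : ℕ) + a.toNat))) := by
  apply le_antisymm
  · apply le_min
    · obtain ⟨f, hf, ho⟩ := (join i j hij e).exists_opt c (S - 2 ^ (2 * (i : ℕ) + a.toNat))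
      rw [ho]
      exact opt_le _ _ ((sol_sub_two_pow f hi).1 hf).1
    · obtain ⟨f, hf, ho⟩ := (join i j hij e).exists_opt c (S - 2 ^ (2 * (j : ℕ) + a.toNat))
      rw [ho]
      exact opt_le _ _ ((sol_sub_two_pow f hj).1 hf).1
  · obtain ⟨f, hf, ho⟩ := (join i j hij e).exists_opt c S
    rw [ho]
    have hu := ((sol_join i j hij e S f).1 hf).2 a
    by_cases h : e.Uses f i a
    · have h' : ¬ e.Uses f j a := fun h' => hu ⟨h, h'⟩
      exact (min_le_right _ _).trans (opt_le _ _ ((sol_sub_two_pow f hj).2 ⟨hf, h'⟩))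
    · exact (min_le_left _ _).trans (opt_le _ _ ((sol_sub_two_pow f hi).2 ⟨hf, h⟩))

/-- After renaming `i` to `j`, the colours at `i` are constrained as those at `j`. -/
theorem opt_rename (i j : Fin k) (e : KExpr k) (c : e.Vert → ℤ) (S S' : ℕ)
    (hS : ∀ (l : Fin k) (a : Bool), S'.testBit (2 * (l : ℕ) + a.toNat) =
      S.testBit (2 * ((if l = i then j else l : Fin k) : ℕ) + a.toNat)) :
    (rename i j e).opt c S = e.opt c S' := by
  refine opt_congr (e := rename i j e) (e' := e) c c (fun f => f) (fun f => ⟨f, rfl⟩)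
    (fun f => ?_) (fun f => rfl)
  unfold Sol
  refine and_congr Iff.rfl (forall_congr' fun v => forall_congr' fun a => imp_congr Iff.rfl ?_)
  rw [hS]
  rfl

theorem size_pos (e : KExpr k) : 0 < e.size := by
  cases e <;> simp [size]

theorem abs_cost_le (e : KExpr k) (c : e.Vert → ℤ) (f : e.Vert → Option Bool) {W : ℤ}
    (hc : ∀ v, |c v| ≤ W) : |e.cost c f| ≤ e.size * W := by
  induction e with
  | vertex i =>
    rw [cost_vertex]
    have h0 := hc ()
    simp only [size, Nat.cast_one, one_mul]
    split_ifs
    · exact h0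
    · simpa using (abs_nonneg _).trans h0
  | union e₁ e₂ ih₁ ih₂ =>
    rw [cost_union]
    have h₁ := ih₁ (fun v => c (Sum.inl v)) (fun v => f (Sum.inl v)) fun v => hc _
    have h₂ := ih₂ (fun v => c (Sum.inr v)) (fun v => f (Sum.inr v)) fun v => hc _
    have hW : 0 ≤ e₁.size * W := (abs_nonneg _).trans h₁
    have hW' : 0 ≤ W := by
      have : (0 : ℤ) < e₁.size := by exact_mod_cast e₁.size_pos
      exact nonneg_of_mul_nonneg_right hW this
    simp only [size]
    push_cast
    refine (abs_add_le _ _).trans ?_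
    linarith
  | join i j hij e ih =>
    have := ih c f hc
    have hW : 0 ≤ e.size * W := (abs_nonneg _).trans this
    have hW' : 0 ≤ W := by
      have : (0 : ℤ) < e.size := by exact_mod_cast e.size_pos
      exact nonneg_of_mul_nonneg_right hW this
    simp only [size]
    push_cast
    calc _ ≤ e.size * W := this
      _ ≤ _ := by linarith
  | rename i j e ih =>
    have := ih c f hc
    have hW : 0 ≤ e.size * W := (abs_nonneg _).trans this
    have hW' : 0 ≤ W := by
      have : (0 : ℤ) < e.size := by exact_mod_cast e.size_pos
      exact nonneg_of_mul_nonneg_right hW this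
    simp only [size]
    push_cast
    calc _ ≤ e.size * W := this
      _ ≤ _ := by linarith

theorem abs_opt_le (e : KExpr k) (c : e.Vert → ℤ) (S : ℕ) {W : ℤ} (hc : ∀ v, |c v| ≤ W) :
    |e.opt c S| ≤ e.size * W := by
  obtain ⟨f, -, ho⟩ := e.exists_opt c S
  rw [ho]
  exact e.abs_cost_le c f hc

/-- With all bits set, every colour is allowed at every label. -/
theorem sol_full (e : KExpr k) (f : e.Vert → Option Bool) :
    e.Sol (2 ^ (2 * k) - 1) f ↔ Proper e.graph f := by
  refine and_iff_left fun v a _ => ?_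
  rw [Nat.testBit_two_pow_sub_one, decide_eq_true_eq]
  have h1 := Bool.toNat_lt a
  have h2 := (e.label v).2
  omega

end KExpr

/-! ### Reasoning about programs -/

theorem Exec.mono {B B' : ℕ} (hB : B ≤ B') {P : Prog} {s s' : State} {t : ℕ}
    (h : Exec B P s t s') : Exec B' P s t s' := by
  have hB' : (B : ℤ) ≤ B' := by exact_mod_cast hB
  induction h with
  | const h => exact .const (h.trans hB')
  | op h => exact .op (h.trans hB')
  | load => exact .load
  | store => exact .store
  | seq _ _ ih ih' => exact .seq ih ih'
  | ite_true hc _ ih => exact .ite_true hc ih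
  | ite_false hc _ ih => exact .ite_false hc ih
  | loop_true hc _ _ ih ih' => exact .loop_true hc ih ih'
  | loop_false hc => exact .loop_false hc

/-- Total correctness with a time bound: from `s`, the program `P` halts within `t` steps in a state
that satisfies `Q`. -/
def Runs (B : ℕ) (P : Prog) (s : State) (t : ℕ) (Q : State → Prop) : Prop :=
  ∃ t' s', t' ≤ t ∧ Exec B P s t' s' ∧ Q s'

@[simp] theorem State.setReg_reg (s : State) (x y : ℕ) (v : ℤ) :
    (s.setReg x v).reg y = if y = x then v else s.reg y := by
  simp [State.setReg, Function.update_apply]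

@[simp] theorem State.setReg_arr (s : State) (x : ℕ) (v : ℤ) : (s.setReg x v).arr = s.arr := rfl

@[simp] theorem State.setArr_reg (s : State) (a : ℕ) (i v : ℤ) : (s.setArr a i v).reg = s.reg := rfl

@[simp] theorem State.setArr_arr (s : State) (a b : ℕ) (i v : ℤ) :
    (s.setArr a i v).arr b = if b = a then Function.update (s.arr b) i v else s.arr b := by
  by_cases h : b = a
  · subst h; simp [State.setArr]
  · simp [State.setArr, h]

/-- Sequential composition of programs. -/
infixr:60 " ;; " => Prog.seq

namespace Runs

variable {B : ℕ} {P q : Prog} {s : State} {t t' : ℕ} {Q Q' : State → Prop} {x y z a : ℕ} {o : Op}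

theorem mono (h : Runs B P s t Q) (ht : t ≤ t') (hQ : ∀ s', Q s' → Q' s') : Runs B P s t' Q' := by
  obtain ⟨u, s', hu, he, hq⟩ := h
  exact ⟨u, s', hu.trans ht, he, hQ _ hq⟩

theorem mono_time (h : Runs B P s t Q) (ht : t ≤ t') : Runs B P s t' Q := h.mono ht fun _ => id

theorem seq (h : Runs B P s t fun s' => Runs B q s' t' Q) : Runs B (P ;; q) s (t + t') Q := by
  obtain ⟨u, s', hu, he, u', s'', hu', he', hq⟩ := h
  exact ⟨u + u', s'', by omega, .seq he he', hq⟩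

theorem const {w : ℤ} (h : |w| ≤ B) (hQ : Q (s.setReg x w)) : Runs B (.const x w) s 1 Q :=
  ⟨1, _, le_rfl, .const h, hQ⟩

theorem op (v : ℤ) (hv : o.eval (s.reg y) (s.reg z) = v) (h : |v| ≤ B) (hQ : Q (s.setReg x v)) :
    Runs B (.op o x y z) s 1 Q := by
  subst hv; exact ⟨1, _, le_rfl, .op h, hQ⟩

theorem load (v : ℤ) (hv : s.arr a (s.reg y) = v) (hQ : Q (s.setReg x v)) :
    Runs B (.load x a y) s 1 Q := by
  subst hv; exact ⟨1, _, le_rfl, .load, hQ⟩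

theorem store (i v : ℤ) (hi : s.reg y = i) (hv : s.reg x = v) (hQ : Q (s.setArr a i v)) :
    Runs B (.store a y x) s 1 Q := by
  subst hi hv; exact ⟨1, _, le_rfl, .store, hQ⟩

theorem seq_const {w : ℤ} (h : |w| ≤ B) (hq : Runs B q (s.setReg x w) t Q) :
    Runs B (.const x w ;; q) s (t + 1) Q :=
  (seq (const h hq)).mono_time (by omega)

theorem seq_op (v : ℤ) (hv : o.eval (s.reg y) (s.reg z) = v) (h : |v| ≤ B)
    (hq : Runs B q (s.setReg x v) t Q) : Runs B (.op o x y z ;; q) s (t + 1) Q :=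
  (seq (op v hv h hq)).mono_time (by omega)

theorem seq_load (v : ℤ) (hv : s.arr a (s.reg y) = v) (hq : Runs B q (s.setReg x v) t Q) :
    Runs B (.load x a y ;; q) s (t + 1) Q :=
  (seq (load v hv hq)).mono_time (by omega)

theorem seq_store (i v : ℤ) (hi : s.reg y = i) (hv : s.reg x = v)
    (hq : Runs B q (s.setArr a i v) t Q) : Runs B (.store a y x ;; q) s (t + 1) Q :=
  (seq (store i v hi hv hq)).mono_time (by omega)

theorem ite {p : Prog} (h₁ : s.reg y < s.reg z → Runs B p s t Q)
    (h₂ : s.reg z ≤ s.reg y → Runs B q s t Q) : Runs B (.ite y z p q) s (t + 1) Q := by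
  by_cases hc : s.reg y < s.reg z
  · obtain ⟨u, s', hu, he, hq⟩ := h₁ hc
    exact ⟨u + 1, s', by omega, .ite_true hc he, hq⟩
  · obtain ⟨u, s', hu, he, hq⟩ := h₂ (not_lt.1 hc)
    exact ⟨u + 1, s', by omega, .ite_false hc he, hq⟩

/-- A conditional assignment. -/
theorem seq_ite {p p' : Prog} (s' : State) (h₁ : s.reg y < s.reg z → Runs B p s 1 (· = s'))
    (h₂ : s.reg z ≤ s.reg y → Runs B p' s 1 (· = s')) (hq : Runs B q s' t Q) :
    Runs B (.ite y z p p' ;; q) s (t + 2) Q :=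
  (seq (t := 2) (t' := t)
    ((ite h₁ h₂).mono le_rfl (by rintro _ rfl; exact hq))).mono_time (by omega)

/-- A loop that performs `n` iterations of at most `t` steps each; `I j` holds after `j`
iterations. -/
theorem loop (I : ℕ → State → Prop) (n : ℕ)
    (hstep : ∀ j < n, ∀ s, I j s → s.reg y < s.reg z ∧ Runs B P s t (I (j + 1)))
    (hend : ∀ s, I n s → ¬ s.reg y < s.reg z) (h0 : I 0 s) :
    Runs B (.loop y z P) s (n * (t + 1) + 1) (I n) := by
  suffices H : ∀ m j s, j + m = n → I j s → Runs B (.loop y z P) s (m * (t + 1) + 1) (I n) from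
    H n 0 s (by omega) h0
  intro m
  induction m with
  | zero =>
    intro j s hj hI
    obtain rfl : j = n := by omega
    exact ⟨1, s, by omega, .loop_false (hend s hI), hI⟩
  | succ m ih =>
    intro j s hj hI
    obtain ⟨hc, u, s', hu, he, hI'⟩ := hstep j (by omega) s hI
    obtain ⟨u', s'', hu', he', hq⟩ := ih (j + 1) s' (by omega) hI'
    exact ⟨u + u' + 1, s'', by rw [Nat.succ_mul]; omega, .loop_true hc he he', hq⟩

end Runs

/-- The program `P` can be continued from `s'` after it has spent at most `t` steps to get there from
`s`. -/
def Reaches (B : ℕ) (P : Prog) (s : State) (t : ℕ) (s' : State) : Prop :=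
  ∀ t' Q, Runs B P s' t' Q → Runs B P s (t + t') Q

theorem Reaches.trans {B : ℕ} {P : Prog} {s s' s'' : State} {t t' : ℕ} (h : Reaches B P s t s')
    (h' : Reaches B P s' t' s'') : Reaches B P s (t + t') s'' := by
  intro u Q hu
  rw [add_assoc]
  exact h _ _ (h' _ _ hu)

theorem Reaches.loop {B : ℕ} {P : Prog} {y z t : ℕ} {s s' : State} (hc : s.reg y < s.reg z)
    (h : Runs B P s t (· = s')) : Reaches B (.loop y z P) s (t + 1) s' := by
  rintro t' Q ⟨u, s'', hu, he, hq⟩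
  obtain ⟨w, _, hw, he', rfl⟩ := h
  exact ⟨w + u + 1, s'', by omega, .loop_true hc he' he, hq⟩

theorem Runs.exists_eq {B : ℕ} {P : Prog} {s : State} {t : ℕ} {Q : State → Prop}
    (h : Runs B P s t Q) : ∃ s', Runs B P s t (· = s') ∧ Q s' := by
  obtain ⟨u, s', hu, he, hq⟩ := h
  exact ⟨s', ⟨u, s', hu, he, rfl⟩, hq⟩

/-- The cells of the array `A` from `p` on hold the words of the list. -/
def Holds (A : ℤ → ℤ) : ℤ → List ℤ → Prop
  | _, [] => True
  | p, a :: L => A p = a ∧ Holds A (p + 1) L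

theorem holds_append {A : ℤ → ℤ} {L L' : List ℤ} {p : ℤ} :
    Holds A p (L ++ L') ↔ Holds A p L ∧ Holds A (p + L.length) L' := by
  induction L generalizing p with
  | nil => simp [Holds]
  | cons a L ih =>
    simp only [List.cons_append, Holds, ih, List.length_cons, and_assoc]
    push_cast
    rw [show p + 1 + (L.length : ℤ) = p + (L.length + 1) by ring]

theorem holds_of_getD {A : ℤ → ℤ} {L : List ℤ} {p : ℤ}
    (h : ∀ j < L.length, A (p + j) = L.getD j 0) : Holds A p L := by
  induction L generalizing p with
  | nil => trivial
  | cons a L ih =>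
    refine ⟨by simpa using h 0 (by simp), ih fun j hj => ?_⟩
    have := h (j + 1) (by simpa using hj)
    rw [List.getD_cons_succ] at this
    rw [← this]
    congr 1
    push_cast
    ring

theorem holds_initState (x : List ℤ) : Holds ((initState x).arr 0) 0 x :=
  holds_of_getD fun j _ => by simp [initState]

/-! ### The programs of the dynamic program -/

/-! The array `0` holds the input, the array `1` the powers of two, and the array `2` a stack of tables
of `4 ^ k` cells each; the cell `S` of the table of an expression is for its optimum under the
constraint `S`. Registers: `0` length of the input, `4` size `4 ^ k` of a table, `5` position in the
input, `6` sum `M` of the absolute values of the input words, `7` the weight `2 M + 1` that stands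
for `+∞`, `8` first free cell of the stack, `10` to `13` the constants `0` to `3`, `15` to `18` the words of
the current operation, `19` base of the topmost table, `20` to `23` the powers of two for the bits of
two labels, `30` the current cell. The registers from `30` on are scratch for the loops over a
table. -/

/-- Put the bit of register `x` that belongs to the power of two in register `p` into register `d`
(register `12` holds the number two, register `39` is scratch). -/
def bitProg (d x p : ℕ) : Prog :=
  .op .div d x p ;; .op .div 39 d 12 ;; .op .mul 39 39 12 ;; .op .sub d d 39

theorem Runs.seq_bit {B : ℕ} {q : Prog} {s : State} {t : ℕ} {Q : State → Prop} {d x p : ℕ}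
    (S b : ℕ) (hx : s.reg x = S) (hp : s.reg p = (2 ^ b : ℕ)) (h2 : s.reg 12 = 2)
    (hB : S ≤ B) (hd : d ≠ 12 ∧ d ≠ 39)
    (hq : ∀ r, Runs B q ((s.setReg 39 r).setReg d ((S.testBit b).toNat : ℕ)) t Q) :
    Runs B (bitProg d x p ;; q) s (t + 4) Q := by
  have hle : S / 2 ^ b ≤ S := Nat.div_le_self _ _
  have hle2 : S / 2 ^ b / 2 * 2 ≤ S / 2 ^ b := Nat.div_mul_le_self _ _
  have hmod : S / 2 ^ b % 2 = (S.testBit b).toNat := (Nat.toNat_testBit S b).symm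
  have habs : ∀ m : ℕ, m ≤ S → |(m : ℤ)| ≤ B := fun m hm => by
    rw [Nat.abs_cast]; exact_mod_cast hm.trans hB
  refine (Runs.seq (t := 4) (t' := t) ?_).mono_time (by omega)
  refine seq_op ((S / 2 ^ b : ℕ) : ℤ) (by simp [Op.eval, hx, hp]) (habs _ hle) ?_
  refine seq_op ((S / 2 ^ b / 2 : ℕ) : ℤ) (by simp [Op.eval, hd.1.symm, h2]) (habs _ (by omega)) ?_
  refine seq_op ((S / 2 ^ b / 2 * 2 : ℕ) : ℤ) (by simp [Op.eval, hd.1.symm, h2])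
    (habs _ (by omega)) ?_
  refine op (((S.testBit b).toNat : ℕ) : ℤ) ?_ (habs _ (by omega)) ?_
  · simp only [Op.eval, State.setReg_reg, if_pos, if_neg hd.2]
    omega
  · convert hq ((S / 2 ^ b / 2 * 2 : ℕ) : ℤ) using 1
    have h39 := hd.2
    simp only [State.setReg, State.mk.injEq, and_true]
    funext r
    simp only [Function.update_apply]
    split_ifs <;> simp_all

/-- The part of the state that the loops over the cells of a table preserve. -/
structure Frame (s₀ s : State) : Prop where
  reg : ∀ r < 30, s.reg r = s₀.reg r
  arr0 : s.arr 0 = s₀.arr 0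
  arr1 : s.arr 1 = s₀.arr 1

theorem Frame.refl (s : State) : Frame s s := ⟨fun _ _ => rfl, rfl, rfl⟩

theorem Frame.trans {s s' s'' : State} (h : Frame s s') (h' : Frame s' s'') : Frame s s'' :=
  ⟨fun r hr => (h'.reg r hr).trans (h.reg r hr), h'.arr0.trans h.arr0, h'.arr1.trans h.arr1⟩

theorem Frame.setReg {s s' : State} (h : Frame s s') {r : ℕ} (hr : 30 ≤ r) (v : ℤ) :
    Frame s (s'.setReg r v) :=
  ⟨fun x hx => by rw [State.setReg_reg, if_neg (by omega)]; exact h.reg x hx, h.arr0, h.arr1⟩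

theorem Frame.setArr {s s' : State} (h : Frame s s') (i v : ℤ) : Frame s (s'.setArr 2 i v) :=
  ⟨h.reg, by simpa using h.arr0, by simpa using h.arr1⟩

/-- Perform `body` for the values `0, 1, …` of register `30` below the number in register `4`. -/
def forTable (body : Prog) : Prog :=
  .const 30 0 ;; .loop 30 4 (body ;; .op .add 30 30 11)

/-- A loop that rewrites the table at `base` in increasing order: when the cell `S` is computed, the
cells below it hold their new values, and those from `S` on their old ones. -/
theorem Runs.forTable {B K τ : ℕ} {s₀ : State} {body : Prog} (base : ℤ) (new : ℕ → ℤ)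
    (h4 : s₀.reg 4 = K) (h11 : s₀.reg 11 = 1) (hK : K ≤ B)
    (hbody : ∀ S < K, ∀ s, Frame s₀ s → s.reg 30 = S →
      (∀ S' < S, s.arr 2 (base + S') = new S') →
      (∀ z, z < base ∨ base + S ≤ z → s.arr 2 z = s₀.arr 2 z) →
      Runs B body s τ fun s' => Frame s s' ∧ s'.reg 30 = S ∧
        s'.arr 2 = Function.update (s.arr 2) (base + S) (new S)) :
    Runs B (OCT.forTable body) s₀ (K * (τ + 2) + 2) fun s' => Frame s₀ s' ∧
      (∀ S < K, s'.arr 2 (base + S) = new S) ∧ ∀ z < base, s'.arr 2 z = s₀.arr 2 z := by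
  refine seq_const (by simp) ?_
  let I : ℕ → State → Prop := fun S s => Frame s₀ s ∧ s.reg 30 = S ∧
      (∀ S' < S, s.arr 2 (base + S') = new S') ∧
      (∀ z, z < base ∨ base + S ≤ z → s.arr 2 z = s₀.arr 2 z)
  refine (Runs.loop I K (t := τ + 1) ?_ ?_ ?_).mono le_rfl ?_
  · rintro S hS s ⟨hf, h30, hnew, hold⟩
    refine ⟨?_, ?_⟩
    · rw [h30, hf.reg 4 (by norm_num), h4]; exact_mod_cast hS
    · refine seq ((hbody S hS s hf h30 hnew hold).mono le_rfl ?_)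
      rintro s' ⟨hf', h30', harr⟩
      have hf'' := hf.trans hf'
      refine op ((S + 1 : ℕ) : ℤ) ?_ ?_ ⟨?_, ?_, ?_, ?_⟩
      · simp [Op.eval, h30', hf''.reg 11 (by norm_num), h11]
      · rw [Nat.abs_cast]; exact_mod_cast hS.trans_le hK
      · exact hf''.setReg le_rfl _
      · simp
      · intro S' hS'
        rw [State.setReg_arr, harr, Function.update_apply]
        split_ifs with h
        · congr 1; omega
        · exact hnew S' (by omega)
      · intro z hz
        rw [State.setReg_arr, harr, Function.update_of_ne (by push_cast at hz; omega)]
        exact hold z (by push_cast at hz; omega)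
  · rintro s ⟨hf, h30, -, -⟩
    rw [h30, hf.reg 4 (by norm_num), h4]; exact lt_irrefl _
  · exact ⟨(Frame.refl _).setReg le_rfl _, by simp, by simp, by simp⟩
  · rintro s ⟨hf, -, hnew, hold⟩
    exact ⟨hf, hnew, fun z hz => hold z (Or.inl hz)⟩

/-- Build the table of a single vertex on top of the stack. -/
def vertexProg : Prog :=
  .ite 10 17 (.op .add 18 7 10) (.op .add 18 18 10) ;;
  .op .add 20 16 16 ;;
  .load 20 1 20 ;;
  .ite 18 10 (.op .add 22 18 10) (.op .add 22 10 10) ;;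
  forTable (
    bitProg 31 30 20 ;;
    .op .add 32 20 20 ;;
    bitProg 33 30 32 ;;
    .op .add 31 31 33 ;;
    .op .add 34 8 30 ;;
    .ite 10 31 (.store 2 34 22) (.store 2 34 18)) ;;
  .op .add 8 8 4

/-- Replace the two topmost tables by their sum. -/
def unionProg : Prog :=
  .op .sub 8 8 4 ;;
  .op .sub 19 8 4 ;;
  forTable (
    .op .add 31 19 30 ;;
    .op .add 32 8 30 ;;
    .load 33 2 31 ;;
    .load 34 2 32 ;;
    .op .add 33 33 34 ;;
    .store 2 31 33)

/-- The base of the topmost table and the powers of two that belong to the two labels. -/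
def labelsProg : Prog :=
  .op .sub 19 8 4 ;;
  .op .add 20 16 16 ;;
  .load 20 1 20 ;;
  .op .add 21 17 17 ;;
  .load 21 1 21 ;;
  .op .add 22 20 20 ;;
  .op .add 23 21 21

/-- Write the minimum of the cells in the registers `36` and `37` to the cell in register `35`. -/
def minProg : Prog :=
  .load 36 2 36 ;;
  .load 37 2 37 ;;
  .ite 36 37 (.store 2 35 36) (.store 2 35 37)

/-- Update the topmost table for a join. If a colour is allowed at both labels, the new cell is the
minimum of two smaller cells, which are already rewritten. -/
def joinProg : Prog :=
  labelsProg ;;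
  forTable (
    bitProg 31 30 20 ;;
    bitProg 32 30 21 ;;
    .op .mul 33 31 32 ;;
    bitProg 31 30 22 ;;
    bitProg 32 30 23 ;;
    .op .mul 34 31 32 ;;
    .op .add 35 19 30 ;;
    .ite 10 33
      (.op .sub 36 35 20 ;; .op .sub 37 35 21 ;; minProg)
      (.ite 10 34
        (.op .sub 36 35 22 ;; .op .sub 37 35 23 ;; minProg)
        (.load 36 2 35 ;; .store 2 35 36)))

/-- Update the topmost table for a renaming: the new cell is the old cell of the constraint in which
the bits at the first label are replaced by those at the second. -/
def renameProg : Prog :=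
  labelsProg ;;
  forTable (
    bitProg 31 30 20 ;;
    bitProg 32 30 21 ;;
    .op .sub 32 32 31 ;;
    .op .mul 32 32 20 ;;
    .op .add 33 30 32 ;;
    bitProg 31 30 22 ;;
    bitProg 32 30 23 ;;
    .op .sub 32 32 31 ;;
    .op .mul 32 32 22 ;;
    .op .add 33 33 32 ;;
    .op .add 34 19 33 ;;
    .load 34 2 34 ;;
    .op .add 35 19 30 ;;
    .store 2 35 34)

/-- The operation that the word in register `15` prescribes. -/
def dispatchProg : Prog :=
  .ite 15 11 vertexProg (.ite 15 12 unionProg (.ite 15 13 joinProg renameProg))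

/-- Read one operation of the expression and perform it on the stack of tables. -/
def stepProg : Prog :=
  .load 15 0 5 ;;
  .op .add 5 5 11 ;;
  .load 16 0 5 ;;
  .op .add 5 5 11 ;;
  .load 17 0 5 ;;
  .op .add 5 5 11 ;;
  .load 18 0 5 ;;
  .op .add 5 5 11 ;;
  dispatchProg

/-- What holds between two operations of an expression of size `n`: constants, powers of two, and the
input `A` of length `len`. The bounds say that words are large enough for the positions in the stack
and for all entries of the tables. -/
structure Env (B k n : ℕ) (W : ℤ) (A : ℤ → ℤ) (len : ℕ) (s : State) : Prop where
  r0 : s.reg 0 = len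
  r4 : s.reg 4 = (2 ^ (2 * k) : ℕ)
  r6 : 2 * s.reg 6 + 1 = W
  r7 : s.reg 7 = W
  r10 : s.reg 10 = 0
  r11 : s.reg 11 = 1
  r12 : s.reg 12 = 2
  r13 : s.reg 13 = 3
  arr0 : s.arr 0 = A
  pow : ∀ b < 2 * k, s.arr 1 (b : ℤ) = (2 ^ b : ℕ)
  lenB : len + 4 ≤ B
  stackB : (n + 2) * 2 ^ (2 * k) ≤ B
  valueB : n * W ≤ B
  W_nonneg : 0 ≤ W
  WB : W ≤ B

theorem Env.frame {B k n : ℕ} {W : ℤ} {A : ℤ → ℤ} {len : ℕ} {s s' : State}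
    (h : Env B k n W A len s) (hf : Frame s s') : Env B k n W A len s' where
  r0 := by rw [hf.reg 0 (by norm_num), h.r0]
  r4 := by rw [hf.reg 4 (by norm_num), h.r4]
  r6 := by rw [hf.reg 6 (by norm_num), h.r6]
  r7 := by rw [hf.reg 7 (by norm_num), h.r7]
  r10 := by rw [hf.reg 10 (by norm_num), h.r10]
  r11 := by rw [hf.reg 11 (by norm_num), h.r11]
  r12 := by rw [hf.reg 12 (by norm_num), h.r12]
  r13 := by rw [hf.reg 13 (by norm_num), h.r13]
  arr0 := by rw [hf.arr0, h.arr0]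
  pow := by rw [hf.arr1]; exact h.pow
  lenB := h.lenB
  stackB := h.stackB
  valueB := h.valueB
  W_nonneg := h.W_nonneg
  WB := h.WB

theorem Env.setReg {B k n : ℕ} {W : ℤ} {A : ℤ → ℤ} {len : ℕ} {s : State}
    (h : Env B k n W A len s) {r : ℕ} (v : ℤ) (hr : r ∉ [0, 4, 6, 7, 10, 11, 12, 13]) :
    Env B k n W A len (s.setReg r v) := by
  simp only [List.mem_cons, List.not_mem_nil, not_or, or_false] at hr
  obtain ⟨h0, h4, h6, h7, h10, h11, h12, h13⟩ := hr
  constructor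
  case r0 => simpa [Ne.symm h0] using h.r0
  case r4 => simpa [Ne.symm h4] using h.r4
  case r6 => simpa [Ne.symm h6] using h.r6
  case r7 => simpa [Ne.symm h7] using h.r7
  case r10 => simpa [Ne.symm h10] using h.r10
  case r11 => simpa [Ne.symm h11] using h.r11
  case r12 => simpa [Ne.symm h12] using h.r12
  case r13 => simpa [Ne.symm h13] using h.r13
  case arr0 => exact h.arr0
  case pow => exact h.pow
  case lenB => exact h.lenB
  case stackB => exact h.stackB
  case valueB => exact h.valueB
  case W_nonneg => exact h.W_nonneg
  case WB => exact h.WB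

/-! ### Correctness of the dynamic program -/

/-- The topmost table of the stack is the table number `D`, with the entries `tbl`; the tables below
are as in `s₀`. -/
structure Top (k : ℕ) (s₀ : State) (D : ℕ) (tbl : ℕ → ℤ) (s : State) : Prop where
  ptr : s.reg 5 = s₀.reg 5
  top : s.reg 8 = ((D + 1) * 2 ^ (2 * k) : ℕ)
  tbl : ∀ S : ℕ, S < 2 ^ (2 * k) → s.arr 2 ((D * 2 ^ (2 * k) : ℕ) + (S : ℤ)) = tbl S
  below : ∀ z < ((D * 2 ^ (2 * k) : ℕ) : ℤ), s.arr 2 z = s₀.arr 2 z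

theorem natCast_abs_le {m B : ℕ} (h : m ≤ B) : |(m : ℤ)| ≤ B := by
  rw [Nat.abs_cast]; exact_mod_cast h

theorem two_pow_le_of_lt {b k : ℕ} (hb : b < 2 * k) : 2 * 2 ^ b ≤ 2 ^ (2 * k) := by
  rw [← pow_succ']; exact Nat.pow_le_pow_right (by norm_num) hb

theorem runs_vertexProg {B k n len : ℕ} {W : ℤ} {A : ℤ → ℤ} {s : State}
    (hE : Env B k n W A len s) {D i : ℕ} {flag w w' : ℤ} (hD : D + 1 ≤ n) (hi : i < k)
    (h8 : s.reg 8 = (D * 2 ^ (2 * k) : ℕ)) (h16 : s.reg 16 = i) (h17 : s.reg 17 = flag)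
    (h18 : s.reg 18 = w) (hw' : w' = if 0 < flag then W else w) (hW : |w'| ≤ B) :
    Runs B vertexProg s (2 ^ (2 * k) * 50 + 20) fun s' => Env B k n W A len s' ∧
      Top k s D (fun S => if S.testBit (2 * i) = true ∨ S.testBit (2 * i + 1) = true
        then min 0 w' else w') s' := by
  have hst : (D + 1) * 2 ^ (2 * k) ≤ B :=
    (Nat.mul_le_mul_right _ (by omega)).trans hE.stackB
  have hst1 : D * 2 ^ (2 * k) + 2 ^ (2 * k) ≤ B := by rw [← Nat.succ_mul]; exact hst
  have hlen := hE.lenB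
  have hp := two_pow_le_of_lt (b := 2 * i) (k := k) (by omega)
  have hpow := hE.pow (2 * i) (by omega)
  have hiK : 2 * i ≤ 2 ^ (2 * k) :=
    (Nat.lt_two_pow_self (n := 2 * i)).le.trans (Nat.pow_le_pow_right (by norm_num) (by omega))
  have hpp : ((2 ^ (2 * i + 1) : ℕ) : ℤ) = (2 ^ (2 * i) : ℕ) + (2 ^ (2 * i) : ℕ) := by
    push_cast; ring
  refine (Runs.seq_ite (t := 2 ^ (2 * k) * 50 + 18) (s.setReg 18 w') (fun hc => ?_) (fun hc => ?_) ?_)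
  · rw [hE.r10, h17] at hc
    rw [if_pos hc] at hw'
    exact Runs.op w' (by simp [Op.eval, hE.r7, hE.r10, hw']) hW rfl
  · rw [hE.r10, h17] at hc
    rw [if_neg (not_lt.2 hc)] at hw'
    exact Runs.op w' (by simp [Op.eval, h18, hE.r10, hw']) hW rfl
  refine Runs.seq_op ((2 * i : ℕ) : ℤ) (by simp [Op.eval, h16, two_mul])
    (natCast_abs_le (by omega)) ?_
  refine Runs.seq_load ((2 ^ (2 * i) : ℕ) : ℤ) (by simpa using hpow) ?_
  refine Runs.seq_ite (((((s.setReg 18 w').setReg 20 (2 * i : ℕ)).setReg 20 (2 ^ (2 * i) : ℕ))).setReg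
    22 (min 0 w')) (fun hc => ?_) (fun hc => ?_) ?_
  · simp only [State.setReg_reg] at hc
    simp [hE.r10] at hc
    exact Runs.op _ (by simp [Op.eval, hE.r10, hc.le]) (by rw [min_eq_right hc.le]; exact hW) rfl
  · simp only [State.setReg_reg] at hc
    simp [hE.r10] at hc
    exact Runs.op _ (by simp [Op.eval, hE.r10, hc]) (by rw [min_eq_left hc]; simp) rfl
  set s₁ := (((s.setReg 18 w').setReg 20 (2 * i : ℕ)).setReg 20 (2 ^ (2 * i) : ℕ)).setReg
    22 (min 0 w') with hs₁
  have hE₁ : Env B k n W A len s₁ := by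
    rw [hs₁]
    exact (((hE.setReg _ (by simp)).setReg _ (by simp)).setReg _ (by simp)).setReg _ (by simp)
  refine (Runs.seq ((Runs.forTable (τ := 40) ((D * 2 ^ (2 * k) : ℕ) : ℤ)
    (fun S => if S.testBit (2 * i) = true ∨ S.testBit (2 * i + 1) = true then min 0 w' else w')
    hE₁.r4 hE₁.r11 (by omega) ?_).mono (t' := 2 ^ (2 * k) * 50 + 3) (by omega) ?_)).mono_time (t := _ + 1) (by omega)
  · intro S hS s' hf h30 hnew hold
    have hE' := hE₁.frame hf
    have e20 : s'.reg 20 = (2 ^ (2 * i) : ℕ) := by rw [hf.reg 20 (by norm_num)]; simp [hs₁]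
    have e18 : s'.reg 18 = w' := by rw [hf.reg 18 (by norm_num)]; simp [hs₁]
    have e22 : s'.reg 22 = min 0 w' := by rw [hf.reg 22 (by norm_num)]; simp [hs₁]
    have e8 : s'.reg 8 = (D * 2 ^ (2 * k) : ℕ) := by
      rw [hf.reg 8 (by norm_num)]; simpa [hs₁] using h8
    refine (Runs.seq_bit (t := 36) S (2 * i) h30 e20 hE'.r12 (by omega) (by norm_num) fun r => ?_)
    refine Runs.seq_op ((2 ^ (2 * i + 1) : ℕ) : ℤ) (by simp [Op.eval, e20, hpp])
      (natCast_abs_le (by rw [pow_succ']; omega)) ?_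
    refine Runs.seq_bit S (2 * i + 1) (by simp [h30]) (by simp) (by simp [hE'.r12]) (by omega)
      (by norm_num) fun r' => ?_
    refine Runs.seq_op (((S.testBit (2 * i)).toNat + (S.testBit (2 * i + 1)).toNat : ℕ) : ℤ)
      (by simp [Op.eval]) (natCast_abs_le ?_) ?_
    · have := Bool.toNat_lt (S.testBit (2 * i))
      have := Bool.toNat_lt (S.testBit (2 * i + 1))
      omega
    refine Runs.seq_op ((D * 2 ^ (2 * k) + S : ℕ) : ℤ) (by simp [Op.eval, e8, h30])
      (natCast_abs_le (by omega)) ?_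
    refine (Runs.ite (t := 1) (fun hc => ?_) fun hc => ?_).mono_time (by norm_num)
    · simp [hE'.r10] at hc
      refine Runs.store (D * 2 ^ (2 * k) + S : ℕ) (min 0 w') (by simp) (by simp [e22]) ⟨?_, ?_, ?_⟩
      · repeat first | exact Frame.refl _ | apply Frame.setArr | refine Frame.setReg ?_ (by norm_num) _
      · simp [h30]
      · rw [if_pos (by revert hc; cases S.testBit (2 * i) <;> cases S.testBit (2 * i + 1) <;> simp)]
        simp
    · simp [hE'.r10] at hc
      refine Runs.store (D * 2 ^ (2 * k) + S : ℕ) w' (by simp) (by simp [e18]) ⟨?_, ?_, ?_⟩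
      · repeat first | exact Frame.refl _ | apply Frame.setArr | refine Frame.setReg ?_ (by norm_num) _
      · simp [h30]
      · rw [if_neg (by revert hc; cases S.testBit (2 * i) <;> cases S.testBit (2 * i + 1) <;> simp)]
        simp
  · rintro s' ⟨hf, hnew, hold⟩
    have hE' := hE₁.frame hf
    have e8 : s'.reg 8 = (D * 2 ^ (2 * k) : ℕ) := by
      rw [hf.reg 8 (by norm_num)]; simpa [hs₁] using h8
    have e5 : s'.reg 5 = s.reg 5 := by
      rw [hf.reg 5 (by norm_num)]; simp [hs₁]
    refine Runs.op (((D + 1) * 2 ^ (2 * k) : ℕ) : ℤ) ?_ (natCast_abs_le hst)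
      ⟨hE'.setReg _ (by simp), ?_, ?_, ?_, ?_⟩
    · simp only [Op.eval, e8, hE'.r4]; push_cast; ring
    · simp [e5]
    · simp
    · simpa using hnew
    · intro z hz
      rw [State.setReg_arr, hold z hz, hs₁]
      rfl

theorem runs_unionProg {B k n len : ℕ} {W : ℤ} {A : ℤ → ℤ} {s : State}
    (hE : Env B k n W A len s) {D : ℕ} {f g : ℕ → ℤ} (hD : D + 1 ≤ n)
    (h8 : s.reg 8 = ((D + 2) * 2 ^ (2 * k) : ℕ))
    (hf : ∀ S : ℕ, S < 2 ^ (2 * k) → s.arr 2 ((D * 2 ^ (2 * k) : ℕ) + (S : ℤ)) = f S)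
    (hg : ∀ S : ℕ, S < 2 ^ (2 * k) → s.arr 2 (((D + 1) * 2 ^ (2 * k) : ℕ) + (S : ℤ)) = g S)
    (hfg : ∀ S, |f S + g S| ≤ B) :
    Runs B unionProg s (2 ^ (2 * k) * 50 + 20) fun s' => Env B k n W A len s' ∧
      Top k s D (fun S => f S + g S) s' := by
  have hst : (D + 2) * 2 ^ (2 * k) ≤ B :=
    (Nat.mul_le_mul_right _ (by omega)).trans hE.stackB
  have e2 : (D + 2) * 2 ^ (2 * k) = D * 2 ^ (2 * k) + 2 * 2 ^ (2 * k) := by ring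
  have e1 : (D + 1) * 2 ^ (2 * k) = D * 2 ^ (2 * k) + 2 ^ (2 * k) := by ring
  rw [e2] at hst
  refine Runs.seq_op (((D + 1) * 2 ^ (2 * k) : ℕ) : ℤ)
    (by simp only [Op.eval, h8, hE.r4]; push_cast; ring) (natCast_abs_le (by omega)) ?_
  refine Runs.seq_op ((D * 2 ^ (2 * k) : ℕ) : ℤ)
    (by simp [Op.eval, hE.r4]; ring) (natCast_abs_le (by omega)) ?_
  set s₁ := (s.setReg 8 ((D + 1) * 2 ^ (2 * k) : ℕ)).setReg 19 (D * 2 ^ (2 * k) : ℕ) with hs₁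
  have hE₁ : Env B k n W A len s₁ := (hE.setReg _ (by simp)).setReg _ (by simp)
  refine (Runs.forTable (τ := 40) ((D * 2 ^ (2 * k) : ℕ) : ℤ) (fun S => f S + g S)
    hE₁.r4 hE₁.r11 (by omega) ?_).mono (by omega) ?_
  · intro S hS s' hF h30 hnew hold
    have hE' := hE₁.frame hF
    have e8 : s'.reg 8 = ((D + 1) * 2 ^ (2 * k) : ℕ) := by
      rw [hF.reg 8 (by norm_num)]; simp [hs₁]
    have e19 : s'.reg 19 = (D * 2 ^ (2 * k) : ℕ) := by
      rw [hF.reg 19 (by norm_num)]; simp [hs₁]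
    have hf' : s'.arr 2 ((D * 2 ^ (2 * k) + S : ℕ) : ℤ) = f S := by
      rw [hold _ (Or.inr (by push_cast; exact le_rfl)), ← hf S hS, hs₁]
      push_cast; rfl
    have hg' : s'.arr 2 (((D + 1) * 2 ^ (2 * k) + S : ℕ) : ℤ) = g S := by
      rw [hold _ (Or.inr (by rw [e1]; simp only [Nat.cast_add]; omega)), ← hg S hS, hs₁]
      push_cast; rfl
    refine Runs.seq_op ((D * 2 ^ (2 * k) + S : ℕ) : ℤ) (by simp [Op.eval, e19, h30])
      (natCast_abs_le (by omega)) ?_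
    refine Runs.seq_op (((D + 1) * 2 ^ (2 * k) + S : ℕ) : ℤ) (by simp [Op.eval, e8, h30])
      (natCast_abs_le (by omega)) ?_
    refine Runs.seq_load (f S) (by rw [← hf']; simp) ?_
    refine Runs.seq_load (g S) (by rw [← hg']; simp) ?_
    refine Runs.seq_op (f S + g S) (by simp [Op.eval]) (hfg S) ?_
    refine (Runs.store ((D * 2 ^ (2 * k) + S : ℕ) : ℤ) (f S + g S) (by simp) (by simp)
      ⟨?_, ?_, ?_⟩).mono_time (t := 1) (by norm_num)
    · repeat first | exact Frame.refl _ | apply Frame.setArr | refine Frame.setReg ?_ (by norm_num) _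
    · simp [h30]
    · simp
  · rintro s' ⟨hF, hnew, hold⟩
    refine ⟨hE₁.frame hF, ?_, ?_, hnew, ?_⟩
    · rw [hF.reg 5 (by norm_num)]; simp [hs₁]
    · rw [hF.reg 8 (by norm_num)]; simp [hs₁]
    · intro z hz
      rw [hold z hz, hs₁]
      rfl

/-- The preparations of a join or a renaming, followed by a loop over the topmost table. -/
theorem runs_labelsProg {B k n len : ℕ} {W : ℤ} {A : ℤ → ℤ} {s : State}
    (hE : Env B k n W A len s) {D i j : ℕ} {f new : ℕ → ℤ} {body : Prog} (hD : D + 1 ≤ n)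
    (hi : i < k) (hj : j < k) (h8 : s.reg 8 = ((D + 1) * 2 ^ (2 * k) : ℕ))
    (h16 : s.reg 16 = i) (h17 : s.reg 17 = j)
    (hf : ∀ S : ℕ, S < 2 ^ (2 * k) → s.arr 2 ((D * 2 ^ (2 * k) : ℕ) + (S : ℤ)) = f S)
    (hbody : ∀ S : ℕ, S < 2 ^ (2 * k) → ∀ s', Env B k n W A len s' → s'.reg 30 = S →
      s'.reg 19 = (D * 2 ^ (2 * k) : ℕ) →
      s'.reg 20 = (2 ^ (2 * i) : ℕ) → s'.reg 21 = (2 ^ (2 * j) : ℕ) →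
      s'.reg 22 = (2 ^ (2 * i + 1) : ℕ) → s'.reg 23 = (2 ^ (2 * j + 1) : ℕ) →
      (∀ S' < S, s'.arr 2 ((D * 2 ^ (2 * k) + S' : ℕ) : ℤ) = new S') →
      (∀ S', S ≤ S' → S' < 2 ^ (2 * k) →
        s'.arr 2 ((D * 2 ^ (2 * k) + S' : ℕ) : ℤ) = f S') →
      Runs B body s' 48 fun s'' => Frame s' s'' ∧ s''.reg 30 = S ∧
        s''.arr 2 = Function.update (s'.arr 2) ((D * 2 ^ (2 * k) : ℕ) + S) (new S)) :
    Runs B (labelsProg ;; forTable body) s (2 ^ (2 * k) * 50 + 20) fun s' =>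
      Env B k n W A len s' ∧ Top k s D new s' := by
  have hst : (D + 1) * 2 ^ (2 * k) ≤ B :=
    (Nat.mul_le_mul_right _ (by omega)).trans hE.stackB
  have e1 : (D + 1) * 2 ^ (2 * k) = D * 2 ^ (2 * k) + 2 ^ (2 * k) := by ring
  have hpi := two_pow_le_of_lt (b := 2 * i) (k := k) (by omega)
  have hpj := two_pow_le_of_lt (b := 2 * j) (k := k) (by omega)
  have hiK : 2 * i < 2 ^ (2 * i) := Nat.lt_two_pow_self
  have hjK : 2 * j < 2 ^ (2 * j) := Nat.lt_two_pow_self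
  have hpowi := hE.pow (2 * i) (by omega)
  have hpowj := hE.pow (2 * j) (by omega)
  refine (Runs.seq (t := 7) (t' := 2 ^ (2 * k) * 50 + 2) ?_).mono_time (by omega)
  refine Runs.seq_op ((D * 2 ^ (2 * k) : ℕ) : ℤ)
    (by simp only [Op.eval, h8, hE.r4]; push_cast; ring) (natCast_abs_le (by omega)) ?_
  refine Runs.seq_op ((2 * i : ℕ) : ℤ) (by simp [Op.eval, h16, two_mul])
    (natCast_abs_le (by omega)) ?_
  refine Runs.seq_load ((2 ^ (2 * i) : ℕ) : ℤ) (by simpa using hpowi) ?_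
  refine Runs.seq_op ((2 * j : ℕ) : ℤ) (by simp [Op.eval, h17, two_mul])
    (natCast_abs_le (by omega)) ?_
  refine Runs.seq_load ((2 ^ (2 * j) : ℕ) : ℤ) (by simpa using hpowj) ?_
  refine Runs.seq_op ((2 ^ (2 * i + 1) : ℕ) : ℤ) (by simp [Op.eval, pow_succ, mul_two])
    (natCast_abs_le (by rw [pow_succ']; omega)) ?_
  refine Runs.op ((2 ^ (2 * j + 1) : ℕ) : ℤ) (by simp [Op.eval, pow_succ, mul_two])
    (natCast_abs_le (by rw [pow_succ']; omega)) ?_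
  set s₁ := ((((((s.setReg 19 (D * 2 ^ (2 * k) : ℕ)).setReg 20 (2 * i : ℕ)).setReg 20
    (2 ^ (2 * i) : ℕ)).setReg 21 (2 * j : ℕ)).setReg 21 (2 ^ (2 * j) : ℕ)).setReg 22
    (2 ^ (2 * i + 1) : ℕ)).setReg 23 (2 ^ (2 * j + 1) : ℕ) with hs₁
  have hE₁ : Env B k n W A len s₁ := by
    rw [hs₁]
    repeat first | exact hE | refine Env.setReg ?_ _ (by simp)
  refine (Runs.forTable (τ := 48) ((D * 2 ^ (2 * k) : ℕ) : ℤ) new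
    hE₁.r4 hE₁.r11 (by omega) ?_).mono (by omega) ?_
  · intro S hS s' hF h30 hnew hold
    refine hbody S hS s' (hE₁.frame hF) h30 ?_ ?_ ?_ ?_ ?_ ?_ ?_
    · rw [hF.reg _ (by norm_num)]; simp [hs₁]
    · rw [hF.reg _ (by norm_num)]; simp [hs₁]
    · rw [hF.reg _ (by norm_num)]; simp [hs₁]
    · rw [hF.reg _ (by norm_num)]; simp [hs₁]
    · rw [hF.reg _ (by norm_num)]; simp [hs₁]
    · intro S' hS'
      rw [← hnew S' hS']; push_cast; rfl
    · intro S' hS' hK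
      rw [hold _ (Or.inr (by push_cast; omega)), ← hf S' hK, hs₁]
      push_cast; rfl
  · rintro s' ⟨hF, hnew, hold⟩
    refine ⟨hE₁.frame hF, ?_, ?_, hnew, ?_⟩
    · rw [hF.reg 5 (by norm_num)]; simp [hs₁]
    · rw [hF.reg 8 (by norm_num)]; simpa [hs₁] using h8
    · intro z hz
      rw [hold z hz, hs₁]
      rfl

theorem runs_minProg {B : ℕ} {s : State} {a b v w : ℤ} (hv : s.arr 2 (s.reg 36) = v)
    (hw : s.arr 2 (s.reg 37) = w) (ha : s.reg 35 = a) (hb : b = min v w) :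
    Runs B minProg s 4 fun s' => Frame s s' ∧ s'.reg 30 = s.reg 30 ∧
      s'.arr 2 = Function.update (s.arr 2) a b := by
  refine Runs.seq_load v hv ?_
  refine Runs.seq_load w (by simpa using hw) ?_
  refine Runs.ite (t := 1) (fun hc => ?_) fun hc => ?_
  · simp at hc
    refine Runs.store a v (by simpa using ha) (by simp) ⟨?_, by simp, ?_⟩
    · repeat first | exact Frame.refl _ | apply Frame.setArr | refine Frame.setReg ?_ (by norm_num) _
    · rw [hb, min_eq_left hc.le]; simp
  · simp at hc
    refine Runs.store a w (by simpa using ha) (by simp) ⟨?_, by simp, ?_⟩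
    · repeat first | exact Frame.refl _ | apply Frame.setArr | refine Frame.setReg ?_ (by norm_num) _
    · rw [hb, min_eq_right hc]; simp

theorem runs_joinProg {B k n len : ℕ} {W : ℤ} {A : ℤ → ℤ} {s : State}
    (hE : Env B k n W A len s) {D : ℕ} {i j : Fin k} (hij : i ≠ j) (e : KExpr k) (c : e.Vert → ℤ)
    (hD : D + 1 ≤ n) (h8 : s.reg 8 = ((D + 1) * 2 ^ (2 * k) : ℕ))
    (h16 : s.reg 16 = (i : ℕ)) (h17 : s.reg 17 = (j : ℕ))
    (hf : ∀ S : ℕ, S < 2 ^ (2 * k) → s.arr 2 ((D * 2 ^ (2 * k) : ℕ) + (S : ℤ)) = e.opt c S) :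
    Runs B joinProg s (2 ^ (2 * k) * 50 + 20) fun s' => Env B k n W A len s' ∧
      Top k s D (fun S => (KExpr.join i j hij e).opt c S) s' := by
  refine runs_labelsProg hE hD i.2 j.2 h8 h16 h17 hf ?_
  intro S hS s' hE' h30 e19 e20 e21 e22 e23 hnew hold
  have hst : (D + 1) * 2 ^ (2 * k) ≤ B :=
    (Nat.mul_le_mul_right _ (by omega)).trans hE.stackB
  have e1 : (D + 1) * 2 ^ (2 * k) = D * 2 ^ (2 * k) + 2 ^ (2 * k) := by ring
  have hand : ∀ a b : Bool, ((a && b).toNat : ℤ) = a.toNat * b.toNat := by decide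
  have hle : ∀ a : Bool, |(a.toNat : ℤ)| ≤ B := fun a =>
    natCast_abs_le ((Bool.toNat_le a).trans (by have := hE.lenB; omega))
  refine Runs.seq_bit (t := 44) S (2 * i) h30 e20 hE'.r12 (by omega) (by norm_num) fun r₁ => ?_
  refine Runs.seq_bit S (2 * j) (by simp [h30]) (by simp [e21]) (by simp [hE'.r12]) (by omega)
    (by norm_num) fun r₂ => ?_
  refine Runs.seq_op ((S.testBit (2 * i) && S.testBit (2 * j)).toNat : ℕ)
    (by simp [Op.eval, hand]) (hle _) ?_
  refine Runs.seq_bit S (2 * i + 1) (by simp [h30]) (by simp [e22]) (by simp [hE'.r12]) (by omega)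
    (by norm_num) fun r₃ => ?_
  refine Runs.seq_bit S (2 * j + 1) (by simp [h30]) (by simp [e23]) (by simp [hE'.r12]) (by omega)
    (by norm_num) fun r₄ => ?_
  refine Runs.seq_op ((S.testBit (2 * i + 1) && S.testBit (2 * j + 1)).toNat : ℕ)
    (by simp [Op.eval, hand]) (hle _) ?_
  refine Runs.seq_op ((D * 2 ^ (2 * k) + S : ℕ) : ℤ) (by simp [Op.eval, e19, h30])
    (natCast_abs_le (by omega)) ?_
  have hmin : ∀ (a : Bool) (s'' : State) (x y : ℕ), Frame s' s'' → s''.reg 30 = S →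
      s''.arr 2 = s'.arr 2 → s''.reg 35 = (D * 2 ^ (2 * k) + S : ℕ) → x < 36 → y < 36 →
      s''.reg x = (2 ^ (2 * (i : ℕ) + a.toNat) : ℕ) → s''.reg y = (2 ^ (2 * (j : ℕ) + a.toNat) : ℕ) →
      S.testBit (2 * (i : ℕ) + a.toNat) = true → S.testBit (2 * (j : ℕ) + a.toNat) = true →
      Runs B (.op .sub 36 35 x ;; .op .sub 37 35 y ;; minProg) s'' 6 fun s₂ =>
        Frame s' s₂ ∧ s₂.reg 30 = S ∧ s₂.arr 2 =
          Function.update (s'.arr 2) ((D * 2 ^ (2 * k) : ℕ) + (S : ℤ))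
            ((KExpr.join i j hij e).opt c S) := by
    intro a s'' x y hF h30' harr h35 hx hy hxi hyj hbi hbj
    have hi := Nat.ge_two_pow_of_testBit hbi
    have hj := Nat.ge_two_pow_of_testBit hbj
    have hi0 : 0 < 2 ^ (2 * (i : ℕ) + a.toNat) := by positivity
    have hj0 : 0 < 2 ^ (2 * (j : ℕ) + a.toNat) := by positivity
    refine Runs.seq_op ((D * 2 ^ (2 * k) + (S - 2 ^ (2 * (i : ℕ) + a.toNat)) : ℕ) : ℤ) ?_
      (natCast_abs_le (by omega)) ?_
    · simp only [Op.eval, h35, hxi]; push_cast [hi]; ring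
    refine Runs.seq_op ((D * 2 ^ (2 * k) + (S - 2 ^ (2 * (j : ℕ) + a.toNat)) : ℕ) : ℤ) ?_
      (natCast_abs_le (by omega)) ?_
    · simp [Op.eval, h35, hyj, hy.ne]; push_cast [hj]; ring
    refine (runs_minProg (v := (KExpr.join i j hij e).opt c (S - 2 ^ (2 * (i : ℕ) + a.toNat)))
      (w := (KExpr.join i j hij e).opt c (S - 2 ^ (2 * (j : ℕ) + a.toNat)))
      (a := ((D * 2 ^ (2 * k) + S : ℕ) : ℤ)) (b := (KExpr.join i j hij e).opt c S)
      ?_ ?_ ?_ ?_).mono le_rfl ?_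
    · rw [← hnew _ (by omega), ← harr]; simp
    · rw [← hnew _ (by omega), ← harr]; simp
    · simp [h35]
    · exact KExpr.opt_join_of_common i j hij e c S a hbi hbj
    · rintro s₂ ⟨hF₂, h30₂, harr₂⟩
      refine ⟨?_, by simpa [h30'] using h30₂, ?_⟩
      · refine Frame.trans ?_ hF₂
        repeat first | exact hF | refine Frame.setReg ?_ (by norm_num) _
      · rw [harr₂, State.setReg_arr, State.setReg_arr, harr]; push_cast; rfl
  refine (Runs.ite (t := 10) (fun hc => ?_) fun hc => ?_).mono_time (by norm_num)
  · simp [hE'.r10] at hc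
    refine (hmin false _ 20 21 ?_ (by simp [h30]) (by simp) (by simp) (by simp) (by simp)
      (by simp [e20]) (by simp [e21]) ?_ ?_).mono_time (by norm_num)
    · repeat first | exact Frame.refl _ | refine Frame.setReg ?_ (by norm_num) _
    · revert hc; simp; cases S.testBit (2 * i) <;> simp
    · revert hc; simp; cases S.testBit (2 * i) <;> cases S.testBit (2 * j) <;> simp
  · simp [hE'.r10] at hc
    refine (Runs.ite (t := 9) (fun hc' => ?_) fun hc' => ?_).mono_time (by norm_num)
    · simp [hE'.r10] at hc'
      refine (hmin true _ 22 23 ?_ (by simp [h30]) (by simp) (by simp) (by simp) (by simp)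
        (by simp [e22]) (by simp [e23]) ?_ ?_).mono_time (by norm_num)
      · repeat first | exact Frame.refl _ | refine Frame.setReg ?_ (by norm_num) _
      · revert hc'; simp; cases S.testBit (2 * i + 1) <;> simp
      · revert hc'; simp; cases S.testBit (2 * i + 1) <;> cases S.testBit (2 * j + 1) <;> simp
    · simp [hE'.r10] at hc'
      refine (Runs.seq_load (t := 1) (e.opt c S) ?_ (Runs.store (D * 2 ^ (2 * k) + S : ℕ) (e.opt c S)
        (by simp) (by simp) ⟨?_, by simp [h30], ?_⟩)).mono_time (by norm_num)
      · rw [← hold S le_rfl hS]; simp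
      · repeat first | exact Frame.refl _ | apply Frame.setArr | refine Frame.setReg ?_ (by norm_num) _
      · rw [KExpr.opt_join_of_disjoint]
        · simp
        · rintro (_ | _) ⟨h1, h2⟩
          · simp at h1 h2; simp [h1, h2] at hc
          · simp at h1 h2; simp [h1, h2] at hc'

theorem runs_renameProg {B k n len : ℕ} {W : ℤ} {A : ℤ → ℤ} {s : State}
    (hE : Env B k n W A len s) {D : ℕ} {i j : Fin k} (e : KExpr k) (c : e.Vert → ℤ)
    (hD : D + 1 ≤ n) (h8 : s.reg 8 = ((D + 1) * 2 ^ (2 * k) : ℕ))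
    (h16 : s.reg 16 = (i : ℕ)) (h17 : s.reg 17 = (j : ℕ))
    (hf : ∀ S : ℕ, S < 2 ^ (2 * k) → s.arr 2 ((D * 2 ^ (2 * k) : ℕ) + (S : ℤ)) = e.opt c S) :
    Runs B renameProg s (2 ^ (2 * k) * 50 + 20) fun s' => Env B k n W A len s' ∧
      Top k s D (fun S => (KExpr.rename i j e).opt c S) s' := by
  refine runs_labelsProg hE hD i.2 j.2 h8 h16 h17 hf ?_
  intro S hS s' hE' h30 e19 e20 e21 e22 e23 hnew hold
  have hst : (D + 1) * 2 ^ (2 * k) ≤ B :=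
    (Nat.mul_le_mul_right _ (by omega)).trans hE.stackB
  have e1 : (D + 1) * 2 ^ (2 * k) = D * 2 ^ (2 * k) + 2 ^ (2 * k) := by ring
  have hst2 : 2 * 2 ^ (2 * k) ≤ B := (Nat.mul_le_mul_right _ (by omega)).trans hE.stackB
  have hpi := two_pow_le_of_lt (b := 2 * i) (k := k) (by omega)
  have hpi' := two_pow_le_of_lt (b := 2 * i + 1) (k := k) (by omega)
  -- the number whose bits at `i` are those of `S` at `j`
  obtain ⟨T, hT⟩ : ∃ T, T + (S.testBit (2 * i)).toNat * 2 ^ (2 * (i : ℕ)) =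
      S + (S.testBit (2 * j)).toNat * 2 ^ (2 * (i : ℕ)) := by
    refine ⟨S + (S.testBit (2 * j)).toNat * 2 ^ (2 * (i : ℕ)) -
      (S.testBit (2 * i)).toNat * 2 ^ (2 * (i : ℕ)), Nat.sub_add_cancel ?_⟩
    by_cases hb : S.testBit (2 * i) = true
    · have := Nat.ge_two_pow_of_testBit hb
      simp only [hb, Bool.toNat_true]; omega
    · simp [hb]
  have hTbit := testBit_replace (S := S) (S' := T) (b := 2 * i) (d' := S.testBit (2 * j)) rfl hT
  have hT1 : T.testBit (2 * i + 1) = S.testBit (2 * i + 1) := by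
    rw [hTbit, if_neg (by omega)]
  obtain ⟨T', hT'⟩ : ∃ T', T' + (S.testBit (2 * i + 1)).toNat * 2 ^ (2 * (i : ℕ) + 1) =
      T + (S.testBit (2 * j + 1)).toNat * 2 ^ (2 * (i : ℕ) + 1) := by
    refine ⟨T + (S.testBit (2 * j + 1)).toNat * 2 ^ (2 * (i : ℕ) + 1) -
      (S.testBit (2 * i + 1)).toNat * 2 ^ (2 * (i : ℕ) + 1), Nat.sub_add_cancel ?_⟩
    by_cases hb : S.testBit (2 * i + 1) = true
    · have := Nat.ge_two_pow_of_testBit (hT1.trans hb)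
      simp only [hb, Bool.toNat_true]; omega
    · simp [hb]
  have hTbit' := testBit_replace (S := T) (S' := T') (b := 2 * i + 1)
    (d' := S.testBit (2 * j + 1)) hT1 hT'
  have hbits : ∀ (l : Fin k) (a : Bool), T'.testBit (2 * (l : ℕ) + a.toNat) =
      S.testBit (2 * ((if l = i then j else l : Fin k) : ℕ) + a.toNat) := by
    intro l a
    rw [hTbit', hTbit]
    by_cases hl : l = i
    · subst hl
      cases a <;> simp
    · have hl' : (l : ℕ) ≠ i := fun h => hl (Fin.ext h)
      have := Bool.toNat_lt a
      rw [if_neg (by omega), if_neg (by omega), if_neg hl]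
  have hlarge : ∀ m ≥ 2 * k, T'.testBit m = false := by
    intro m hm
    have hi := i.2
    rw [hTbit', hTbit, if_neg (by omega), if_neg (by omega)]
    exact Nat.testBit_lt_two_pow (hS.trans_le (Nat.pow_le_pow_right (by norm_num) hm))
  have hTK : T' < 2 ^ (2 * k) := Nat.lt_pow_two_of_testBit _ hlarge
  have hval : s'.arr 2 ((D * 2 ^ (2 * k) + T' : ℕ) : ℤ) = (KExpr.rename i j e).opt c S := by
    rw [KExpr.opt_rename i j e c S T' hbits]
    by_cases h : T' < S
    -- the cell is already rewritten, but renaming does not change it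
    · rw [hnew _ h]
      refine KExpr.opt_rename i j e c T' T' fun l a => ?_
      rw [hbits, hbits]
      by_cases hl : l = i
      · by_cases hj : j = i <;> simp [hl, hj]
      · simp [hl]
    · exact hold _ (by omega) hTK
  have hcase : ∀ (a b : Bool) (m : ℕ), m ≤ 2 ^ (2 * k) →
      |(b.toNat : ℤ) - a.toNat| ≤ B ∧ |((b.toNat : ℤ) - a.toNat) * (m : ℕ)| ≤ B := by
    intro a b m hm
    have hmB : (m : ℤ) ≤ B := by exact_mod_cast (by omega : m ≤ B)
    have := hE.lenB
    cases a <;> cases b <;> simp [hmB] <;> omega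
  refine Runs.seq_bit (t := 44) S (2 * i) h30 e20 hE'.r12 (by omega) (by norm_num) fun r₁ => ?_
  refine Runs.seq_bit S (2 * j) (by simp [h30]) (by simp [e21]) (by simp [hE'.r12]) (by omega)
    (by norm_num) fun r₂ => ?_
  refine Runs.seq_op ((S.testBit (2 * j)).toNat - (S.testBit (2 * i)).toNat : ℤ)
    (by simp [Op.eval]) (hcase _ _ 0 (by omega)).1 ?_
  refine Runs.seq_op (((S.testBit (2 * j)).toNat - (S.testBit (2 * i)).toNat : ℤ) *
    (2 ^ (2 * (i : ℕ)) : ℕ)) (by simp [Op.eval, e20]) (hcase _ _ _ (by omega)).2 ?_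
  refine Runs.seq_op (T : ℤ) ?_ (natCast_abs_le ?_) ?_
  · have : (T : ℤ) + (S.testBit (2 * i)).toNat * (2 ^ (2 * (i : ℕ)) : ℕ) =
      S + (S.testBit (2 * j)).toNat * (2 ^ (2 * (i : ℕ)) : ℕ) := by exact_mod_cast hT
    simp only [Op.eval, State.setReg_reg]
    simp [h30]
    push_cast at this
    linarith
  · have := Nat.mul_le_mul_right (2 ^ (2 * (i : ℕ))) (Bool.toNat_le (S.testBit (2 * j)))
    omega
  refine Runs.seq_bit S (2 * i + 1) (by simp [h30]) (by simp [e22]) (by simp [hE'.r12]) (by omega)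
    (by norm_num) fun r₃ => ?_
  refine Runs.seq_bit S (2 * j + 1) (by simp [h30]) (by simp [e23]) (by simp [hE'.r12]) (by omega)
    (by norm_num) fun r₄ => ?_
  refine Runs.seq_op ((S.testBit (2 * j + 1)).toNat - (S.testBit (2 * i + 1)).toNat : ℤ)
    (by simp [Op.eval]) (hcase _ _ 0 (by omega)).1 ?_
  refine Runs.seq_op (((S.testBit (2 * j + 1)).toNat - (S.testBit (2 * i + 1)).toNat : ℤ) *
    (2 ^ (2 * (i : ℕ) + 1) : ℕ)) (by simp [Op.eval, e22]) (hcase _ _ _ (by omega)).2 ?_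
  refine Runs.seq_op (T' : ℤ) ?_ (natCast_abs_le (by omega)) ?_
  · have : (T' : ℤ) + (S.testBit (2 * i + 1)).toNat * (2 ^ (2 * (i : ℕ) + 1) : ℕ) =
      T + (S.testBit (2 * j + 1)).toNat * (2 ^ (2 * (i : ℕ) + 1) : ℕ) := by exact_mod_cast hT'
    simp only [Op.eval, State.setReg_reg]
    simp
    push_cast at this
    linarith
  refine Runs.seq_op ((D * 2 ^ (2 * k) + T' : ℕ) : ℤ) (by simp [Op.eval, e19])
    (natCast_abs_le (by omega)) ?_
  refine Runs.seq_load ((KExpr.rename i j e).opt c S) (by rw [← hval]; simp) ?_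
  refine Runs.seq_op ((D * 2 ^ (2 * k) + S : ℕ) : ℤ) (by simp [Op.eval, e19, h30])
    (natCast_abs_le (by omega)) ?_
  refine (Runs.store (D * 2 ^ (2 * k) + S : ℕ) ((KExpr.rename i j e).opt c S) (by simp) (by simp)
    ⟨?_, by simp [h30], ?_⟩).mono_time (t := 1) (by norm_num)
  · repeat first | exact Frame.refl _ | apply Frame.setArr | refine Frame.setReg ?_ (by norm_num) _
  · simp

theorem KExpr.length_encode {k : ℕ} (e : KExpr k) (c : e.Vert → WithTop ℤ) :
    (e.encode c).length = 4 * e.size := by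
  induction e with
  | vertex i => rfl
  | union e₁ e₂ ih₁ ih₂ =>
    simp only [encode, List.length_append, ih₁, ih₂, size, List.length_cons, List.length_nil]
    ring
  | join i j hij e ih =>
    have := ih c
    simp only [encode, List.length_append, size, List.length_cons, List.length_nil]
    rw [this]; ring
  | rename i j e ih =>
    have := ih c
    simp only [encode, List.length_append, size, List.length_cons, List.length_nil]
    rw [this]; ring

/-- One iteration of the main loop, when the next four words are an operation. -/
theorem reaches_step {B k n len : ℕ} {W : ℤ} {A : ℤ → ℤ} {s : State}
    (hE : Env B k n W A len s) {p : ℕ} {a₀ a₁ a₂ a₃ : ℤ} {Q : State → Prop}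
    (h5 : s.reg 5 = p) (hA : Holds A p [a₀, a₁, a₂, a₃]) (hp : p + 4 ≤ len)
    (hrun : ∀ s₁, Env B k n W A len s₁ → s₁.reg 5 = (p + 4 : ℕ) → s₁.reg 8 = s.reg 8 →
      s₁.arr 2 = s.arr 2 → s₁.reg 15 = a₀ → s₁.reg 16 = a₁ → s₁.reg 17 = a₂ → s₁.reg 18 = a₃ →
      Runs B dispatchProg s₁ (2 ^ (2 * k) * 50 + 25) Q) :
    ∃ s', Reaches B (.loop 5 0 stepProg) s (2 ^ (2 * k) * 50 + 50) s' ∧ Q s' := by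
  have hlen := hE.lenB
  obtain ⟨h0, h1, h2, h3, -⟩ := hA
  rw [← hE.arr0] at h0 h1 h2 h3
  have hr : Runs B stepProg s (2 ^ (2 * k) * 50 + 33) Q := by
    refine Runs.seq_load a₀ (by rw [h5]; exact h0) ?_
    refine Runs.seq_op ((p + 1 : ℕ) : ℤ) (by simp [Op.eval, hE.r11, h5])
      (natCast_abs_le (by omega)) ?_
    refine Runs.seq_load a₁ (by simpa using h1) ?_
    refine Runs.seq_op ((p + 2 : ℕ) : ℤ) (by simp [Op.eval, hE.r11]; ring)
      (natCast_abs_le (by omega)) ?_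
    refine Runs.seq_load a₂ (by simp; rw [← h2]; congr 1) ?_
    refine Runs.seq_op ((p + 3 : ℕ) : ℤ) (by simp [Op.eval, hE.r11]; ring)
      (natCast_abs_le (by omega)) ?_
    refine Runs.seq_load a₃ (by simp; rw [← h3]; congr 1) ?_
    refine Runs.seq_op ((p + 4 : ℕ) : ℤ) (by simp [Op.eval, hE.r11]; ring)
      (natCast_abs_le (by omega)) ?_
    refine hrun _ ?_ (by simp) (by simp) (by simp) (by simp) (by simp) (by simp) (by simp)
    repeat first | exact hE | refine Env.setReg ?_ _ (by simp)
  obtain ⟨s', hs', hQ⟩ := hr.exists_eq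
  refine ⟨s', Reaches.loop ?_ (hs'.mono_time (by omega)), hQ⟩
  rw [h5, hE.r0]; exact_mod_cast (by omega : p < len)

theorem runs_dispatch {B k n len : ℕ} {W : ℤ} {A : ℤ → ℤ} {s : State} {t : ℕ} {Q : State → Prop}
    (hE : Env B k n W A len s)
    (h : (s.reg 15 = 0 ∧ Runs B vertexProg s t Q) ∨ (s.reg 15 = 1 ∧ Runs B unionProg s t Q) ∨
      (s.reg 15 = 2 ∧ Runs B joinProg s t Q) ∨ (s.reg 15 = 3 ∧ Runs B renameProg s t Q)) :
    Runs B dispatchProg s (t + 3) Q := by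
  have h11 := hE.r11
  have h12 := hE.r12
  have h13 := hE.r13
  refine Runs.ite (fun hc => ?_) fun hc => Runs.ite (fun hc' => ?_) fun hc' =>
    Runs.ite (fun hc'' => ?_) fun hc'' => ?_
  · rcases h with ⟨h, hr⟩ | ⟨h, hr⟩ | ⟨h, hr⟩ | ⟨h, hr⟩
    · exact hr.mono_time (by omega)
    all_goals omega
  · rcases h with ⟨h, hr⟩ | ⟨h, hr⟩ | ⟨h, hr⟩ | ⟨h, hr⟩
    · omega
    · exact hr.mono_time (by omega)
    all_goals omega
  · rcases h with ⟨h, hr⟩ | ⟨h, hr⟩ | ⟨h, hr⟩ | ⟨h, hr⟩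
    · omega
    · omega
    · exact hr.mono_time (by omega)
    · omega
  · rcases h with ⟨h, hr⟩ | ⟨h, hr⟩ | ⟨h, hr⟩ | ⟨h, hr⟩
    · omega
    · omega
    · omega
    · exact hr

/-- The loop reads a subexpression and leaves its table on top of the stack. -/
theorem reaches_expr {B k n len : ℕ} {W : ℤ} {A : ℤ → ℤ} (e : KExpr k) (c : e.Vert → WithTop ℤ)
    (hc : ∀ v, |(c v).untopD W| ≤ W) (D p : ℕ) (s : State) (hE : Env B k n W A len s)
    (h5 : s.reg 5 = p) (h8 : s.reg 8 = (D * 2 ^ (2 * k) : ℕ)) (hA : Holds A p (e.encode c))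
    (hp : p + 4 * e.size ≤ len) (hD : D + e.size ≤ n) :
    ∃ s', Reaches B (.loop 5 0 stepProg) s (e.size * (2 ^ (2 * k) * 50 + 50)) s' ∧
      Env B k n W A len s' ∧ s'.reg 5 = (p + 4 * e.size : ℕ) ∧
      s'.reg 8 = ((D + 1) * 2 ^ (2 * k) : ℕ) ∧
      (∀ S : ℕ, S < 2 ^ (2 * k) → s'.arr 2 ((D * 2 ^ (2 * k) : ℕ) + (S : ℤ)) =
        e.opt (fun v => (c v).untopD W) S) ∧
      ∀ z < ((D * 2 ^ (2 * k) : ℕ) : ℤ), s'.arr 2 z = s.arr 2 z := by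
  induction e generalizing D p s with
  | vertex i =>
    simp only [KExpr.size] at hp hD
    obtain ⟨s', hr, hE', s₁, h1, h2, hT⟩ := reaches_step (s := s)
      (Q := fun s' => Env B k n W A len s' ∧ ∃ s₁ : State, s₁.reg 5 = (p + 4 : ℕ) ∧
        s₁.arr 2 = s.arr 2 ∧ Top k s₁ D ((KExpr.vertex i).opt fun v => (c v).untopD W) s') hE h5 hA
      (by omega) (by
      intro s₁ hE₁ h5₁ h8₁ harr h15 h16 h17 h18
      refine (runs_dispatch (t := 2 ^ (2 * k) * 50 + 20) hE₁ (Or.inl ⟨h15, ?_⟩)).mono_time (by omega)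
      have hweight : (c ()).untopD W =
          if 0 < (weightWords (c ())).1 then W else (weightWords (c ())).2 := by
        by_cases h : c () = ⊤
        · simp [weightWords, h]
        · obtain ⟨w, hw⟩ := WithTop.ne_top_iff_exists.1 h
          simp [weightWords, ← hw]
      refine (runs_vertexProg hE₁ (D := D) (by omega) i.2 (h8₁.trans h8) h16 h17 h18 hweight
        ((hc ()).trans hE.WB)).mono le_rfl ?_
      rintro s' ⟨hE', hT⟩
      refine ⟨hE', s₁, h5₁, harr, hT.ptr, hT.top, fun S hS => ?_, hT.below⟩
      rw [hT.tbl S hS, KExpr.opt_vertex])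
    refine ⟨s', ?_, hE', ?_, hT.top, hT.tbl, ?_⟩
    · simpa [KExpr.size] using hr
    · rw [hT.ptr, h1]; simp [KExpr.size]
    · intro z hz; rw [hT.below z hz, h2]
  | union e₁ e₂ ih₁ ih₂ =>
    simp only [KExpr.size] at hp hD
    simp only [KExpr.encode, holds_append, List.length_append, KExpr.length_encode] at hA
    obtain ⟨⟨hA₁, hA₂⟩, hA₃⟩ := hA
    obtain ⟨s₁, hr₁, hE₁, hp₁, ht₁, htab₁, hb₁⟩ := ih₁ (fun v => c (Sum.inl v)) (fun v => hc _) D p s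
      hE h5 h8 hA₁ (by omega) (by omega)
    obtain ⟨s₂, hr₂, hE₂, hp₂, ht₂, htab₂, hb₂⟩ := ih₂ (fun v => c (Sum.inr v)) (fun v => hc _)
      (D + 1) (p + 4 * e₁.size) s₁ hE₁ hp₁ ht₁ (by exact_mod_cast hA₂) (by omega) (by omega)
    obtain ⟨s', hr, hE', s₃, h1, h2, hT⟩ := reaches_step (s := s₂)
      (Q := fun s' => Env B k n W A len s' ∧ ∃ s₃ : State,
        s₃.reg 5 = (p + 4 * e₁.size + 4 * e₂.size + 4 : ℕ) ∧
        s₃.arr 2 = s₂.arr 2 ∧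
        Top k s₃ D ((KExpr.union e₁ e₂).opt fun v => (c v).untopD W) s') hE₂ hp₂
      (by push_cast at hA₃ ⊢; rw [add_assoc (p : ℤ)]; exact hA₃) (by omega) (by
      intro s₃ hE₃ h5₃ h8₃ harr h15 h16 h17 h18
      refine (runs_dispatch (t := 2 ^ (2 * k) * 50 + 20) hE₃
        (Or.inr (Or.inl ⟨h15, ?_⟩))).mono_time (by omega)
      refine (runs_unionProg hE₃ (D := D)
        (f := e₁.opt fun v => (c (Sum.inl v)).untopD W)
        (g := e₂.opt fun v => (c (Sum.inr v)).untopD W) (by omega) ?_ ?_ ?_ ?_).mono le_rfl ?_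
      · rw [h8₃, ht₂]
      · intro S hS
        rw [harr, hb₂, htab₁ S hS]
        have : ((D + 1) * 2 ^ (2 * k) : ℕ) = D * 2 ^ (2 * k) + 2 ^ (2 * k) := by ring
        rw [this]; simp only [Nat.cast_add]; omega
      · intro S hS
        rw [harr, htab₂ S hS]
      · intro S
        have h1 := KExpr.opt_union e₁ e₂ (fun v => (c v).untopD W) S
        rw [← h1]
        refine (KExpr.abs_opt_le _ _ S (fun v => hc v)).trans ?_
        refine le_trans ?_ hE.valueB
        refine mul_le_mul_of_nonneg_right ?_ hE.W_nonneg
        simp only [KExpr.size]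
        exact_mod_cast (by omega : e₁.size + e₂.size + 1 ≤ n)
      · rintro s' ⟨hE', hT⟩
        refine ⟨hE', s₃, h5₃, harr, hT.ptr, hT.top, fun S hS => ?_, hT.below⟩
        rw [hT.tbl S hS, KExpr.opt_union])
    refine ⟨s', ?_, hE', ?_, hT.top, hT.tbl, ?_⟩
    · have := (hr₁.trans hr₂).trans hr
      convert this using 1
      simp only [KExpr.size]; ring
    · rw [hT.ptr, h1]; simp only [KExpr.size]; congr 1; ring
    · intro z hz
      rw [hT.below z hz, h2, hb₂ z, hb₁ z hz]
      refine hz.trans_le ?_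
      exact_mod_cast Nat.mul_le_mul_right _ (Nat.le_succ D)
  | join i j hij e ih =>
    simp only [KExpr.size] at hp hD
    simp only [KExpr.encode, holds_append] at hA
    obtain ⟨hA₁, hA₃⟩ := hA
    have hlen := KExpr.length_encode e c
    rw [hlen] at hA₃
    obtain ⟨s₁, hr₁, hE₁, hp₁, ht₁, htab₁, hb₁⟩ := ih c hc D p s
      hE h5 h8 hA₁ (by omega) (by omega)
    obtain ⟨s', hr, hE', s₃, h1, h2, hT⟩ := reaches_step (s := s₁)
      (Q := fun s' => Env B k n W A len s' ∧ ∃ s₃ : State,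
        s₃.reg 5 = (p + 4 * e.size + 4 : ℕ) ∧ s₃.arr 2 = s₁.arr 2 ∧
        Top k s₃ D ((KExpr.join i j hij e).opt fun v => (c v).untopD W) s') hE₁ hp₁
      (by exact_mod_cast hA₃) (by omega) (by
      intro s₃ hE₃ h5₃ h8₃ harr h15 h16 h17 h18
      refine (runs_dispatch (t := 2 ^ (2 * k) * 50 + 20) hE₃
        (Or.inr (Or.inr (Or.inl ⟨h15, ?_⟩)))).mono_time (by omega)
      refine (runs_joinProg hE₃ (D := D) hij e (fun v => (c v).untopD W) (by omega) ?_ h16 h17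
        ?_).mono le_rfl ?_
      · rw [h8₃, ht₁]
      · intro S hS
        rw [harr]; exact htab₁ S hS
      · rintro s' ⟨hE', hT⟩
        exact ⟨hE', s₃, h5₃, harr, hT⟩)
    refine ⟨s', ?_, hE', ?_, hT.top, hT.tbl, ?_⟩
    · have := hr₁.trans hr
      convert this using 1
      simp only [KExpr.size]; ring
    · rw [hT.ptr, h1]; simp only [KExpr.size]; congr 1
    · intro z hz
      rw [hT.below z hz, h2, hb₁ z hz]
  | rename i j e ih =>
    simp only [KExpr.size] at hp hD
    simp only [KExpr.encode, holds_append] at hA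
    obtain ⟨hA₁, hA₃⟩ := hA
    have hlen := KExpr.length_encode e c
    rw [hlen] at hA₃
    obtain ⟨s₁, hr₁, hE₁, hp₁, ht₁, htab₁, hb₁⟩ := ih c hc D p s
      hE h5 h8 hA₁ (by omega) (by omega)
    obtain ⟨s', hr, hE', s₃, h1, h2, hT⟩ := reaches_step (s := s₁)
      (Q := fun s' => Env B k n W A len s' ∧ ∃ s₃ : State,
        s₃.reg 5 = (p + 4 * e.size + 4 : ℕ) ∧ s₃.arr 2 = s₁.arr 2 ∧
        Top k s₃ D ((KExpr.rename i j e).opt fun v => (c v).untopD W) s') hE₁ hp₁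
      (by exact_mod_cast hA₃) (by omega) (by
      intro s₃ hE₃ h5₃ h8₃ harr h15 h16 h17 h18
      refine (runs_dispatch (t := 2 ^ (2 * k) * 50 + 20) hE₃
        (Or.inr (Or.inr (Or.inr ⟨h15, ?_⟩)))).mono_time (by omega)
      refine (runs_renameProg hE₃ (D := D) e (fun v => (c v).untopD W) (by omega) ?_ h16 h17
        ?_).mono le_rfl ?_
      · rw [h8₃, ht₁]
      · intro S hS
        rw [harr]; exact htab₁ S hS
      · rintro s' ⟨hE', hT⟩
        exact ⟨hE', s₃, h5₃, harr, hT⟩)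
    refine ⟨s', ?_, hE', ?_, hT.top, hT.tbl, ?_⟩
    · have := hr₁.trans hr
      convert this using 1
      simp only [KExpr.size]; ring
    · rw [hT.ptr, h1]; simp only [KExpr.size]; congr 1
    · intro z hz
      rw [hT.below z hz, h2, hb₁ z hz]

/-! ### Minimum weights with infinite entries -/

theorem natAbs_weight_le {k : ℕ} (e : KExpr k) (c : e.Vert → WithTop ℤ) :
    ∑ v, ((c v).untopD 0).natAbs ≤ ((e.encode c).map Int.natAbs).sum := by
  induction e with
  | vertex i =>
    refine le_trans (Fintype.sum_unique (ι := Unit) _).le ?_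
    simp only [KExpr.encode, List.map_cons, List.sum_cons, weightWords]
    change ((c ()).untopD 0).natAbs ≤ _
    omega
  | union e₁ e₂ ih₁ ih₂ =>
    refine le_trans (Fintype.sum_sum_type _).le ?_
    have h₁ := ih₁ fun v => c (Sum.inl v)
    have h₂ := ih₂ fun v => c (Sum.inr v)
    simp only [KExpr.encode, List.map_append, List.sum_append]
    exact (add_le_add h₁ h₂).trans (Nat.le_add_right _ _)
  | join i j hij e ih =>
    simp only [KExpr.encode, List.map_append, List.sum_append]
    exact (ih c).trans (Nat.le_add_right _ _)
  | rename i j e ih =>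
    simp only [KExpr.encode, List.map_append, List.sum_append]
    exact (ih c).trans (Nat.le_add_right _ _)

theorem KExpr.cost_eq_sum {k : ℕ} {M : Type*} [AddCommMonoid M] (e : KExpr k) (c : e.Vert → M)
    {f : e.Vert → Option Bool} {X : Finset e.Vert} (hX : ∀ v, f v = none ↔ v ∈ X) :
    e.cost c f = ∑ v ∈ X, c v := by
  classical
  unfold cost
  simp only [hX]
  rw [Finset.sum_ite_mem, Finset.univ_inter]

/-- The minimum weight of an odd cycle transversal can be computed with a large finite weight in
place of `+∞`. -/
theorem exists_isLeast_weight {k : ℕ} (e : KExpr k) (c : e.Vert → WithTop ℤ) {M : ℕ}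
    (hM : ∑ v, ((c v).untopD 0).natAbs ≤ M) (a : ℤ)
    (ha : a = e.opt (fun v => (c v).untopD (2 * M + 1)) (2 ^ (2 * k) - 1)) :
    ∃ m : WithTop ℤ,
      IsLeast {w : WithTop ℤ | ∃ X : Finset e.Vert, IsOCT e.graph X ∧ w = ∑ v ∈ X, c v} m ∧
      weightWords m = if (M : ℤ) < a then (1, 0) else (0, a) := by
  classical
  -- a sum with an entry `2 M + 1` exceeds `M` whatever the other entries are
  set c' : e.Vert → ℤ := fun v => (c v).untopD (2 * M + 1) with hc'
  have hopt : ∀ X : Finset e.Vert, IsOCT e.graph X → a ≤ ∑ v ∈ X, c' v := by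
    intro X hX
    obtain ⟨f, hf, hfX⟩ := isOCT_iff_exists_proper.1 hX
    rw [ha, ← e.cost_eq_sum c' hfX]
    exact e.opt_le _ ((e.sol_full f).2 hf)
  have hfin : ∀ X : Finset e.Vert, (∀ v ∈ X, c v ≠ ⊤) →
      ∑ v ∈ X, c v = ((∑ v ∈ X, c' v : ℤ) : WithTop ℤ) ∧ ∑ v ∈ X, c' v ≤ M := by
    intro X hX
    constructor
    · rw [WithTop.coe_sum]
      refine Finset.sum_congr rfl fun v hv => ?_
      obtain ⟨w, hw⟩ := WithTop.ne_top_iff_exists.1 (hX v hv)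
      simp [hc', ← hw]
    · calc ∑ v ∈ X, c' v ≤ ∑ v ∈ X, (((c v).untopD 0).natAbs : ℤ) := by
            refine Finset.sum_le_sum fun v hv => ?_
            obtain ⟨w, hw⟩ := WithTop.ne_top_iff_exists.1 (hX v hv)
            simp only [hc', ← hw, WithTop.untopD_coe]
            exact Int.le_natAbs
        _ ≤ ∑ v, (((c v).untopD 0).natAbs : ℤ) :=
            Finset.sum_le_sum_of_subset_of_nonneg (Finset.subset_univ _) fun _ _ _ => by positivity
        _ ≤ M := by exact_mod_cast hM
  have htop : ∀ X : Finset e.Vert, (∃ v ∈ X, c v = ⊤) →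
      ∑ v ∈ X, c v = ⊤ ∧ M < ∑ v ∈ X, c' v := by
    rintro X ⟨v₀, hv₀, htop⟩
    refine ⟨by rw [WithTop.sum_eq_top]; exact ⟨v₀, hv₀, htop⟩, ?_⟩
    have h1 : ∀ v, -(((c v).untopD 0).natAbs : ℤ) ≤ c' v := by
      intro v
      by_cases hv : c v = ⊤
      · simp only [hc', hv, WithTop.untopD_top]; simp; omega
      · obtain ⟨w, hw⟩ := WithTop.ne_top_iff_exists.1 hv
        simp only [hc', ← hw, WithTop.untopD_coe]; omega
    have h2 : -(M : ℤ) ≤ ∑ v ∈ X.erase v₀, c' v := by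
      calc -(M : ℤ) ≤ -∑ v, (((c v).untopD 0).natAbs : ℤ) := by
            rw [neg_le_neg_iff]; exact_mod_cast hM
        _ ≤ -∑ v ∈ X.erase v₀, (((c v).untopD 0).natAbs : ℤ) := by
            rw [neg_le_neg_iff]
            exact Finset.sum_le_sum_of_subset_of_nonneg (Finset.subset_univ _)
              fun _ _ _ => by positivity
        _ ≤ _ := by
            rw [← Finset.sum_neg_distrib]
            exact Finset.sum_le_sum fun v _ => h1 v
    rw [← Finset.add_sum_erase X c' hv₀]
    have h3 : c' v₀ = 2 * M + 1 := by simp [hc', htop]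
    omega
  obtain ⟨f, hf, hof⟩ := e.exists_opt c' (2 ^ (2 * k) - 1)
  rw [e.sol_full] at hf
  have hfX : ∀ v, f v = none ↔ v ∈ Finset.univ.filter fun v => f v = none := by simp
  set X₀ := Finset.univ.filter fun v => f v = none
  have hX₀ : IsOCT e.graph X₀ := isOCT_iff_exists_proper.2 ⟨f, hf, hfX⟩
  have ha₀ : a = ∑ v ∈ X₀, c' v := by rw [ha, hof, e.cost_eq_sum c' hfX]
  by_cases hinf : ∃ v ∈ X₀, c v = ⊤
  · obtain ⟨h1, h2⟩ := htop X₀ hinf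
    rw [← ha₀] at h2
    refine ⟨⊤, ⟨⟨X₀, hX₀, h1.symm⟩, ?_⟩, by simp [weightWords, h2]⟩
    rintro w ⟨X, hX, rfl⟩
    by_cases hX' : ∃ v ∈ X, c v = ⊤
    · exact (htop X hX').1.ge
    · push Not at hX'
      have := (hfin X hX').2
      have := hopt X hX
      omega
  · push Not at hinf
    obtain ⟨h1, h2⟩ := hfin X₀ hinf
    rw [← ha₀] at h1 h2
    refine ⟨(a : ℤ), ⟨⟨X₀, hX₀, h1.symm⟩, ?_⟩, by simp [weightWords, h2]⟩
    rintro w ⟨X, hX, rfl⟩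
    by_cases hX' : ∃ v ∈ X, c v = ⊤
    · rw [(htop X hX').1]; exact le_top
    · push Not at hX'
      rw [(hfin X hX').1]
      exact WithTop.coe_le_coe.2 (hopt X hX)

/-! ### The algorithm -/

/-- Weighted odd cycle transversal by dynamic programming over the expression. -/
def octProg : Prog :=
  .const 10 0 ;;
  .const 11 1 ;;
  .const 12 2 ;;
  .const 13 3 ;;
  .load 1 0 10 ;;
  .op .add 2 1 1 ;;
  .const 3 0 ;;
  .const 4 1 ;;
  .loop 3 2 (.store 1 3 4 ;; .op .add 4 4 4 ;; .op .add 3 3 11) ;;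
  .const 5 0 ;;
  .const 6 0 ;;
  .loop 5 0 (.load 15 0 5 ;; .ite 15 10 (.op .sub 6 6 15) (.op .add 6 6 15) ;; .op .add 5 5 11) ;;
  .op .add 7 6 6 ;;
  .op .add 7 7 11 ;;
  .const 5 1 ;;
  .const 8 0 ;;
  .loop 5 0 stepProg ;;
  .op .sub 9 4 11 ;;
  .load 9 2 9 ;;
  .ite 6 9 (.const 0 1 ;; .const 1 0) (.op .add 1 9 10 ;; .const 0 0)

theorem sum_natAbs_take (x : List ℤ) (j : ℕ) (hj : j < x.length) :
    ((x.take (j + 1)).map Int.natAbs).sum = ((x.take j).map Int.natAbs).sum + (x.getD j 0).natAbs := by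
  rw [List.take_add_one, List.map_append, List.sum_append]
  simp [hj]

/-- The running time is dominated by the main loop: `O(4 ^ k)` steps for each operation. -/
theorem runs_octProg {B : ℕ} (I : WeightedInst) (x : List ℤ) (hx : x = (I.k : ℤ) :: I.e.encode I.c)
    (M : ℕ) (hM : M = (x.map Int.natAbs).sum) (hlenB : x.length + 4 ≤ B)
    (hstack : (I.e.size + 2) * 2 ^ (2 * I.k) ≤ B) (hval : I.e.size * (2 * M + 1) ≤ B) :
    Runs B octProg (initState x)
      (8 * I.k + 6 * x.length + I.e.size * (2 ^ (2 * I.k) * 50 + 50) + 40)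
      (weightedOCT.Correct I) := by
  have hlen : x.length = 4 * I.e.size + 1 := by
    rw [hx, List.length_cons, KExpr.length_encode]
  have hn := I.e.size_pos
  have hMB : 2 * M + 1 ≤ B := (Nat.le_mul_of_pos_left _ hn).trans hval
  have hk2 : 2 * I.k < 2 ^ (2 * I.k) := Nat.lt_two_pow_self
  have hKB : 2 * 2 ^ (2 * I.k) ≤ B := (Nat.mul_le_mul_right _ (by omega)).trans hstack
  have h1B : |(1 : ℤ)| ≤ B := by simpa using (by exact_mod_cast (by omega) : (1 : ℤ) ≤ B)
  have h2B : |(2 : ℤ)| ≤ B := by simpa using (by exact_mod_cast (by omega) : (2 : ℤ) ≤ B)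
  have h3B : |(3 : ℤ)| ≤ B := by simpa using (by exact_mod_cast (by omega) : (3 : ℤ) ≤ B)
  have harr0 : ∀ j : ℕ, (initState x).arr 0 (j : ℤ) = x.getD j 0 := by
    intro j; simp [initState]
  have hcells : Holds ((initState x).arr 0) 1 (I.e.encode I.c) := by
    have := holds_initState x
    conv at this => arg 3; rw [hx]
    simpa using this.2
  have hk0 : (initState x).arr 0 0 = I.k := by rw [hx]; simp [initState]
  set A := (initState x).arr 0 with hA
  -- constants and the number of labels
  refine (Runs.mono_time (t := (2 * I.k) * (3 + 1) + 1 + (2 + (x.length * (4 + 1) + 1 +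
    (4 + (I.e.size * (2 ^ (2 * I.k) * 50 + 50) + 1 + 5)))) + 8) ?_ (by omega))
  refine Runs.seq_const (by simp) ?_
  refine Runs.seq_const h1B ?_
  refine Runs.seq_const h2B ?_
  refine Runs.seq_const h3B ?_
  refine Runs.seq_load (I.k : ℤ) (by simp; exact hk0) ?_
  refine Runs.seq_op ((2 * I.k : ℕ) : ℤ) (by simp [Op.eval]; ring) (natCast_abs_le (by omega)) ?_
  refine Runs.seq_const (by simp) ?_
  refine Runs.seq_const h1B ?_
  set s₁ := ((((((((initState x).setReg 10 0).setReg 11 1).setReg 12 2).setReg 13 3).setReg 1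
    I.k).setReg 2 (2 * I.k : ℕ)).setReg 3 0).setReg 4 1 with hs₁
  -- powers of two
  refine Runs.seq ((Runs.loop (t := 3) (fun j s => s.reg 3 = j ∧ s.reg 4 = (2 ^ j : ℕ) ∧
    (∀ r, r ≠ 3 → r ≠ 4 → s.reg r = s₁.reg r) ∧ s.arr 0 = A ∧
    ∀ b < j, s.arr 1 (b : ℤ) = (2 ^ b : ℕ)) (2 * I.k) ?_ ?_ ?_).mono le_rfl ?_)
  · rintro j hj s ⟨h3, h4, hr, h0, hpow⟩
    refine ⟨by rw [h3, hr 2 (by norm_num) (by norm_num)]; simp [hs₁]; omega, ?_⟩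
    have hj2 := two_pow_le_of_lt hj
    refine Runs.seq_store j (2 ^ j : ℕ) h3 h4 ?_
    refine Runs.seq_op ((2 ^ (j + 1) : ℕ) : ℤ) (by simp [Op.eval, h4, pow_succ]; ring)
      (natCast_abs_le (by rw [pow_succ']; omega)) ?_
    refine Runs.op ((j + 1 : ℕ) : ℤ) ?_ (natCast_abs_le (by omega)) ⟨by simp, by simp, ?_, ?_, ?_⟩
    · simp [Op.eval, h3, hr 11]; simp [hs₁]
    · intro r hr3 hr4
      simp [hr3, hr4, hr]
    · simpa using h0
    · intro b hb
      simp only [State.setReg_arr, State.setArr_arr, if_true, Function.update_apply, Nat.cast_inj]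
      split_ifs with h
      · rw [h]
      · exact hpow b (by omega)
  · rintro s ⟨h3, -, hr, -, -⟩
    rw [h3, hr 2 (by norm_num) (by norm_num)]
    simp [hs₁]
  · exact ⟨by simp [hs₁], by simp [hs₁], fun _ _ _ => rfl, rfl, by simp⟩
  rintro s₂ ⟨-, h4, hr₂, h0₂, hpow⟩
  have hr₂' : s₂.reg 0 = x.length ∧ s₂.reg 10 = 0 ∧ s₂.reg 11 = 1 ∧ s₂.reg 12 = 2 ∧ s₂.reg 13 = 3 := by
    refine ⟨?_, ?_, ?_, ?_, ?_⟩ <;> rw [hr₂ _ (by norm_num) (by norm_num)] <;>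
      simp [hs₁, initState]
  obtain ⟨h0, h10, h11, h12, h13⟩ := hr₂'
  -- the sum of the absolute values of the input words
  refine (Runs.seq_const (t := 1 + (x.length * (4 + 1) + 1 + (4 + (I.e.size * (2 ^ (2 * I.k) * 50 + 50) + 1 + 5))))
    (by simp) ?_).mono_time (by omega)
  refine (Runs.seq_const (t := (x.length * (4 + 1) + 1 + (4 + (I.e.size * (2 ^ (2 * I.k) * 50 + 50) + 1 + 5))))
    (by simp) ?_).mono_time (by omega)
  have hsum : ∀ j ≤ x.length, ((x.take j).map Int.natAbs).sum ≤ M := by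
    intro j _
    rw [hM]
    conv_rhs => rw [← List.take_append_drop j x]
    rw [List.map_append, List.sum_append]
    omega
  refine Runs.seq ((Runs.loop (t := 4) (fun j s => s.reg 5 = j ∧
    s.reg 6 = (((x.take j).map Int.natAbs).sum : ℕ) ∧
    (∀ r, r ≠ 5 → r ≠ 6 → r ≠ 15 → s.reg r = s₂.reg r) ∧ s.arr = s₂.arr)
    x.length ?_ ?_ ?_).mono le_rfl ?_)
  · rintro j hj s ⟨h5, h6, hr, harr⟩
    refine ⟨by rw [h5, hr 0 (by norm_num) (by norm_num) (by norm_num), h0]; omega, ?_⟩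
    have hs := hsum (j + 1) hj
    refine Runs.seq_load (x.getD j 0) (by rw [harr, h0₂, h5, harr0]) ?_
    refine Runs.seq_ite ((s.setReg 15 (x.getD j 0)).setReg 6
      (((x.take (j + 1)).map Int.natAbs).sum : ℕ)) (fun hc => ?_) (fun hc => ?_) ?_
    · refine Runs.op _ ?_ (natCast_abs_le (by omega)) rfl
      simp only [State.setReg_reg, if_true] at hc
      simp [hr, h10] at hc
      rw [sum_natAbs_take x j hj]
      simp [Op.eval, h6, abs_of_neg hc]
      ring
    · refine Runs.op _ ?_ (natCast_abs_le (by omega)) rfl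
      simp only [State.setReg_reg, if_true] at hc
      simp [hr, h10] at hc
      rw [sum_natAbs_take x j hj]
      simp [Op.eval, h6, abs_of_nonneg hc]
    · refine Runs.op ((j + 1 : ℕ) : ℤ) (by simp [Op.eval, h5, hr, h11]) (natCast_abs_le (by omega))
        ⟨by simp, by simp, ?_, by simpa using harr⟩
      intro r h1 h2 h3
      simp [h1, h2, h3, hr]
  · rintro s ⟨h5, -, hr, -⟩
    rw [h5, hr 0 (by norm_num) (by norm_num) (by norm_num), h0]
    exact lt_irrefl _
  · exact ⟨by simp, by simp, fun r h1 h2 _ => by simp [h1, h2], rfl⟩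
  rintro s₃ ⟨-, h6, hr₃, harr₃⟩
  rw [List.take_length, ← hM] at h6
  have e0 := hr₃ 0 (by norm_num) (by norm_num) (by norm_num)
  have e4 := hr₃ 4 (by norm_num) (by norm_num) (by norm_num)
  have e10 := hr₃ 10 (by norm_num) (by norm_num) (by norm_num)
  have e11 := hr₃ 11 (by norm_num) (by norm_num) (by norm_num)
  have e12 := hr₃ 12 (by norm_num) (by norm_num) (by norm_num)
  have e13 := hr₃ 13 (by norm_num) (by norm_num) (by norm_num)
  -- the main loop
  refine (Runs.seq_op (t := 3 + (I.e.size * (2 ^ (2 * I.k) * 50 + 50) + 1 + 5)) ((2 * M : ℕ) : ℤ)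
    (by simp [Op.eval, h6]; ring) (natCast_abs_le (by omega)) ?_).mono_time (by omega)
  refine (Runs.seq_op (t := 2 + (I.e.size * (2 ^ (2 * I.k) * 50 + 50) + 1 + 5)) ((2 * M + 1 : ℕ) : ℤ)
    (by simp [Op.eval, e11, h11]) (natCast_abs_le (by omega)) ?_).mono_time (by omega)
  refine (Runs.seq_const (t := 1 + (I.e.size * (2 ^ (2 * I.k) * 50 + 50) + 1 + 5)) h1B
    ?_).mono_time (by omega)
  refine (Runs.seq_const (t := (I.e.size * (2 ^ (2 * I.k) * 50 + 50) + 1 + 5)) (by simp)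
    ?_).mono_time (by omega)
  set s₄ := (((s₃.setReg 7 (2 * M : ℕ)).setReg 7 (2 * M + 1 : ℕ)).setReg 5 1).setReg 8 0 with hs₄
  have hE : Env B I.k I.e.size (2 * M + 1) A x.length s₄ := by
    constructor
    case r0 => simp [hs₄, e0, h0]
    case r4 => simp [hs₄, e4, h4]
    case r6 => simp [hs₄, h6]
    case r7 => simp [hs₄]
    case r10 => simp [hs₄, e10, h10]
    case r11 => simp [hs₄, e11, h11]
    case r12 => simp [hs₄, e12, h12]
    case r13 => simp [hs₄, e13, h13]
    case arr0 => simpa [hs₄, harr₃] using h0₂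
    case pow => simpa [hs₄, harr₃] using hpow
    case lenB => exact hlenB
    case stackB => exact hstack
    case valueB => exact_mod_cast hval
    case W_nonneg => positivity
    case WB => exact_mod_cast hMB
  have hweights : ∑ v, ((I.c v).untopD 0).natAbs ≤ M := by
    refine (natAbs_weight_le I.e I.c).trans ?_
    rw [hM, hx, List.map_cons, List.sum_cons]
    omega
  have hc : ∀ v, |(I.c v).untopD (2 * (M : ℤ) + 1)| ≤ 2 * (M : ℤ) + 1 := by
    intro v
    by_cases hv : I.c v = ⊤
    · rw [hv, WithTop.untopD_top, abs_of_nonneg (by positivity)]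
    · have hle : ((I.c v).untopD 0).natAbs ≤ M :=
        (Finset.single_le_sum (f := fun v => ((I.c v).untopD 0).natAbs)
          (fun _ _ => Nat.zero_le _) (Finset.mem_univ v)).trans hweights
      obtain ⟨w, hw⟩ := WithTop.ne_top_iff_exists.1 hv
      rw [← hw] at hle ⊢
      simp only [WithTop.untopD_coe] at hle ⊢
      rw [abs_le]; omega
  obtain ⟨s₅, hreach, hE₅, h5₅, h8₅, htab, -⟩ := reaches_expr I.e I.c hc 0 1 s₄ hE (by simp [hs₄])
    (by simp [hs₄]) (by exact_mod_cast hcells) (by omega) (by omega)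
  refine Runs.seq ?_
  refine hreach 1 _ ?_
  refine ⟨1, s₅, le_rfl, .loop_false ?_, ?_⟩
  · rw [h5₅, hE₅.r0, hlen]; omega
  -- the answer
  have hK1 : 1 ≤ 2 ^ (2 * I.k) := Nat.one_le_two_pow
  have htop := htab (2 ^ (2 * I.k) - 1) (by omega)
  obtain ⟨m, hm, hw⟩ := exists_isLeast_weight I.e I.c hweights _ rfl
  set a := I.e.opt (fun v => (I.c v).untopD (2 * M + 1)) (2 ^ (2 * I.k) - 1) with ha
  have haB : |a| ≤ B := by
    refine (KExpr.abs_opt_le _ _ _ hc).trans ?_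
    exact_mod_cast hval
  have hM6 : s₅.reg 6 = M := by have := hE₅.r6; omega
  refine Runs.seq_op ((2 ^ (2 * I.k) - 1 : ℕ) : ℤ)
    (by simp [Op.eval, hE₅.r4, hE₅.r11]) (natCast_abs_le (by omega)) ?_
  refine Runs.seq_load a (by rw [← htop]; simp) ?_
  refine Runs.ite (fun hc => ?_) fun hc => ?_
  · simp [hM6] at hc
    rw [if_pos hc] at hw
    exact Runs.seq_const h1B (Runs.const (by simp) ⟨m, hm, by simp [hw]⟩)
  · simp [hM6] at hc
    rw [if_neg (by omega)] at hw
    exact Runs.seq_op a (by simp [Op.eval, hE₅.r10]) haB (Runs.const (by simp)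
      ⟨m, hm, by simp [hw]⟩)

theorem weightedOCT_solvedBy :
    ∃ (P : Prog) (C d : ℕ), weightedOCT.SolvedBy P fun I : WeightedInst =>
      C * (4 : ℝ) ^ I.k * (I.k : ℝ) ^ d * I.e.size := by
  refine ⟨octProg, 300, 1, 3, fun I => ?_⟩
  set x := weightedOCT.input I with hx
  set M := (x.map Int.natAbs).sum with hM
  have hlen : x.length = 4 * I.e.size + 1 := by
    rw [hx]; change (_ :: I.e.encode I.c).length = _
    rw [List.length_cons, KExpr.length_encode]
  -- without labels there are no expressions, so that `k ^ d` does not vanish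
  have hk : 1 ≤ I.k := by
    have : ∀ {k : ℕ}, KExpr k → 1 ≤ k := by
      intro k e
      induction e with
      | vertex i => exact Nat.one_le_of_lt i.2
      | union _ _ ih _ => exact ih
      | join _ _ _ _ ih => exact ih
      | rename _ _ _ ih => exact ih
    exact this I.e
  set n := I.e.size with hn
  have hn1 : 1 ≤ n := I.e.size_pos
  set K := 2 ^ (2 * I.k) with hK
  have hkK : 2 * I.k < K := Nat.lt_two_pow_self
  obtain ⟨t, s, ht, he, hc⟩ := runs_octProg (B := x.length + 4 + (n + 2) * K + n * (2 * M + 1)) I x rfl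
    M rfl (by omega) (by simp only [← hn, ← hK]; omega) (by simp only [← hn]; omega)
  simp only [← hn, ← hK] at ht
  have hT : 300 * (4 : ℝ) ^ I.k * (I.k : ℝ) ^ 1 * n = ((300 * K * I.k * n : ℕ) : ℝ) := by
    rw [hK, pow_mul]; push_cast; norm_num
  have hnK : K ≤ K * I.k * n := by
    calc K = K * 1 * 1 := by ring
      _ ≤ _ := by gcongr
  have hnn : n ≤ K * I.k * n := by
    calc n = 1 * 1 * n := by ring
      _ ≤ _ := by gcongr; omega
  have hnK' : n * K ≤ K * I.k * n := by
    calc n * K = K * 1 * n := by ring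
      _ ≤ _ := by gcongr
  have hT' : 300 * K * I.k * n = 300 * (K * I.k * n) := by ring
  refine ⟨t, _, s, ?_, ?_, he, hc⟩
  · push_cast
    rw [hT]
    refine Nat.cast_le.2 (ht.trans ?_)
    rw [hlen, hT']
    have : n * (K * 50 + 50) = 50 * (n * K) + 50 * n := by ring
    rw [this]
    omega
  · push_cast only [Nat.cast_ofNat]
    rw [hT]
    have hmag : magnitude x = x.length + M := rfl
    rw [hmag]
    set Y := 300 * K * I.k * n + (x.length + M) + 2 with hY
    have hYle : x.length + 4 + (n + 2) * K + n * (2 * M + 1) ≤ Y ^ 3 := by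
      have hY2 : 3 ≤ Y := by omega
      have e1 : (n + 2) * K = n * K + 2 * K := by ring
      have e2 : n * (2 * M + 1) ≤ Y * (2 * Y) := Nat.mul_le_mul (by omega) (by omega)
      have e3 : Y ^ 3 = Y * (Y * Y) := by ring
      have e4 : 3 * (Y * Y) ≤ Y * (Y * Y) := Nat.mul_le_mul_right _ hY2
      have e5 : 3 * Y ≤ Y * Y := Nat.mul_le_mul_right _ hY2
      have e6 : Y * (2 * Y) = 2 * (Y * Y) := by ring
      rw [e1]
      omega
    exact_mod_cast hYle

/-! ### Linear expressions as nondeterministic processes -/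

/-- The operations of a linear expression: add a vertex with label `i`, join `i` and `j`, rename `i`
to `j`. -/
inductive LinOp
  | add (i : ℕ)
  | join (i j : ℕ)
  | ren (i j : ℕ)

/-- The words of an operation; adding a vertex is the creation of a vertex of weight one, followed by
a disjoint union. -/
def LinOp.words : LinOp → List ℤ
  | .add i => [0, i, 0, 1, 1, 0, 0, 0]
  | .join i j => [2, i, j, 0]
  | .ren i j => [3, i, j, 0]

/-- The number of operations of a `k`-expression. -/
def LinOp.size : LinOp → ℕ
  | .add _ => 2
  | .join _ _ => 1
  | .ren _ _ => 1

/-- The labels are below `k`, and the two labels of an operation are distinct. -/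
def LinOp.WF (k : ℕ) : LinOp → Prop
  | .add i => i < k
  | .join i j => i < k ∧ j < k ∧ i ≠ j
  | .ren i j => i < k ∧ j < k ∧ i ≠ j

/-- `σ l a`: the label `l` carries a vertex of colour `a`. -/
abbrev Usage := ℕ → Bool → Prop

/-- The usage after a vertex with label `i` has been added, with the colour `o` or deleted. -/
def Usage.add (σ : Usage) (i : ℕ) (o : Option Bool) : Usage :=
  fun l a => σ l a ∨ (l = i ∧ o = some a)

/-- The usage after the label `i` has been renamed to `j`. -/
def Usage.ren (σ : Usage) (i j : ℕ) : Usage :=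
  fun l a => (l = j ∧ σ i a) ∨ (l ≠ i ∧ σ l a)

/-- The cost of colouring a vertex: deletions cost one. -/
def delCost (o : Option Bool) : ℕ := if o = none then 1 else 0

/-- `Steps L n σ n' σ'`: the process that goes through `L`, guesses the colours of the added vertices
and checks the joins can get from `(n, σ)` to `(n', σ')`; that is, some partial colouring of the vertices that the operations `L` add extends a
proper partial colouring with `n` deletions and usage `σ` to one with `n'` deletions and usage
`σ'`. -/
def Steps : List LinOp → ℕ → Usage → ℕ → Usage → Prop
  | [], n, σ, n', σ' => n' = n ∧ σ' = σ
  | .add i :: L, n, σ, n', σ' => ∃ o, Steps L (n + delCost o) (σ.add i o) n' σ'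
  | .join i j :: L, n, σ, n', σ' => (∀ a, ¬ (σ i a ∧ σ j a)) ∧ Steps L n σ n' σ'
  | .ren i j :: L, n, σ, n', σ' => Steps L n (σ.ren i j) n' σ'

theorem steps_append {L L' : List LinOp} {n n' : ℕ} {σ σ' : Usage} :
    Steps (L ++ L') n σ n' σ' ↔ ∃ m τ, Steps L n σ m τ ∧ Steps L' m τ n' σ' := by
  induction L generalizing n σ with
  | nil =>
    constructor
    · intro h; exact ⟨n, σ, ⟨rfl, rfl⟩, h⟩
    · rintro ⟨m, τ, ⟨rfl, rfl⟩, h⟩; exact h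
  | cons op L ih =>
    cases op with
    | add i =>
      simp only [List.cons_append, Steps, ih]
      constructor
      · rintro ⟨o, m, τ, h, h'⟩; exact ⟨m, τ, ⟨o, h⟩, h'⟩
      · rintro ⟨m, τ, ⟨o, h⟩, h'⟩; exact ⟨o, m, τ, h, h'⟩
    | join i j =>
      simp only [List.cons_append, Steps, ih]
      constructor
      · rintro ⟨h₀, m, τ, h, h'⟩; exact ⟨m, τ, ⟨h₀, h⟩, h'⟩
      · rintro ⟨m, τ, ⟨h₀, h⟩, h'⟩; exact ⟨h₀, m, τ, h, h'⟩
    | ren i j => simp only [List.cons_append, Steps, ih]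

namespace KExpr

variable {k : ℕ}

/-- Some proper partial colouring of the graph of the expression has `n` deletions and usage `σ`. -/
def Reach (e : KExpr k) (n : ℕ) (σ : Usage) : Prop :=
  ∃ f, Proper e.graph f ∧ n = e.cost (fun _ => 1) f ∧
    σ = fun l a => ∃ i : Fin k, (i : ℕ) = l ∧ e.Uses f i a

theorem reach_vertex (i : Fin k) (n : ℕ) (σ : Usage) :
    (vertex i).Reach n σ ↔ Steps [.add i] 0 (fun _ _ => False) n σ := by
  have huse : ∀ f : (vertex i).Vert → Option Bool,
      (fun l a => ∃ i' : Fin k, (i' : ℕ) = l ∧ (vertex i).Uses f i' a) =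
        Usage.add (fun _ _ => False) i (f ()) := by
    intro f
    funext l a
    simp only [Usage.add, false_or, eq_iff_iff]
    constructor
    · rintro ⟨_, rfl, v, rfl, hv⟩; exact ⟨rfl, hv⟩
    · rintro ⟨rfl, hv⟩; exact ⟨i, rfl, (), rfl, hv⟩
  constructor
  · rintro ⟨f, -, rfl, rfl⟩
    exact ⟨f (), by rw [cost_vertex, delCost, zero_add], huse f⟩
  · rintro ⟨o, rfl, rfl⟩
    exact ⟨fun _ => o, fun u v huv => (huv : False).elim,
      by rw [cost_vertex, delCost, zero_add], (huse fun _ => o).symm⟩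

theorem reach_add (e : KExpr k) (i : Fin k) (n : ℕ) (σ : Usage) :
    (union e (vertex i)).Reach n σ ↔ ∃ m τ, e.Reach m τ ∧ Steps [.add i] m τ n σ := by
  have huse : ∀ (f : e.Vert → Option Bool) (g : (vertex i).Vert → Option Bool),
      (fun l a => ∃ i' : Fin k, (i' : ℕ) = l ∧
        (union e (vertex i)).Uses (fun v => Sum.elim f g v) i' a) =
        Usage.add (fun l a => ∃ i : Fin k, (i : ℕ) = l ∧ e.Uses f i a) i (g ()) := by
    intro f g
    funext l a
    simp only [Usage.add, eq_iff_iff]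
    constructor
    · rintro ⟨_, rfl, v | v, rfl, hv⟩
      · exact Or.inl ⟨_, rfl, v, rfl, hv⟩
      · exact Or.inr ⟨rfl, hv⟩
    · rintro (⟨_, rfl, v, rfl, hv⟩ | ⟨rfl, hv⟩)
      · exact ⟨_, rfl, Sum.inl v, rfl, hv⟩
      · exact ⟨i, rfl, Sum.inr (), rfl, hv⟩
  constructor
  · rintro ⟨f, hf, rfl, rfl⟩
    rw [proper_union] at hf
    have hcost := cost_vertex i (fun _ => 1) (fun v => f (Sum.inr v))
    refine ⟨_, _, ⟨fun v => f (Sum.inl v), hf.1, rfl, rfl⟩, f (Sum.inr ()), ?_, ?_⟩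
    · rw [cost_union, hcost]; rfl
    · rw [← huse (fun v => f (Sum.inl v)) (fun v => f (Sum.inr v))]
      have : f = fun v => Sum.elim (fun v => f (Sum.inl v)) (fun v => f (Sum.inr v)) v := by
        funext v; cases v <;> rfl
      conv_lhs => rw [this]
      rfl
  · rintro ⟨m, τ, ⟨f, hf, rfl, rfl⟩, o, rfl, rfl⟩
    refine ⟨fun v => Sum.elim f (fun _ => o) v, ?_, ?_, ?_⟩
    · rw [proper_union]
      exact ⟨hf, fun u v huv => (huv : False).elim⟩
    · rw [cost_union, cost_vertex]; rfl
    · rw [huse]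

theorem reach_join (e : KExpr k) (i j : Fin k) (hij : i ≠ j) (n : ℕ) (σ : Usage) :
    (join i j hij e).Reach n σ ↔ ∃ m τ, e.Reach m τ ∧ Steps [.join i j] m τ n σ := by
  have huse : ∀ (f : e.Vert → Option Bool) (l : Fin k) (a : Bool),
      (∃ i' : Fin k, (i' : ℕ) = l ∧ e.Uses f i' a) ↔ e.Uses f l a := by
    intro f l a
    constructor
    · rintro ⟨i', h, hu⟩; rwa [← Fin.ext h]
    · intro h; exact ⟨l, rfl, h⟩
  constructor
  · rintro ⟨f, hf, rfl, rfl⟩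
    have hf' := (proper_join i j hij e f).1 hf
    refine ⟨_, _, ⟨f, hf'.1, rfl, rfl⟩, ?_, rfl, rfl⟩
    rintro a ⟨h₁, h₂⟩
    exact hf'.2 a ⟨(huse f i a).1 h₁, (huse f j a).1 h₂⟩
  · rintro ⟨m, τ, ⟨f, hf, rfl, rfl⟩, h, rfl, rfl⟩
    refine ⟨f, (proper_join i j hij e f).2 ⟨hf, fun a => ?_⟩, rfl, rfl⟩
    rintro ⟨h₁, h₂⟩
    exact h a ⟨(huse f i a).2 h₁, (huse f j a).2 h₂⟩

theorem reach_rename (e : KExpr k) (i j : Fin k) (n : ℕ) (σ : Usage) :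
    (rename i j e).Reach n σ ↔ ∃ m τ, e.Reach m τ ∧ Steps [.ren i j] m τ n σ := by
  have huse : ∀ (f : e.Vert → Option Bool),
      (fun l a => ∃ i' : Fin k, (i' : ℕ) = l ∧ (rename i j e).Uses f i' a) =
        Usage.ren (fun l a => ∃ i : Fin k, (i : ℕ) = l ∧ e.Uses f i a) i j := by
    intro f
    funext l a
    simp only [Usage.ren, eq_iff_iff]
    constructor
    · rintro ⟨_, rfl, v, rfl, hv⟩
      by_cases h : e.label v = i
      · exact Or.inl ⟨by simp [label, h], _, rfl, v, h, hv⟩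
      · refine Or.inr ⟨?_, e.label v, by simp [label, h], v, rfl, hv⟩
        rw [show (rename i j e).label v = e.label v by simp [label, h]]
        exact fun h' => h (Fin.ext h')
    · rintro (⟨rfl, i', h, v, rfl, hv⟩ | ⟨h, _, rfl, v, rfl, hv⟩)
      · exact ⟨j, rfl, v, by simp [label, Fin.ext h], hv⟩
      · refine ⟨e.label v, rfl, v, ?_, hv⟩
        have : e.label v ≠ i := fun h' => h (by rw [h'])
        simp [label, this]
  constructor
  · rintro ⟨f, hf, rfl, rfl⟩
    exact ⟨_, _, ⟨f, hf, rfl, rfl⟩, rfl, huse f⟩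
  · rintro ⟨m, τ, ⟨f, hf, rfl, rfl⟩, rfl, rfl⟩
    exact ⟨f, hf, rfl, (huse f).symm⟩

/-- Appending operations to an expression extends its process. -/
theorem exists_extension (L : List LinOp) (hL : ∀ op ∈ L, op.WF k) (e : KExpr k) :
    ∃ e' : KExpr k, e'.encode (fun _ => 1) = e.encode (fun _ => 1) ++ L.flatMap LinOp.words ∧
      e'.size = e.size + (L.map LinOp.size).sum ∧
      ∀ n σ, e'.Reach n σ ↔ ∃ m τ, e.Reach m τ ∧ Steps L m τ n σ := by
  induction L generalizing e with
  | nil =>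
    refine ⟨e, by simp, by simp, fun n σ => ⟨fun h => ⟨n, σ, h, rfl, rfl⟩, ?_⟩⟩
    rintro ⟨m, τ, h, rfl, rfl⟩; exact h
  | cons op L ih =>
    have hop := hL op (by simp)
    have ih := ih fun op h => hL op (by simp [h])
    obtain ⟨e₁, henc, hsize, hreach⟩ : ∃ e₁ : KExpr k,
        e₁.encode (fun _ => 1) = e.encode (fun _ => 1) ++ op.words ∧ e₁.size = e.size + op.size ∧
        ∀ n σ, e₁.Reach n σ ↔ ∃ m τ, e.Reach m τ ∧ Steps [op] m τ n σ := by
      cases op with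
      | add i =>
        refine ⟨union e (vertex ⟨i, hop⟩), ?_, rfl, e.reach_add _⟩
        simp [encode, LinOp.words, weightWords]
      | join i j =>
        refine ⟨join ⟨i, hop.1⟩ ⟨j, hop.2.1⟩ (by simpa using hop.2.2) e, rfl, rfl, e.reach_join _ _ _⟩
      | ren i j =>
        exact ⟨rename ⟨i, hop.1⟩ ⟨j, hop.2.1⟩ e, rfl, rfl,
          e.reach_rename _ _⟩
    obtain ⟨e', henc', hsize', hreach'⟩ := ih e₁
    refine ⟨e', by rw [henc', henc]; simp, by rw [hsize', hsize]; simp; ring, fun n σ => ?_⟩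
    rw [hreach']
    constructor
    · rintro ⟨m, τ, h, h'⟩
      obtain ⟨m', τ', h₁, h₂⟩ := (hreach _ _).1 h
      exact ⟨m', τ', h₁, steps_append (L := [op]).2 ⟨m, τ, h₂, h'⟩⟩
    · rintro ⟨m, τ, h, h'⟩
      obtain ⟨m', τ', h₁, h₂⟩ := steps_append (L := [op]).1 h'
      exact ⟨m', τ', (hreach _ _).2 ⟨m, τ, h, h₁⟩, h₂⟩

theorem exists_oct_iff_reach (e : KExpr k) (p : ℕ) :
    (∃ X : Finset e.Vert, IsOCT e.graph X ∧ X.card ≤ p) ↔ ∃ n ≤ p, ∃ σ, e.Reach n σ := by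
  classical
  constructor
  · rintro ⟨X, hX, hp⟩
    obtain ⟨f, hf, hfX⟩ := isOCT_iff_exists_proper.1 hX
    refine ⟨_, ?_, _, f, hf, rfl, rfl⟩
    rw [e.cost_eq_sum _ hfX]
    simpa using hp
  · rintro ⟨n, hn, σ, f, hf, rfl, -⟩
    have hfX : ∀ v, f v = none ↔ v ∈ Finset.univ.filter fun v => f v = none := by simp
    refine ⟨_, isOCT_iff_exists_proper.2 ⟨f, hf, hfX⟩, ?_⟩
    rw [e.cost_eq_sum _ hfX] at hn
    simpa using hn

/-- A list of operations describes an expression whose small odd cycle transversals correspond to the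
cheap runs of the process. -/
theorem exists_of_steps (i : ℕ) (L : List LinOp) (hi : i < k) (hL : ∀ op ∈ L, op.WF k) :
    ∃ e : KExpr k, e.encode (fun _ => 1) = [0, (i : ℤ), 0, 1] ++ L.flatMap LinOp.words ∧
      e.size = 1 + (L.map LinOp.size).sum ∧
      ∀ p, (∃ X : Finset e.Vert, IsOCT e.graph X ∧ X.card ≤ p) ↔
        ∃ n ≤ p, ∃ σ, Steps (.add i :: L) 0 (fun _ _ => False) n σ := by
  obtain ⟨e, henc, hsize, hreach⟩ := exists_extension L hL (vertex ⟨i, hi⟩)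
  refine ⟨e, by rw [henc]; simp [encode, weightWords], hsize, fun p => ?_⟩
  rw [exists_oct_iff_reach]
  refine exists_congr fun n => and_congr Iff.rfl (exists_congr fun σ => ?_)
  rw [hreach]
  simp only [reach_vertex]
  exact (steps_append (L := [.add i])).symm

end KExpr

/-! ### Gadgets for satisfiability -/

/-! The label `0` and the label `1` are carried by reference vertices of two different colours, `2` by
vertices that are never joined again, `3` to `6` by the vertices of the current gadget, and `7` by the
vertices that can make the current clause true. The label `8 + i` is the class `i`, which stands for
the two variables `2 i` and `2 i + 1`. The variable `2 i + b` belongs to the layer `b`, which is one of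
the two colours, and it is true if the class `i` carries a vertex of this colour. So the four possible
sets of colours of a class are the four assignments of its two variables. -/

/-- The label of the reference vertex that vertices of the layer `b` are joined to. -/
def refLabel (b : Bool) : ℕ := if b then 1 else 0

/-- The operations for an occurrence of a literal of the variable of the class `i` in the layer `b`,
which is positive if `s` holds. One of the vertices `3` and `4` has to be deleted: `3` survives only if
the variable is false, while `4` joins the class, so that it survives only if the variable is true or
becomes true. The vertex `5` survives only if no vertex `5` of the clause has survived before, and `5`
and `6` both survive only if the vertex among `3` and `4` that witnesses the falsity of the literal is
deleted. Hence a literal costs two deletions, or one if it makes its clause true. -/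
def literalOps (i : ℕ) (b s : Bool) : List LinOp :=
  [.add 3, .add 4, .join 3 (refLabel b), .join 4 (refLabel b), .join 3 4, .join 3 (8 + i),
    .add 5, .add 6, .join 5 1, .join 5 6, .join 5 7, .join (if b then 5 else 6) (if s then 3 else 4),
    .ren 4 (8 + i), .ren 3 2, .ren 6 2, .ren 5 7]

/-- The colour of the layer `b` if the first reference vertex has the colour `ρ`. -/
def layer (ρ b : Bool) : Bool := if b then ρ else !ρ

/-- The invariant between two gadgets: the reference vertices have the colours `ρ` and `!ρ`, and the
labels of the gadgets are free. -/
structure Good (ρ : Bool) (σ : Usage) : Prop where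
  ref₀ : ∀ a, σ 0 a ↔ a = ρ
  ref₁ : ∀ a, σ 1 a ↔ a = !ρ
  aux₃ : ∀ a, ¬ σ 3 a
  aux₄ : ∀ a, ¬ σ 4 a
  aux₅ : ∀ a, ¬ σ 5 a
  aux₆ : ∀ a, ¬ σ 6 a
  clause : ∀ a, σ 7 a → a = ρ

theorem option_bool_cases : ∀ o : Option Bool, o = none ∨ o = some false ∨ o = some true := by
  decide

/-- The runs of a literal gadget; `o₃`, …, `o₆` are the colours of its four vertices. -/
theorem steps_literal {ρ : Bool} {σ : Usage} (hσ : Good ρ σ) {i : ℕ} {b s : Bool} {n n' : ℕ}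
    {σ' : Usage} :
    Steps (literalOps i b s) n σ n' σ' ↔ ∃ o₃ o₄ o₅ o₆ : Option Bool,
      n' = n + delCost o₃ + delCost o₄ + delCost o₅ + delCost o₆ ∧
      (o₃ = none ∨ o₃ = some (layer ρ b) ∧ o₄ = none ∧ ¬ σ (8 + i) (layer ρ b)) ∧
      (o₄ = none ∨ o₄ = some (layer ρ b)) ∧
      (o₅ = none ∨ o₅ = some ρ ∧ o₆ ≠ some ρ ∧ ¬ σ 7 ρ) ∧
      ((if b then o₅ else o₆) = none ∨ (if b then o₅ else o₆) ≠ (if s then o₃ else o₄)) ∧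
      σ' = fun l a => if l = 2 then σ 2 a ∨ o₃ = some a ∨ o₆ = some a else
        if l = 7 then σ 7 a ∨ o₅ = some a else
        if l = 8 + i then σ (8 + i) a ∨ o₄ = some a else σ l a := by
  obtain ⟨h0, h1, h3, h4, h5, h6, h7⟩ := hσ
  obtain ⟨i2, i3, i4, i5, i6, i7⟩ : 8 + i ≠ 2 ∧ 8 + i ≠ 3 ∧ 8 + i ≠ 4 ∧ 8 + i ≠ 5 ∧ 8 + i ≠ 6 ∧
    8 + i ≠ 7 := by omega
  have j2 := i2.symm
  have j3 := i3.symm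
  have j4 := i4.symm
  have j5 := i5.symm
  have j6 := i6.symm
  have j7 := i7.symm
  have hfin : ∀ o₃ o₄ o₅ o₆ : Option Bool,
      ((((((((σ.add 3 o₃).add 4 o₄).add 5 o₅).add 6 o₆).ren 4 (8 + i)).ren 3 2).ren 6 2).ren 5 7) =
      fun l a => if l = 2 then σ 2 a ∨ o₃ = some a ∨ o₆ = some a else
        if l = 7 then σ 7 a ∨ o₅ = some a else
        if l = 8 + i then σ (8 + i) a ∨ o₄ = some a else σ l a := by
    intro o₃ o₄ o₅ o₆
    funext l a
    simp only [Usage.ren, Usage.add, eq_iff_iff]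
    by_cases e2 : l = 2
    · subst e2; simp [h3, h6, j2, j3, j6]; tauto
    by_cases e7 : l = 7
    · subst e7; simp [h5, j5, j7]; tauto
    by_cases e8 : l = 8 + i
    · subst e8; simp [h4, i2, i3, i4, i5, i6, i7]; tauto
    by_cases e3 : l = 3
    · subst e3; simp [h3, j3]
    by_cases e4 : l = 4
    · subst e4; simp [h4, j4]
    by_cases e5 : l = 5
    · subst e5; simp [h5, j5]
    by_cases e6 : l = 6
    · subst e6; simp [h6, j6]
    simp [*]
  simp only [literalOps, Steps, hfin]
  constructor
  · rintro ⟨o₃, o₄, c₁, c₂, c₃, c₄, o₅, o₆, c₅, c₆, c₇, c₈, hn, hs⟩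
    refine ⟨o₃, o₄, o₅, o₆, hn, ?_, ?_, ?_, ?_, hs⟩
    all_goals
      have q₃ := option_bool_cases o₃
      have q₄ := option_bool_cases o₄
      have q₅ := option_bool_cases o₅
      have q₆ := option_bool_cases o₆
      clear hs hn hfin
      cases b <;> cases s <;> cases ρ <;>
      simp [Usage.add, refLabel, h0, h1, h3, h4, h5, h6, layer, i3, i4] at c₁ c₂ c₃ c₄ c₅ c₆ c₇ c₈ ⊢ <;> grind
  · rintro ⟨o₃, o₄, o₅, o₆, hn, c₁, c₂, c₃, c₄, hs⟩
    refine ⟨o₃, o₄, ?_, ?_, ?_, ?_, o₅, o₆, ?_, ?_, ?_, ?_, hn, hs⟩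
    all_goals
      have q₃ := option_bool_cases o₃
      have q₄ := option_bool_cases o₄
      have q₅ := option_bool_cases o₅
      have q₆ := option_bool_cases o₆
      clear hs hn hfin
      cases b <;> cases s <;> cases ρ <;>
      simp [Usage.add, refLabel, h0, h1, h3, h4, h5, h6, layer, i3, i4] at c₁ c₂ c₃ c₄ h7 ⊢ <;> grind

/-- Create the vertex of the class `i` in the layer `b`. -/
def layerInitOps (i : ℕ) (b : Bool) : List LinOp :=
  [.add 4, .join 4 (refLabel b), .ren 4 (8 + i)]

/-- Create the vertex that is adjacent to the vertices of the class `i` in the layer `b`. -/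
def layerFinalOps (i : ℕ) (b : Bool) : List LinOp :=
  [.add 4, .join 4 (refLabel b), .join 4 (8 + i), .ren 4 2]

/-- Create a vertex that has to be deleted, since it is adjacent to both references. It makes up for
the deletion that a true literal saves, so that a clause with `m` literals costs `2 m`. -/
def forcedOps : List LinOp := [.add 5, .join 5 0, .join 5 1, .ren 5 2]

theorem steps_layerInit {ρ : Bool} {σ : Usage} (hσ : Good ρ σ) {i : ℕ} {b : Bool} {n n' : ℕ}
    {σ' : Usage} :
    Steps (layerInitOps i b) n σ n' σ' ↔ ∃ o : Option Bool, n' = n + delCost o ∧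
      (o = none ∨ o = some (layer ρ b)) ∧ σ' = fun l a => σ l a ∨ (l = 8 + i ∧ o = some a) := by
  obtain ⟨h0, h1, h3, h4, h5, h6, h7⟩ := hσ
  have i4 : 4 ≠ 8 + i := by omega
  have hfin : ∀ o : Option Bool, (σ.add 4 o).ren 4 (8 + i) =
      fun l a => σ l a ∨ (l = 8 + i ∧ o = some a) := by
    intro o
    funext l a
    simp only [Usage.ren, Usage.add, eq_iff_iff]
    by_cases e4 : l = 4
    · subst e4; simp [h4, i4]
    · simp [e4, h4]; tauto
  simp only [layerInitOps, Steps, hfin]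
  refine exists_congr fun o => ?_
  have q := option_bool_cases o
  have key : (∀ a, ¬ (σ.add 4 o 4 a ∧ σ.add 4 o (refLabel b) a)) ↔
      (o = none ∨ o = some (layer ρ b)) := by
    cases b <;> cases ρ <;> simp [Usage.add, refLabel, h0, h1, h4, layer] <;> grind
  rw [key]
  tauto

theorem steps_layerFinal {ρ : Bool} {σ : Usage} (hσ : Good ρ σ) {i : ℕ} {b : Bool} {n n' : ℕ}
    {σ' : Usage} :
    Steps (layerFinalOps i b) n σ n' σ' ↔ ∃ o : Option Bool, n' = n + delCost o ∧
      (o = none ∨ o = some (layer ρ b) ∧ ¬ σ (8 + i) (layer ρ b)) ∧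
      σ' = fun l a => σ l a ∨ (l = 2 ∧ o = some a) := by
  obtain ⟨h0, h1, h3, h4, h5, h6, h7⟩ := hσ
  have i4 : 8 + i ≠ 4 := by omega
  have hfin : ∀ o : Option Bool, (σ.add 4 o).ren 4 2 =
      fun l a => σ l a ∨ (l = 2 ∧ o = some a) := by
    intro o
    funext l a
    simp only [Usage.ren, Usage.add, eq_iff_iff]
    by_cases e4 : l = 4
    · subst e4; simp [h4]
    · simp [e4, h4]; tauto
  simp only [layerFinalOps, Steps, hfin]
  refine exists_congr fun o => ?_
  have q := option_bool_cases o
  have key : ((∀ a, ¬ (σ.add 4 o 4 a ∧ σ.add 4 o (refLabel b) a)) ∧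
      ∀ a, ¬ (σ.add 4 o 4 a ∧ σ.add 4 o (8 + i) a)) ↔
      (o = none ∨ o = some (layer ρ b) ∧ ¬ σ (8 + i) (layer ρ b)) := by
    cases b <;> cases ρ <;> simp [Usage.add, refLabel, h0, h1, h4, layer, i4] <;> grind
  constructor
  · rintro ⟨c₁, c₂, hn, hs⟩
    exact ⟨hn, key.1 ⟨c₁, c₂⟩, hs⟩
  · rintro ⟨hn, c, hs⟩
    exact ⟨(key.2 c).1, (key.2 c).2, hn, hs⟩

theorem steps_forced {ρ : Bool} {σ : Usage} (hσ : Good ρ σ) {n n' : ℕ} {σ' : Usage} :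
    Steps forcedOps n σ n' σ' ↔ n' = n + 1 ∧ σ' = σ := by
  obtain ⟨h0, h1, h3, h4, h5, h6, h7⟩ := hσ
  have hfin : (σ.add 5 none).ren 5 2 = σ := by
    funext l a
    simp only [Usage.ren, Usage.add, eq_iff_iff]
    by_cases e5 : l = 5
    · subst e5; simp [h5]
    · simp [e5, h5]
  simp only [forcedOps, Steps]
  constructor
  · rintro ⟨o, c₁, c₂, hn, hs⟩
    obtain rfl : o = none := by
      have q := option_bool_cases o
      cases ρ <;> simp [Usage.add, h0, h1, h5] at c₁ c₂ <;> grind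
    exact ⟨hn, by rw [hs, hfin]⟩
  · rintro ⟨rfl, rfl⟩
    refine ⟨none, ?_, ?_, rfl, hfin.symm⟩ <;> simp [Usage.add, h5]

theorem steps_clauseEnd {σ σ' : Usage} {n n' : ℕ} :
    Steps [.ren 7 2] n σ n' σ' ↔ n' = n ∧ σ' = fun l a => if l = 2 then σ 2 a ∨ σ 7 a else
      if l = 7 then False else σ l a := by
  have hfin : σ.ren 7 2 = fun l a => if l = 2 then σ 2 a ∨ σ 7 a else
      if l = 7 then False else σ l a := by
    funext l a
    simp only [Usage.ren, eq_iff_iff]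
    by_cases e2 : l = 2
    · subst e2; simp; tauto
    by_cases e7 : l = 7
    · subst e7; simp
    simp [e2, e7]
  simp only [Steps, hfin]

/-- The operations for an occurrence of a literal of the variable `l.1`: the variable belongs to the
class `l.1 / 2`, and its parity selects the layer. -/
def litOps (l : ℕ × Bool) : List LinOp := literalOps (l.1 / 2) (decide (l.1 % 2 = 1)) l.2

/-- The operations for a clause: afterwards the label `7` is free again. -/
def clauseOps (K : List (ℕ × Bool)) : List LinOp :=
  forcedOps ++ (K.flatMap litOps ++ [.ren 7 2])

/-- The truth value of a variable in a usage. -/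
def val (ρ : Bool) (σ : Usage) (v : ℕ) : Prop := σ (8 + v / 2) (layer ρ (decide (v % 2 = 1)))

/-- The classes below `h` use no colours in `σ'` that they do not use in `σ`. -/
def ClassLE (h : ℕ) (σ' σ : Usage) : Prop := ∀ i < h, ∀ a, σ' (8 + i) a → σ (8 + i) a

theorem ClassLE.trans {h : ℕ} {σ τ υ : Usage} (h₁ : ClassLE h σ τ) (h₂ : ClassLE h τ υ) :
    ClassLE h σ υ := fun i hi a ha => h₂ i hi a (h₁ i hi a ha)

theorem val_congr {h : ℕ} {σ τ : Usage} (h₁ : ClassLE h σ τ) (h₂ : ClassLE h τ σ) (ρ : Bool) {v : ℕ}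
    (hv : v / 2 < h) : val ρ σ v ↔ val ρ τ v :=
  ⟨h₁ _ hv _, h₂ _ hv _⟩

open Classical in
/-- The indicator of a proposition. -/
noncomputable def ind (p : Prop) : ℕ := if p then 1 else 0

theorem ind_pos {p : Prop} (h : p) : ind p = 1 := if_pos h

theorem ind_neg {p : Prop} (h : ¬ p) : ind p = 0 := if_neg h

theorem ind_le (p : Prop) : ind p ≤ 1 := by unfold ind; split_ifs <;> simp

/-- A literal costs two deletions, or one if its vertex `5` survives; this requires the literal to be
true unless the class of the variable changes. -/
theorem literal_sound {ρ : Bool} {h : ℕ} {l : ℕ × Bool} (hl : l.1 / 2 < h) {σ σ' : Usage} {n n' : ℕ}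
    (hσ : Good ρ σ) (hs : Steps (litOps l) n σ n' σ') :
    Good ρ σ' ∧ ClassLE h σ σ' ∧ n + 2 + ind (σ 7 ρ) ≤ n' + ind (σ' 7 ρ) ∧
      (n' + ind (σ' 7 ρ) = n + 2 + ind (σ 7 ρ) → ClassLE h σ' σ → σ' 7 ρ →
        σ 7 ρ ∨ (val ρ σ l.1 ↔ l.2 = true)) := by
  obtain ⟨o₃, o₄, o₅, o₆, rfl, c₃, c₄, c₅, c₆, rfl⟩ := (steps_literal hσ).1 hs
  obtain ⟨h0, h1, h3, h4, h5, h6, h7⟩ := hσ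
  obtain ⟨v, s⟩ := l
  simp only at hl c₃ c₄ c₅ c₆ ⊢
  generalize hi : v / 2 = i at hl c₃ c₄ c₅ c₆ ⊢
  obtain ⟨i0, i1, i2, i3, i4, i5, i6, i7⟩ : 0 ≠ 8 + i ∧ 1 ≠ 8 + i ∧ 8 + i ≠ 2 ∧ 3 ≠ 8 + i ∧
    4 ≠ 8 + i ∧ 5 ≠ 8 + i ∧ 6 ≠ 8 + i ∧ 8 + i ≠ 7 := by omega
  have hcost : ∀ o : Option Bool, o ≠ none → delCost o = 0 := fun o ho => if_neg ho
  have hnone : delCost none = 1 := rfl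
  refine ⟨⟨?_, ?_, ?_, ?_, ?_, ?_, ?_⟩, ?_, ?_, ?_⟩
  · simpa [i0] using h0
  · simpa [i1] using h1
  · simpa [i3] using h3
  · simpa [i4] using h4
  · simpa [i5] using h5
  · simpa [i6] using h6
  · intro a ha
    simp at ha
    rcases ha with ha | ha
    · exact h7 a ha
    · rcases c₅ with c₅ | c₅
      · simp [c₅] at ha
      · rw [c₅.1] at ha; simpa using ha.symm
  · intro j hj a ha
    have : 8 + j ≠ 2 ∧ 8 + j ≠ 7 := by omega
    simp only [this.1, this.2, if_false]
    split_ifs with hji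
    · rw [← hji]; exact Or.inl ha
    · exact ha
  · simp only [show (7 : ℕ) ≠ 2 by norm_num, if_false, if_true]
    have hpair : 1 ≤ delCost o₃ + delCost o₄ := by
      rcases c₃ with c₃ | c₃
      · rw [c₃, hnone]; omega
      · rw [c₃.2.1, hnone]; omega
    rcases c₅ with c₅ | c₅
    · rw [c₅, hnone]; simp; omega
    · rw [ind_neg c₅.2.2, ind_pos (Or.inr c₅.1)]; omega
  · simp only [show (7 : ℕ) ≠ 2 by norm_num, if_false, if_true]
    intro ht hle hQ
    rcases c₅ with c₅ | c₅
    · simp [c₅] at hQ; exact Or.inl hQ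
    right
    obtain ⟨c₅, c₅', c₅''⟩ := c₅
    rw [ind_neg c₅'', ind_pos (Or.inr c₅), hcost o₅ (by simp [c₅])] at ht
    have hpair : 1 ≤ delCost o₃ + delCost o₄ := by
      rcases c₃ with c₃ | c₃
      · rw [c₃, hnone]; omega
      · rw [c₃.2.1, hnone]; omega
    have ht₆ : delCost o₆ = 0 := by omega
    have h₆ : o₆ ≠ none := by rintro rfl; simp [hnone] at ht₆
    have h₃₄ : ¬ (o₃ = none ∧ o₄ = none) := by
      rintro ⟨rfl, rfl⟩; rw [hnone] at ht; omega
    have hclass : o₄ = some (layer ρ (decide (v % 2 = 1))) →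
        σ (8 + i) (layer ρ (decide (v % 2 = 1))) := by
      intro h
      have := hle i hl (layer ρ (decide (v % 2 = 1)))
      simp only [i2, i7, if_false, if_true] at this
      exact this (Or.inr h)
    unfold val
    simp only [hi]
    generalize hb : decide (v % 2 = 1) = b at *
    -- both vertices `5` and `6` survive, in different colours, and the one in the colour of the layer
    -- is adjacent to the vertex that witnesses the falsity of the literal
    have hdead : (if s = true then o₃ else o₄) = none := by
      have hcol : (if s = true then o₃ else o₄) = none ∨
          (if s = true then o₃ else o₄) = some (layer ρ b) := by
        cases s
        · simpa using c₄
        · simp only [if_true]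
          rcases c₃ with c₃ | c₃
          · exact Or.inl c₃
          · exact Or.inr c₃.1
      rcases hcol with hcol | hcol
      · exact hcol
      · exfalso
        rw [hcol] at c₆
        have q₆ := option_bool_cases o₆
        cases b <;> cases ρ <;> simp [layer, c₅] at c₆ c₅' <;> grind
    cases s
    · simp only [Bool.false_eq_true, if_false, iff_false] at hdead ⊢
      rcases c₃ with c₃ | c₃
      · exact absurd ⟨c₃, hdead⟩ h₃₄
      · exact c₃.2.2
    · simp only [if_true, iff_true] at hdead ⊢
      rcases c₄ with c₄ | c₄
      · exact absurd ⟨hdead, c₄⟩ h₃₄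
      · exact hclass c₄

theorem literals_sound {ρ : Bool} {h : ℕ} (K : List (ℕ × Bool)) (hK : ∀ l ∈ K, l.1 / 2 < h)
    {σ σ' : Usage} {n n' : ℕ} (hσ : Good ρ σ) (hs : Steps (K.flatMap litOps) n σ n' σ') :
    Good ρ σ' ∧ ClassLE h σ σ' ∧ n + 2 * K.length + ind (σ 7 ρ) ≤ n' + ind (σ' 7 ρ) ∧
      (n' + ind (σ' 7 ρ) = n + 2 * K.length + ind (σ 7 ρ) → ClassLE h σ' σ → σ' 7 ρ →
        σ 7 ρ ∨ ∃ l ∈ K, (val ρ σ l.1 ↔ l.2 = true)) := by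
  induction K generalizing n σ with
  | nil =>
    obtain ⟨rfl, rfl⟩ := hs
    exact ⟨hσ, fun _ _ _ => id, by simp, fun _ _ h => Or.inl h⟩
  | cons l K ih =>
    rw [List.flatMap_cons, steps_append] at hs
    obtain ⟨m, τ, h₁, h₂⟩ := hs
    obtain ⟨g₁, le₁, n₁, t₁⟩ := literal_sound (hK l (by simp)) hσ h₁
    obtain ⟨g₂, le₂, n₂, t₂⟩ := ih (fun l hl => hK l (by simp [hl])) g₁ h₂
    rw [List.length_cons]
    refine ⟨g₂, le₁.trans le₂, by omega, fun ht hle hQ => ?_⟩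
    rcases t₂ (by omega) (hle.trans le₁) hQ with hQ' | ⟨l', hl', hsat⟩
    · rcases t₁ (by omega) (le₂.trans hle) hQ' with hQ'' | hsat
      · exact Or.inl hQ''
      · exact Or.inr ⟨l, by simp, hsat⟩
    · refine Or.inr ⟨l', by simp [hl'], ?_⟩
      rwa [val_congr le₁ (le₂.trans hle) ρ (hK l' (by simp [hl']))]

/-- A clause with `m` literals costs `2 m` deletions, and it costs more if no literal is true and the
classes do not change. -/
theorem clause_sound {ρ : Bool} {h : ℕ} (K : List (ℕ × Bool)) (hK : ∀ l ∈ K, l.1 / 2 < h)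
    {σ σ' : Usage} {n n' : ℕ} (hσ : Good ρ σ) (h7 : ∀ a, ¬ σ 7 a)
    (hs : Steps (clauseOps K) n σ n' σ') :
    Good ρ σ' ∧ (∀ a, ¬ σ' 7 a) ∧ ClassLE h σ σ' ∧ n + 2 * K.length ≤ n' ∧
      (n' = n + 2 * K.length → ClassLE h σ' σ → ∃ l ∈ K, (val ρ σ l.1 ↔ l.2 = true)) := by
  rw [clauseOps, steps_append] at hs
  obtain ⟨m, τ, hm, hs⟩ := hs
  obtain ⟨rfl, rfl⟩ := (steps_forced hσ).1 hm
  rw [steps_append] at hs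
  obtain ⟨m, υ, h₁, h₂⟩ := hs
  obtain ⟨rfl, rfl⟩ := steps_clauseEnd.1 h₂
  obtain ⟨g, le, hn, ht⟩ := literals_sound K hK hσ h₁
  rw [ind_neg (h7 ρ)] at hn ht
  have hind := ind_le (υ 7 ρ)
  have hclass : ∀ i a, (if 8 + i = 2 then υ 2 a ∨ υ 7 a else if 8 + i = 7 then False else υ (8 + i) a)
      ↔ υ (8 + i) a := by
    intro i a
    have : 8 + i ≠ 2 ∧ 8 + i ≠ 7 := by omega
    simp only [this.1, this.2, if_false]
  refine ⟨⟨?_, ?_, ?_, ?_, ?_, ?_, ?_⟩, by simp, ?_, by omega, ?_⟩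
  · simpa using g.ref₀
  · simpa using g.ref₁
  · simpa using g.aux₃
  · simpa using g.aux₄
  · simpa using g.aux₅
  · simpa using g.aux₆
  · simp
  · intro i hi a ha
    exact (hclass i a).2 (le i hi a ha)
  · intro heq hle
    have hQ : υ 7 ρ := by
      by_contra hQ
      rw [ind_neg hQ] at hn
      omega
    rw [ind_pos hQ] at ht
    rcases ht (by omega) (fun i hi a ha => hle i hi a ((hclass i a).2 ha)) hQ with h | h
    · exact absurd h (h7 ρ)
    · exact h

theorem clauses_sound {ρ : Bool} {h : ℕ} (Ks : List (List (ℕ × Bool)))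
    (hK : ∀ K ∈ Ks, ∀ l ∈ K, l.1 / 2 < h)
    {σ σ' : Usage} {n n' : ℕ} (hσ : Good ρ σ) (h7 : ∀ a, ¬ σ 7 a)
    (hs : Steps (Ks.flatMap clauseOps) n σ n' σ') :
    Good ρ σ' ∧ ClassLE h σ σ' ∧ n + 2 * (Ks.map List.length).sum ≤ n' ∧
      (n' = n + 2 * (Ks.map List.length).sum → ClassLE h σ' σ →
        ∀ K ∈ Ks, ∃ l ∈ K, (val ρ σ l.1 ↔ l.2 = true)) := by
  induction Ks generalizing n σ with
  | nil =>
    obtain ⟨rfl, rfl⟩ := hs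
    exact ⟨hσ, fun _ _ _ => id, by simp, by simp⟩
  | cons K Ks ih =>
    rw [List.flatMap_cons, steps_append] at hs
    obtain ⟨m, τ, h₁, h₂⟩ := hs
    obtain ⟨g₁, e₁, le₁, n₁, t₁⟩ := clause_sound K (hK K (by simp)) hσ h7 h₁
    obtain ⟨g₂, le₂, n₂, t₂⟩ := ih (fun K hK' => hK K (by simp [hK'])) g₁ e₁ h₂
    rw [List.map_cons, List.sum_cons]
    refine ⟨g₂, le₁.trans le₂, by omega, fun ht hle K' hK' => ?_⟩
    rw [List.mem_cons] at hK'
    rcases hK' with rfl | hK'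
    · exact t₁ (by omega) (le₂.trans hle)
    · obtain ⟨l, hl, hsat⟩ := t₂ (by omega) (hle.trans le₁) K' hK'
      refine ⟨l, hl, ?_⟩
      rwa [val_congr le₁ (le₂.trans hle) ρ (hK K' (by simp [hK']) l hl)]

/-! ### Soundness of the reduction -/

/-- Create the two vertices of each class. -/
def initOps (h : ℕ) : List LinOp :=
  (List.range h).flatMap fun i => layerInitOps i true ++ layerInitOps i false

/-- Create the two final vertices for each class. -/
def finalOps (h : ℕ) : List LinOp :=
  (List.range h).flatMap fun i => layerFinalOps i true ++ layerFinalOps i false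

/-- The number of pairs of a class below `h` and a colour that the class uses. -/
noncomputable def classCount (h : ℕ) (σ : Usage) : ℕ :=
  ∑ i ∈ Finset.range h, (ind (σ (8 + i) true) + ind (σ (8 + i) false))

theorem ind_le_ind {p q : Prop} (h : p → q) : ind p ≤ ind q := by
  by_cases hp : p
  · rw [ind_pos hp, ind_pos (h hp)]
  · rw [ind_neg hp]; exact Nat.zero_le _

theorem ClassLE.classCount_le {h : ℕ} {σ τ : Usage} (hle : ClassLE h σ τ) :
    classCount h σ ≤ classCount h τ :=
  Finset.sum_le_sum fun i hi => add_le_add (ind_le_ind (hle i (Finset.mem_range.1 hi) _))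
    (ind_le_ind (hle i (Finset.mem_range.1 hi) _))

theorem ClassLE.of_classCount_le {h : ℕ} {σ τ : Usage} (hle : ClassLE h σ τ)
    (hc : classCount h τ ≤ classCount h σ) : ClassLE h τ σ := by
  have heq := (Finset.sum_eq_sum_iff_of_le fun i hi =>
    add_le_add (ind_le_ind (hle i (Finset.mem_range.1 hi) true))
      (ind_le_ind (hle i (Finset.mem_range.1 hi) false))).1
      (le_antisymm hle.classCount_le hc)
  intro i hi a ha
  have h0 := heq i (Finset.mem_range.2 hi)
  have h1 := ind_le_ind (hle i hi true)
  have h2 := ind_le_ind (hle i hi false)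
  by_contra hcon
  cases a
  · rw [ind_pos ha, ind_neg hcon] at h0; omega
  · rw [ind_pos ha, ind_neg hcon] at h0; omega

theorem Good.of_add {ρ : Bool} {σ σ' : Usage} (hσ : Good ρ σ)
    (h : ∀ l < 8, l ≠ 2 → ∀ a, σ' l a ↔ σ l a) : Good ρ σ' where
  ref₀ a := by rw [h 0 (by norm_num) (by norm_num), hσ.ref₀]
  ref₁ a := by rw [h 1 (by norm_num) (by norm_num), hσ.ref₁]
  aux₃ a := by rw [h 3 (by norm_num) (by norm_num)]; exact hσ.aux₃ a
  aux₄ a := by rw [h 4 (by norm_num) (by norm_num)]; exact hσ.aux₄ a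
  aux₅ a := by rw [h 5 (by norm_num) (by norm_num)]; exact hσ.aux₅ a
  aux₆ a := by rw [h 6 (by norm_num) (by norm_num)]; exact hσ.aux₆ a
  clause a := by rw [h 7 (by norm_num) (by norm_num)]; exact hσ.clause a

theorem good_layerInit {ρ : Bool} {σ : Usage} (hσ : Good ρ σ) (i : ℕ) (o : Option Bool) :
    Good ρ fun l a => σ l a ∨ (l = 8 + i ∧ o = some a) :=
  hσ.of_add fun l hl _ a => by have : l ≠ 8 + i := by omega
                               simp [this]

theorem good_layerFinal {ρ : Bool} {σ : Usage} (hσ : Good ρ σ) (o : Option Bool) :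
    Good ρ fun l a => σ l a ∨ (l = 2 ∧ o = some a) :=
  hσ.of_add fun l _ hl a => by simp [hl]

/-- The initial vertices that are not deleted give colours to the classes, that is, they set variables to
true, so that the deleted ones and the used colours add up to two per class. -/
theorem init_sound {ρ : Bool} (h : ℕ) {σ σ' : Usage} {n n' : ℕ} (hσ : Good ρ σ)
    (hempty : ∀ i a, ¬ σ (8 + i) a) (hs : Steps (initOps h) n σ n' σ') :
    Good ρ σ' ∧ (∀ a, σ' 7 a ↔ σ 7 a) ∧ (∀ i ≥ h, ∀ a, ¬ σ' (8 + i) a) ∧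
      n' + classCount h σ' = n + 2 * h := by
  induction h generalizing n' σ' with
  | zero =>
    obtain ⟨rfl, rfl⟩ := hs
    exact ⟨hσ, fun _ => Iff.rfl, fun i _ => hempty i, by simp [classCount]⟩
  | succ h ih =>
    rw [initOps, List.range_succ, List.flatMap_append, steps_append] at hs
    obtain ⟨m, τ, h₁, h₂⟩ := hs
    obtain ⟨g, h7, he, hn⟩ := ih h₁
    rw [List.flatMap_singleton, steps_append] at h₂
    obtain ⟨m', υ, h₂, h₃⟩ := h₂
    obtain ⟨o, rfl, ho, rfl⟩ := (steps_layerInit g).1 h₂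
    obtain ⟨o', rfl, ho', rfl⟩ := (steps_layerInit (good_layerInit g h o)).1 h₃
    refine ⟨good_layerInit (good_layerInit g h o) h o', fun a => ?_, fun i hi a => ?_, ?_⟩
    · rw [← h7]
      have : 7 ≠ 8 + h := by omega
      simp [this]
    · have : ¬ i = h := by omega
      have := he i (by omega) a
      simp [*]
    · rw [classCount, Finset.sum_range_succ]
      have hsum : ∑ i ∈ Finset.range h, (ind ((τ (8 + i) true ∨ 8 + i = 8 + h ∧ o = some true) ∨
          8 + i = 8 + h ∧ o' = some true) + ind ((τ (8 + i) false ∨ 8 + i = 8 + h ∧ o = some false) ∨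
          8 + i = 8 + h ∧ o' = some false)) = classCount h τ := by
        refine Finset.sum_congr rfl fun i hi => ?_
        have : ¬ i = h := (Finset.mem_range.1 hi).ne
        simp [this]
      rw [hsum]
      have e1 := he h le_rfl true
      have e2 := he h le_rfl false
      rcases ho with rfl | rfl <;> rcases ho' with rfl | rfl <;> cases ρ <;>
        simp [layer, delCost, ind, e1, e2] <;> omega

/-- A final vertex has to be deleted if its class uses the colour of its layer. Together with the
initial vertices this costs two deletions per class, and more if a variable has become true in the
meantime. -/
theorem final_sound {ρ : Bool} (h : ℕ) {σ σ' : Usage} {n n' : ℕ} (hσ : Good ρ σ)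
    (hs : Steps (finalOps h) n σ n' σ') :
    Good ρ σ' ∧ (∀ i a, σ' (8 + i) a ↔ σ (8 + i) a) ∧ n + classCount h σ ≤ n' := by
  induction h generalizing n' σ' with
  | zero =>
    obtain ⟨rfl, rfl⟩ := hs
    exact ⟨hσ, fun _ _ => Iff.rfl, by simp [classCount]⟩
  | succ h ih =>
    rw [finalOps, List.range_succ, List.flatMap_append, steps_append] at hs
    obtain ⟨m, τ, h₁, h₂⟩ := hs
    obtain ⟨g, hc, hn⟩ := ih h₁
    rw [List.flatMap_singleton, steps_append] at h₂
    obtain ⟨m', υ, h₂, h₃⟩ := h₂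
    obtain ⟨o, rfl, ho, rfl⟩ := (steps_layerFinal g).1 h₂
    obtain ⟨o', rfl, ho', rfl⟩ := (steps_layerFinal (good_layerFinal g o)).1 h₃
    have hne : ∀ i, 8 + i ≠ 2 := by omega
    refine ⟨good_layerFinal (good_layerFinal g o) o', fun i a => ?_, ?_⟩
    · simp [hne, hc]
    · rw [classCount, Finset.sum_range_succ]
      rw [classCount] at hn
      simp only [hne, false_and, or_false, hc] at ho ho'
      have key : ∀ (o : Option Bool) (q : Prop) (c : Bool), (o = none ∨ o = some c ∧ ¬ q) →
          ind q ≤ delCost o := by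
        rintro o q c (rfl | ⟨rfl, hq⟩)
        · exact ind_le _
        · rw [ind_neg hq]; exact Nat.zero_le _
      have k1 := key _ _ _ ho
      have k2 := key _ _ _ ho'
      cases ρ <;> simp [layer] at k1 k2 <;> omega

/-- Many reference vertices with the labels `0` and `1`: more of them than can be deleted. -/
def refOps (p : ℕ) : List LinOp := (List.replicate p [LinOp.add 0, .add 1]).flatten

theorem refs_sound (p : ℕ) {σ σ' : Usage} {n n' : ℕ} (hs : Steps (refOps p) n σ n' σ') :
    (∀ l ≥ 2, σ' l = σ l) ∧ n ≤ n' ∧ ((∃ a, σ' 0 a) ∨ n + p ≤ n') ∧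
      ((∃ a, σ' 1 a) ∨ n + p ≤ n') ∧ (∀ l a, σ l a → σ' l a) := by
  induction p generalizing n σ with
  | zero =>
    obtain ⟨rfl, rfl⟩ := hs
    exact ⟨fun _ _ => rfl, le_rfl, Or.inr le_rfl, Or.inr le_rfl, fun _ _ => id⟩
  | succ p ih =>
    rw [refOps, List.replicate_succ, List.flatten_cons, steps_append] at hs
    obtain ⟨m, τ, h₁, h₂⟩ := hs
    obtain ⟨e, hn, h0, h1, hmono⟩ := ih h₂
    obtain ⟨o, o', rfl, rfl⟩ := h₁
    refine ⟨fun l hl => ?_, by omega, ?_, ?_, fun l a ha => hmono l a (Or.inl (Or.inl ha))⟩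
    · rw [e l hl]
      funext a
      have : l ≠ 0 ∧ l ≠ 1 := by omega
      simp [Usage.add, this]
    · rcases o with _ | a
      · refine h0.imp id fun h => ?_
        simp only [delCost, if_true] at h
        omega
      · exact Or.inl ⟨a, hmono 0 a (Or.inl (Or.inr ⟨rfl, rfl⟩))⟩
    · rcases o' with _ | a
      · refine h1.imp id fun h => ?_
        simp only [delCost, if_true] at h
        omega
      · exact Or.inl ⟨a, hmono 1 a (Or.inr ⟨rfl, rfl⟩)⟩

/-- The operations after the creation of the first vertex. -/
def bodyOps (h p : ℕ) (Ks : List (List (ℕ × Bool))) : List LinOp :=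
  .add 1 :: (refOps p ++ (.join 0 1 :: (initOps h ++ (Ks.flatMap clauseOps ++ finalOps h))))

/-- A cheap run yields a satisfying assignment. -/
theorem reduction_sound {h : ℕ} (Ks : List (List (ℕ × Bool)))
    (hK : ∀ K ∈ Ks, ∀ l ∈ K, l.1 / 2 < h) {n p : ℕ} {σ : Usage}
    (hp : p = 2 * h + 2 * (Ks.map List.length).sum) (hn : n ≤ p)
    (hs : Steps (.add 0 :: bodyOps h p Ks) 0 (fun _ _ => False) n σ) :
    ∃ x : ℕ → Bool, ∀ K ∈ Ks, ∃ l ∈ K, x l.1 = l.2 := by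
  rw [bodyOps, ← List.cons_append, ← List.cons_append,
    show LinOp.add 0 :: LinOp.add 1 :: refOps p = refOps (p + 1) from rfl, steps_append] at hs
  obtain ⟨n₁, σ₁, hs₁, hdisj, hs⟩ := hs
  rw [steps_append] at hs
  obtain ⟨n₂, σ₂, hs₂, hs⟩ := hs
  rw [steps_append] at hs
  obtain ⟨n₃, σ₃, hs₃, hs₄⟩ := hs
  obtain ⟨he, -, h0, h1, -⟩ := refs_sound _ hs₁
  -- once the reference vertices are known to survive, the other bounds follow
  have main : ∀ ρ, Good ρ σ₁ → ∃ x : ℕ → Bool, ∀ K ∈ Ks, ∃ l ∈ K, x l.1 = l.2 := by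
    intro ρ g₁
    have hempty : ∀ i a, ¬ σ₁ (8 + i) a := fun i a => by rw [he _ (by omega)]; exact id
    obtain ⟨g₂, h7, -, hn₂⟩ := init_sound h g₁ hempty hs₂
    have h7' : ∀ a, ¬ σ₂ 7 a := fun a => by rw [h7, he _ (by omega)]; exact id
    obtain ⟨g₃, le₃, hn₃, ht₃⟩ := clauses_sound Ks hK g₂ h7' hs₃
    obtain ⟨-, -, hn₄⟩ := final_sound h g₃ hs₄
    have hcc := le₃.classCount_le
    have hle := le₃.of_classCount_le (by omega)
    have hsat := ht₃ (by omega) hle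
    classical
    refine ⟨fun v => decide (val ρ σ₂ v), fun K hKs => ?_⟩
    obtain ⟨l, hl, h⟩ := hsat K hKs
    refine ⟨l, hl, ?_⟩
    cases hl2 : l.2 <;> simp [hl2] at h ⊢ <;> exact h
  have hgood : ∀ a b, σ₁ 0 a → σ₁ 1 b → Good a σ₁ := by
    intro a b ha hb
    have h2 : ∀ l ≥ 2, ∀ c, ¬ σ₁ l c := fun l hl c => by rw [he l hl]; exact id
    have hab : b = !a := by
      have := hdisj a
      cases a <;> cases b <;> simp_all
    subst hab
    refine ⟨fun c => ⟨fun hc => ?_, fun hc => hc ▸ ha⟩, fun c => ⟨fun hc => ?_, fun hc => hc ▸ hb⟩,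
      h2 3 (by norm_num), h2 4 (by norm_num), h2 5 (by norm_num), h2 6 (by norm_num),
      fun c hc => absurd hc (h2 7 (by norm_num) c)⟩
    · by_contra hne
      have : c = !a := by cases a <;> cases c <;> simp_all
      exact hdisj c ⟨hc, this ▸ hb⟩
    · by_contra hne
      have : c = a := by cases a <;> cases c <;> simp_all
      exact hdisj c ⟨this ▸ ha, hc⟩
  -- deletions only accumulate
  have hmono : ∀ (L : List LinOp) (m m' : ℕ) (τ τ' : Usage), Steps L m τ m' τ' → m ≤ m' := by
    intro L
    induction L with
    | nil => rintro m m' τ τ' ⟨rfl, -⟩; exact le_rfl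
    | cons op L ih =>
      intro m m' τ τ' h
      cases op with
      | add i => obtain ⟨o, h⟩ := h; have := ih _ _ _ _ h; omega
      | join i j => exact ih _ _ _ _ h.2
      | ren i j => exact ih _ _ _ _ h
  have hn₁ : n₁ ≤ n := (hmono _ _ _ _ _ hs₂).trans
    ((hmono _ _ _ _ _ hs₃).trans (hmono _ _ _ _ _ hs₄))
  rcases h0 with ⟨a, ha⟩ | h0
  · rcases h1 with ⟨b, hb⟩ | h1
    · exact main a (hgood a b ha hb)
    · omega
  · omega

/-! ### Completeness of the reduction -/

/-- The usages of the classes below `h` spell the assignment `x`. -/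
def Spells (h : ℕ) (x : ℕ → Bool) (σ : Usage) : Prop :=
  ∀ i < h, ∀ a : Bool, σ (8 + i) a ↔ x (2 * i + a.toNat) = true

theorem init_complete (x : ℕ → Bool) (h : ℕ) {σ : Usage} {n : ℕ} (hσ : Good true σ)
    (hempty : ∀ i a, ¬ σ (8 + i) a) : ∃ n' σ', Steps (initOps h) n σ n' σ' ∧ Spells h x σ' := by
  induction h with
  | zero => exact ⟨n, σ, ⟨rfl, rfl⟩, by intro i hi; omega⟩
  | succ h ih =>
    obtain ⟨m, τ, hs, hsp⟩ := ih
    obtain ⟨g, -, he, -⟩ := init_sound h hσ hempty hs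
    rw [initOps, List.range_succ, List.flatMap_append]
    simp only [steps_append, List.flatMap_singleton]
    refine ⟨_, _, ⟨m, τ, hs, _, _, (steps_layerInit g).2
      ⟨if x (2 * h + 1) then some true else none, rfl, ?_, rfl⟩,
      (steps_layerInit (good_layerInit g h _)).2
      ⟨if x (2 * h) then some false else none, rfl, ?_, rfl⟩⟩, fun i hi a => ?_⟩
    · split_ifs <;> simp [layer]
    · split_ifs <;> simp [layer]
    · rcases Nat.lt_succ_iff_lt_or_eq.1 hi with hi | rfl
      · simp [hi.ne, hsp i hi]
      · cases a <;> simp [he i le_rfl]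

/-- The bound of `literal_sound` is attained with the value `x` of the variable, and the literal makes
its clause true if it is true. -/
theorem literal_complete {x : ℕ → Bool} {h : ℕ} {l : ℕ × Bool} (hl : l.1 / 2 < h) {σ : Usage}
    {n : ℕ} (hσ : Good true σ) (hx : Spells h x σ) :
    ∃ n' σ', Steps (litOps l) n σ n' σ' ∧ Spells h x σ' ∧
      n' + ind (σ' 7 true) = n + 2 + ind (σ 7 true) ∧
      (σ 7 true ∨ x l.1 = l.2 → σ' 7 true) := by
  classical
  obtain ⟨v, s⟩ := l
  have hxv := hx (v / 2) hl (decide (v % 2 = 1))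
  have hv : 2 * (v / 2) + (decide (v % 2 = 1)).toNat = v := by
    rcases Nat.mod_two_eq_zero_or_one v with h | h <;> simp [h] <;> omega
  rw [hv] at hxv
  simp only [litOps]
  generalize decide (v % 2 = 1) = b at *
  have hlay : layer true b = b := by cases b <;> rfl
  refine ⟨_, _, (steps_literal hσ).2 ⟨if x v then none else some b, if x v then some b else none,
    if x v = s ∧ ¬ σ 7 true then some true else none,
    if x v = s ∧ ¬ σ 7 true then some false else some (!b), rfl, ?_, ?_, ?_, ?_, rfl⟩, ?_, ?_, ?_⟩
  · rw [hlay]; by_cases h : x v <;> simp [h, hxv]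
  · rw [hlay]; by_cases h : x v <;> simp [h]
  · by_cases h : x v = s ∧ ¬ σ 7 true <;> simp [h]
  · by_cases h : x v = s ∧ ¬ σ 7 true
    · simp only [h, not_false_eq_true, and_self, if_true]
      right
      cases s <;> cases b <;> simp
    · simp only [h, if_false]
      cases b
      · right; cases s <;> cases x v <;> simp
      · simp
  · intro i hi a
    have : 8 + i ≠ 2 ∧ 8 + i ≠ 7 := by omega
    simp only [this.1, this.2, if_false]
    split_ifs with h₁ h₂
    · obtain rfl : i = v / 2 := by omega
      simp only [Option.some.injEq]
      rw [← hx _ hl, or_iff_left_iff_imp]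
      rintro rfl
      exact hxv.2 h₂
    · obtain rfl : i = v / 2 := by omega
      simp [hx _ hl]
    · exact hx i hi a
  · by_cases h : x v = s ∧ ¬ σ 7 true
    · obtain ⟨rfl, h2⟩ := h
      cases x v <;> simp [h2, delCost, ind]
    · by_cases h2 : σ 7 true
      · cases x v <;> simp [h2, delCost, ind]
      · have h1 : ¬ x v = s := fun h1 => h ⟨h1, h2⟩
        cases hxv : x v <;> simp [h2, hxv ▸ h1, delCost, ind]
  · intro h
    by_cases h2 : σ 7 true
    · simp [h2]
    · simp [h2] at h; simp [h, h2]

theorem literals_complete {x : ℕ → Bool} {h : ℕ} (K : List (ℕ × Bool)) (hK : ∀ l ∈ K, l.1 / 2 < h)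
    {σ : Usage} {n : ℕ} (hσ : Good true σ) (hx : Spells h x σ) :
    ∃ n' σ', Steps (K.flatMap litOps) n σ n' σ' ∧ Spells h x σ' ∧
      n' + ind (σ' 7 true) = n + 2 * K.length + ind (σ 7 true) ∧
      (σ 7 true ∨ (∃ l ∈ K, x l.1 = l.2) → σ' 7 true) := by
  induction K generalizing n σ with
  | nil => exact ⟨n, σ, ⟨rfl, rfl⟩, hx, by simp, by simp⟩
  | cons l K ih =>
    obtain ⟨m, τ, h₁, hx₁, n₁, t₁⟩ := literal_complete (n := n) (hK l (by simp)) hσ hx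
    obtain ⟨n', σ', h₂, hx₂, n₂, t₂⟩ := ih (n := m) (fun l hl => hK l (by simp [hl]))
      (literal_sound (hK l (by simp)) hσ h₁).1 hx₁
    refine ⟨n', σ', ?_, hx₂, by rw [List.length_cons]; omega, ?_⟩
    · rw [List.flatMap_cons, steps_append]
      exact ⟨m, τ, h₁, h₂⟩
    · rintro (h | ⟨l', hl', h⟩)
      · exact t₂ (Or.inl (t₁ (Or.inl h)))
      · rcases List.mem_cons.1 hl' with rfl | hl'
        · exact t₂ (Or.inl (t₁ (Or.inr h)))
        · exact t₂ (Or.inr ⟨l', hl', h⟩)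

theorem clauses_complete {x : ℕ → Bool} {h : ℕ} (Ks : List (List (ℕ × Bool)))
    (hK : ∀ K ∈ Ks, ∀ l ∈ K, l.1 / 2 < h) (hsat : ∀ K ∈ Ks, ∃ l ∈ K, x l.1 = l.2)
    {σ : Usage} {n : ℕ} (hσ : Good true σ) (h7 : ∀ a, ¬ σ 7 a) (hx : Spells h x σ) :
    ∃ n' σ', Steps (Ks.flatMap clauseOps) n σ n' σ' ∧ Spells h x σ' ∧
      n' = n + 2 * (Ks.map List.length).sum := by
  induction Ks generalizing n σ with
  | nil => exact ⟨n, σ, ⟨rfl, rfl⟩, hx, by simp⟩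
  | cons K Ks ih =>
    obtain ⟨m, τ, h₁, hx₁, n₁, t₁⟩ := literals_complete (n := n + 1) K (hK K (by simp)) hσ hx
    have hs : Steps (clauseOps K) n σ m _ :=
      steps_append.2 ⟨_, _, (steps_forced hσ).2 ⟨rfl, rfl⟩,
        steps_append.2 ⟨m, τ, h₁, steps_clauseEnd.2 ⟨rfl, rfl⟩⟩⟩
    obtain ⟨g, e, -, -⟩ := clause_sound K (hK K (by simp)) hσ h7 hs
    obtain ⟨n', σ', h₂, hx₂, n₂⟩ := ih (n := m) (fun K hK' => hK K (by simp [hK']))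
      (fun K hK' => hsat K (by simp [hK'])) g e (by
        intro i hi a
        have : 8 + i ≠ 2 ∧ 8 + i ≠ 7 := by omega
        simp only [this.1, this.2, if_false]
        exact hx₁ i hi a)
    refine ⟨n', σ', steps_append.2 ⟨_, _, hs, h₂⟩, hx₂, ?_⟩
    rw [ind_neg (h7 true), ind_pos (t₁ (Or.inr (hsat K (by simp))))] at n₁
    rw [List.map_cons, List.sum_cons]
    omega

theorem final_complete (h : ℕ) {σ : Usage} {n : ℕ} (hσ : Good true σ) :
    ∃ σ', Steps (finalOps h) n σ (n + classCount h σ) σ' := by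
  classical
  induction h with
  | zero => exact ⟨σ, rfl, rfl⟩
  | succ h ih =>
    obtain ⟨τ, hs⟩ := ih
    obtain ⟨g, hc, -⟩ := final_sound h hσ hs
    rw [finalOps, List.range_succ, List.flatMap_append]
    simp only [steps_append, List.flatMap_singleton]
    have hne : 8 + h ≠ 2 := by omega
    refine ⟨_, _, _, hs, _, _, (steps_layerFinal g).2
      ⟨if σ (8 + h) true then none else some true, rfl, ?_, rfl⟩,
      (steps_layerFinal (good_layerFinal g _)).2
      ⟨if σ (8 + h) false then none else some false, ?_, ?_, rfl⟩⟩
    · split_ifs with h' <;> simp [layer, hc, h']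
    · rw [classCount, Finset.sum_range_succ, ← classCount]
      by_cases h1 : σ (8 + h) true <;> by_cases h2 : σ (8 + h) false <;>
        simp [h1, h2, delCost, ind] <;> omega
    · split_ifs with h' <;> simp [layer, hc, h']

theorem refs_complete (p : ℕ) (n : ℕ) (σ : Usage) :
    Steps (refOps p) n σ n fun l a => σ l a ∨ 0 < p ∧ (l = 0 ∧ a = true ∨ l = 1 ∧ a = false) := by
  induction p generalizing σ with
  | zero => exact ⟨rfl, by simp⟩
  | succ p ih =>
    rw [refOps, List.replicate_succ, List.flatten_cons, steps_append]
    refine ⟨n, _, ⟨some true, some false, rfl, rfl⟩, ?_⟩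
    rw [← refOps]
    convert ih _ using 1
    funext l a
    simp only [Usage.add, Option.some.injEq, eq_iff_iff]
    cases a <;> simp <;> tauto

/-- A satisfying assignment yields a cheap run, in which all reference vertices survive. -/
theorem reduction_complete {h : ℕ} (Ks : List (List (ℕ × Bool)))
    (hK : ∀ K ∈ Ks, ∀ l ∈ K, l.1 / 2 < h) (p : ℕ) (x : ℕ → Bool)
    (hsat : ∀ K ∈ Ks, ∃ l ∈ K, x l.1 = l.2) :
    ∃ σ, Steps (.add 0 :: bodyOps h p Ks) 0 (fun _ _ => False)
      (2 * h + 2 * (Ks.map List.length).sum) σ := by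
  have hs₁ := refs_complete (p + 1) 0 fun _ _ => False
  have g₁ : Good true fun l a => False ∨ 0 < p + 1 ∧ (l = 0 ∧ a = true ∨ l = 1 ∧ a = false) := by
    refine ⟨?_, ?_, ?_, ?_, ?_, ?_, ?_⟩ <;> simp
  obtain ⟨n₂, σ₂, hs₂, hx₂⟩ := init_complete x h (n := 0) g₁ fun i a => by
    have : 8 + i ≠ 0 ∧ 8 + i ≠ 1 := by omega
    simp [this]
  obtain ⟨g₂, h7, -, hn₂⟩ := init_sound h g₁ (fun i a => by
    have : 8 + i ≠ 0 ∧ 8 + i ≠ 1 := by omega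
    simp [this]) hs₂
  have h7' : ∀ a, ¬ σ₂ 7 a := fun a => by rw [h7]; simp
  obtain ⟨n₃, σ₃, hs₃, hx₃, hn₃⟩ := clauses_complete Ks hK hsat (n := n₂) g₂ h7' hx₂
  obtain ⟨g₃, -⟩ := clauses_sound Ks hK g₂ h7' hs₃
  obtain ⟨σ₄, hs₄⟩ := final_complete h (n := n₃) g₃
  have hcc : classCount h σ₃ = classCount h σ₂ := by
    have h₁ : ClassLE h σ₃ σ₂ := fun i hi a => by rw [hx₂ i hi, hx₃ i hi]; exact id
    have h₂ : ClassLE h σ₂ σ₃ := fun i hi a => by rw [hx₂ i hi, hx₃ i hi]; exact id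
    exact le_antisymm h₁.classCount_le h₂.classCount_le
  refine ⟨σ₄, ?_⟩
  rw [bodyOps, ← List.cons_append, ← List.cons_append,
    show LinOp.add 0 :: LinOp.add 1 :: refOps p = refOps (p + 1) from rfl, steps_append]
  refine ⟨_, _, hs₁, ?_, ?_⟩
  · intro a
    cases a <;> simp
  · rw [show 2 * h + 2 * (Ks.map List.length).sum = n₃ + classCount h σ₃ by omega]
    exact steps_append.2 ⟨_, _, hs₂, steps_append.2 ⟨_, _, hs₃, hs₄⟩⟩

theorem bodyOps_wf {h : ℕ} (p : ℕ) (Ks : List (List (ℕ × Bool)))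
    (hK : ∀ K ∈ Ks, ∀ l ∈ K, l.1 / 2 < h) : ∀ op ∈ bodyOps h p Ks, op.WF (h + 8) := by
  intro op hop
  simp only [bodyOps, refOps, initOps, finalOps, List.mem_cons, List.mem_append, List.mem_flatten,
    List.mem_flatMap, List.mem_range, List.mem_replicate] at hop
  have hlayer : ∀ i < h, ∀ b, (∀ op ∈ layerInitOps i b, op.WF (h + 8)) ∧
      (∀ op ∈ layerFinalOps i b, op.WF (h + 8)) := by
    intro i hi b
    cases b <;> simp [layerInitOps, layerFinalOps, LinOp.WF, refLabel] <;> omega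
  rcases hop with rfl | ⟨_, ⟨-, rfl⟩, hop⟩ | rfl | ⟨i, hi, hop⟩ | ⟨K, hK', hop⟩ | ⟨i, hi, hop⟩
  · simp [LinOp.WF]
  · revert op; simp [LinOp.WF]
  · simp [LinOp.WF]
  · exact hop.elim ((hlayer i hi _).1 op) ((hlayer i hi _).1 op)
  · simp only [clauseOps, List.mem_append, List.mem_flatMap] at hop
    rcases hop with hop | ⟨l, hl, hop⟩ | hop
    · revert op; simp [forcedOps, LinOp.WF]
    · have := hK K hK' l hl
      rw [litOps] at hop
      generalize decide (l.1 % 2 = 1) = b at hop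
      revert op
      cases b <;> cases l.2 <;> simp [literalOps, LinOp.WF, refLabel] <;> omega
    · revert op; simp [LinOp.WF]
  · exact hop.elim ((hlayer i hi _).2 op) ((hlayer i hi _).2 op)

theorem sum_size_flatMap {α : Type} (f : α → List LinOp) (c : ℕ) (L : List α)
    (h : ∀ a ∈ L, ((f a).map LinOp.size).sum = c) :
    ((L.flatMap f).map LinOp.size).sum = L.length * c := by
  induction L with
  | nil => simp
  | cons a L ih =>
    rw [List.flatMap_cons, List.map_append, List.sum_append, h a (by simp),
      ih fun b hb => h b (by simp [hb]), List.length_cons]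
    ring

theorem sum_size_bodyOps (h p : ℕ) (Ks : List (List (ℕ × Bool))) :
    ((bodyOps h p Ks).map LinOp.size).sum =
      3 + 4 * p + 18 * h + 6 * Ks.length + 20 * (Ks.map List.length).sum := by
  have h₁ : ((refOps p).map LinOp.size).sum = 4 * p := by
    induction p with
    | zero => rfl
    | succ p ih =>
      rw [refOps, List.replicate_succ, List.flatten_cons, List.map_append, List.sum_append,
        ← refOps, ih]
      simp [LinOp.size]
      ring
  have h₂ : ((initOps h).map LinOp.size).sum = h * 8 := by
    rw [initOps, sum_size_flatMap _ 8 _ fun i _ => ?_, List.length_range]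
    simp [layerInitOps, LinOp.size]
  have h₃ : ((finalOps h).map LinOp.size).sum = h * 10 := by
    rw [finalOps, sum_size_flatMap _ 10 _ fun i _ => ?_, List.length_range]
    simp [layerFinalOps, LinOp.size]
  have h₄ : ((Ks.flatMap clauseOps).map LinOp.size).sum =
      6 * Ks.length + 20 * (Ks.map List.length).sum := by
    induction Ks with
    | nil => rfl
    | cons K Ks ih =>
      rw [List.flatMap_cons, List.map_append, List.sum_append, ih]
      have : ((clauseOps K).map LinOp.size).sum = 6 + 20 * K.length := by
        rw [clauseOps, List.map_append, List.sum_append, List.map_append, List.sum_append,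
          sum_size_flatMap _ 20 K fun l _ => ?_]
        · simp [forcedOps, LinOp.size]; ring
        · simp [litOps, literalOps, LinOp.size]
      rw [this]
      simp
      ring
  simp only [bodyOps, List.map_cons, List.map_append, List.sum_cons, List.sum_append, h₁, h₂, h₃,
    h₄, LinOp.size]
  ring

/-- The reduction from satisfiability yields an expression with `h + 8` labels for a formula with up
to `2 h` variables. -/
theorem exists_reduction (h : ℕ) (Ks : List (List (ℕ × Bool)))
    (hK : ∀ K ∈ Ks, ∀ l ∈ K, l.1 / 2 < h) {p : ℕ}
    (hp : p = 2 * h + 2 * (Ks.map List.length).sum) :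
    ∃ e : KExpr (h + 8),
      e.encode (fun _ => 1) = [0, 0, 0, 1] ++ (bodyOps h p Ks).flatMap LinOp.words ∧
      e.size = 4 + 4 * p + 18 * h + 6 * Ks.length + 20 * (Ks.map List.length).sum ∧
      ((∃ X : Finset e.Vert, IsOCT e.graph X ∧ X.card ≤ p) ↔
        ∃ x : ℕ → Bool, ∀ K ∈ Ks, ∃ l ∈ K, x l.1 = l.2) := by
  obtain ⟨e, henc, hsize, hoct⟩ := KExpr.exists_of_steps (k := h + 8) 0 (bodyOps h p Ks) (by omega)
    (bodyOps_wf p Ks hK)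
  refine ⟨e, by simpa using henc, by rw [hsize, sum_size_bodyOps]; ring, ?_⟩
  rw [hoct]
  constructor
  · rintro ⟨n, hn, σ, hs⟩
    exact reduction_sound Ks hK hp hn hs
  · rintro ⟨x, hx⟩
    obtain ⟨σ, hs⟩ := reduction_complete Ks hK p x hx
    exact ⟨_, hp.ge, σ, hs⟩

/-! ### Copies of programs on other registers and arrays -/

/-- The program with its registers shifted by `R` and its arrays shifted by one. -/
def Prog.shift (R : ℕ) : Prog → Prog
  | .const x a => .const (x + R) a
  | .op o x y z => .op o (x + R) (y + R) (z + R)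
  | .load x a y => .load (x + R) (a + 1) (y + R)
  | .store a y x => .store (a + 1) (y + R) (x + R)
  | .seq p q => .seq (p.shift R) (q.shift R)
  | .ite y z p q => .ite (y + R) (z + R) (p.shift R) (q.shift R)
  | .loop y z p => .loop (y + R) (z + R) (p.shift R)

/-- The state `u` carries a copy of the state `s`. -/
structure Copy (R : ℕ) (s u : State) : Prop where
  reg : ∀ r, u.reg (r + R) = s.reg r
  arr : ∀ a, u.arr (a + 1) = s.arr a

theorem Copy.setReg {R : ℕ} {s u : State} (h : Copy R s u) (x : ℕ) (v : ℤ) :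
    Copy R (s.setReg x v) (u.setReg (x + R) v) :=
  ⟨fun r => by simp [h.reg], fun a => by simp [h.arr]⟩

theorem Copy.setArr {R : ℕ} {s u : State} (h : Copy R s u) (a : ℕ) (i v : ℤ) :
    Copy R (s.setArr a i v) (u.setArr (a + 1) i v) :=
  ⟨fun r => by simp [h.reg], fun b => by simp [h.arr]⟩

/-- The shifted program runs on a copy as the program does, and leaves the registers below `R` alone. -/
theorem Exec.shift {B : ℕ} (R : ℕ) {P : Prog} {s s' : State} {t : ℕ} (h : Exec B P s t s') :
    ∀ u, Copy R s u → ∃ u', Exec B (P.shift R) u t u' ∧ Copy R s' u' ∧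
      ∀ r < R, u'.reg r = u.reg r := by
  have hne : ∀ {r x : ℕ}, r < R → r ≠ x + R := by intros; omega
  induction h with
  | const h => exact fun u hu => ⟨_, .const h, hu.setReg _ _, fun r hr => by simp [hne hr]⟩
  | @op s o x y z h =>
    intro u hu
    rw [← hu.reg y, ← hu.reg z] at h ⊢
    exact ⟨_, .op h, hu.setReg _ _, fun r hr => by simp [hne hr]⟩
  | @load s x a y =>
    intro u hu
    rw [← hu.reg y, ← hu.arr a]
    exact ⟨_, .load, hu.setReg _ _, fun r hr => by simp [hne hr]⟩
  | @store s a y x =>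
    intro u hu
    rw [← hu.reg y, ← hu.reg x]
    exact ⟨_, .store, hu.setArr _ _ _, fun r hr => rfl⟩
  | seq _ _ ih ih' =>
    intro u hu
    obtain ⟨u', he, hu', hr⟩ := ih u hu
    obtain ⟨u'', he', hu'', hr'⟩ := ih' u' hu'
    exact ⟨u'', .seq he he', hu'', fun r h => by rw [hr' r h, hr r h]⟩
  | ite_true hc _ ih =>
    intro u hu
    obtain ⟨u', he, hu', hr⟩ := ih u hu
    exact ⟨u', .ite_true (by rwa [hu.reg, hu.reg]) he, hu', hr⟩
  | ite_false hc _ ih =>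
    intro u hu
    obtain ⟨u', he, hu', hr⟩ := ih u hu
    exact ⟨u', .ite_false (by rwa [hu.reg, hu.reg]) he, hu', hr⟩
  | loop_true hc _ _ ih ih' =>
    intro u hu
    obtain ⟨u', he, hu', hr⟩ := ih u hu
    obtain ⟨u'', he', hu'', hr'⟩ := ih' u' hu'
    exact ⟨u'', .loop_true (by rwa [hu.reg, hu.reg]) he he', hu'',
      fun r h => by rw [hr' r h, hr r h]⟩
  | loop_false hc => exact fun u hu => ⟨u, .loop_false (by rwa [hu.reg, hu.reg]), hu, fun _ _ => rfl⟩

/-! ### Programs that write an instance -/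

/-! Registers: `0` to `7` hold the constants `0` to `7`, `8` the label of a class, `9` the label of a
reference vertex, `10` and `11` the labels that a literal gadget joins last, `12` the number of words
written so far, `13` the number of variables, `14` the number of clauses, `15` the position in the
input, `16` and `19` loop counters, `17` the number of classes, `18` the budget, `20` the length of a
clause, `21` first the number of labels and later the current literal, `22` the length of the input,
and `23` is scratch. The input is in the array `0`, and the output goes to the array `1`. -/

/-- The array that holds the words of a list from cell `0` on, and zeros elsewhere. -/
def listArr (L : List ℤ) : ℤ → ℤ := fun i => if 0 ≤ i then L.getD i.toNat 0 else 0

theorem initState_arr_zero (x : List ℤ) : (initState x).arr 0 = listArr x := by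
  funext i
  simp [initState, listArr]

theorem listArr_concat (L : List ℤ) (w : ℤ) :
    Function.update (listArr L) (L.length : ℤ) w = listArr (L ++ [w]) := by
  funext i
  rcases lt_or_ge i 0 with hi | hi
  · rw [Function.update_of_ne (by omega)]
    simp [listArr, not_le.2 hi]
  · lift i to ℕ using hi
    by_cases h : i = L.length
    · subst h; simp [listArr]
    · rw [Function.update_of_ne (by exact_mod_cast h)]
      simp only [listArr, Int.natCast_nonneg, if_true, Int.toNat_natCast]
      rcases Nat.lt_or_ge i L.length with h' | h'
      · rw [List.getD_append _ _ _ _ h']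
      · rw [List.getD_eq_default _ _ h', List.getD_eq_default _ _ (by simp; omega)]

/-- Append the contents of the registers `rs` to the output, then continue with `q`. -/
def emit : List ℕ → Prog → Prog
  | [], q => q
  | r :: rs, q => .store 1 12 r ;; .op .add 12 12 1 ;; emit rs q

/-- The state while the output `W` is written from the input `x`; the words `todo` are still to be
written. -/
structure Writes (x W : List ℤ) (m h p : ℕ) (s : State) (todo : List ℤ) : Prop where
  const : ∀ c < 8, s.reg c = c
  input : s.arr 0 = listArr x
  arrs : ∀ a, s.arr (a + 2) = fun _ => 0
  regs : ∀ r ≥ 24, s.reg r = 0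
  clauses : s.reg 14 = m
  classes : s.reg 17 = h
  budget : s.reg 18 = p
  output : ∃ L, L ++ todo = W ∧ s.reg 12 = L.length ∧ s.arr 1 = listArr L

section Writing

variable {x W : List ℤ} {m h p : ℕ} {s : State} {todo : List ℤ} {B : ℕ}

theorem Writes.setReg (hs : Writes x W m h p s todo) {r : ℕ} (v : ℤ)
    (hr : 8 ≤ r ∧ r < 24 ∧ r ≠ 12 ∧ r ≠ 14 ∧ r ≠ 17 ∧ r ≠ 18) :
    Writes x W m h p (s.setReg r v) todo := by
  obtain ⟨h8, h24, h12, h14, h17, h18⟩ := hr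
  refine ⟨fun c hc => ?_, hs.input, hs.arrs, fun c hc => ?_, ?_, ?_, ?_, ?_⟩
  · rw [State.setReg_reg, if_neg (by omega), hs.const c hc]
  · rw [State.setReg_reg, if_neg (by omega), hs.regs c hc]
  · rw [State.setReg_reg, if_neg h14.symm, hs.clauses]
  · rw [State.setReg_reg, if_neg h17.symm, hs.classes]
  · rw [State.setReg_reg, if_neg h18.symm, hs.budget]
  · obtain ⟨L, hL, h, h'⟩ := hs.output
    exact ⟨L, hL, by rw [State.setReg_reg, if_neg h12.symm, h], h'⟩

theorem runs_emit {rs : List ℕ} {q : Prog} {ws : List ℤ} {t : ℕ} {Q : State → Prop}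
    (hs : Writes x W m h p s (ws ++ todo)) (hrs : 12 ∉ rs) (hws : rs.map s.reg = ws)
    (hB : W.length ≤ B)
    (hq : ∀ s', Writes x W m h p s' todo → (∀ r, r ≠ 12 → s'.reg r = s.reg r) → Runs B q s' t Q) :
    Runs B (emit rs q) s (t + 2 * rs.length) Q := by
  induction rs generalizing s ws with
  | nil =>
    subst hws
    exact hq s hs fun _ _ => rfl
  | cons r rs ih =>
    subst hws
    simp only [List.mem_cons, not_or] at hrs
    obtain ⟨L, hL, h12, harr⟩ := hs.output
    have hlen : L.length + 1 ≤ W.length := by rw [← hL]; simp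
    rw [List.length_cons, show t + 2 * (rs.length + 1) = t + 2 * rs.length + 1 + 1 by ring]
    refine Runs.seq_store L.length _ h12 rfl ?_
    refine Runs.seq_op (L.length + 1) ?_ ?_ ?_
    · simp only [Op.eval, State.setArr_reg, h12, hs.const 1 (by norm_num)]
      simp
    · rw [abs_of_nonneg (by positivity)]
      exact_mod_cast hlen.trans hB
    · have hne : ∀ r', r' ≠ 12 → ((s.setArr 1 L.length (s.reg r)).setReg 12 (L.length + 1)).reg r' =
          s.reg r' := fun r' h => by simp [h]
      have hmap : rs.map ((s.setArr 1 L.length (s.reg r)).setReg 12 (L.length + 1)).reg =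
          rs.map s.reg := List.map_congr_left fun r' hr' => hne r' fun h => hrs.2 (h ▸ hr')
      refine ih (ws := rs.map s.reg) ⟨?_, ?_, ?_, ?_, ?_, ?_, ?_, ?_⟩ hrs.2 hmap
        fun s' hs' hreg => hq s' hs' fun r' hr' => by rw [hreg r' hr', hne r' hr']
      · intro c hc
        rw [hne c (by omega), hs.const c hc]
      · simpa using hs.input
      · intro a; simpa using hs.arrs a
      · intro c hc
        rw [hne c (by omega), hs.regs c hc]
      · rw [hne _ (by norm_num), hs.clauses]
      · rw [hne _ (by norm_num), hs.classes]
      · rw [hne _ (by norm_num), hs.budget]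
      · refine ⟨L ++ [s.reg r], by rw [← hL]; simp, by simp, ?_⟩
        simp only [State.setReg_arr, State.setArr_arr, if_true, harr, listArr_concat]

/-- A loop that processes the elements of a list; `I L s` holds if the elements of `L` are still to be
processed. -/
theorem Runs.loop_list {α : Type} {P : Prog} {y z t : ℕ} (I : List α → State → Prop)
    (hstep : ∀ a L s, I (a :: L) s → s.reg y < s.reg z ∧ Runs B P s t (I L))
    (hend : ∀ s, I [] s → ¬ s.reg y < s.reg z) (L : List α) (s : State) (h0 : I L s) :
    Runs B (.loop y z P) s (L.length * (t + 1) + 1) (I []) := by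
  induction L generalizing s with
  | nil => exact ⟨1, s, by simp, .loop_false (hend s h0), h0⟩
  | cons a L ih =>
    obtain ⟨hc, u, s', hu, he, hI⟩ := hstep a L s h0
    obtain ⟨u', s'', hu', he', hq⟩ := ih s' hI
    exact ⟨u + u' + 1, s'', by rw [List.length_cons, Nat.succ_mul]; omega, .loop_true hc he he', hq⟩

/-! ### The program for the reduction -/

/-- The words of the operations, as a single list. -/
def opWords (L : List LinOp) : List ℤ := L.flatMap LinOp.words

theorem opWords_append (L L' : List LinOp) : opWords (L ++ L') = opWords L ++ opWords L' :=
  List.flatMap_append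

theorem opWords_flatMap {α : Type} (L : List α) (f : α → List LinOp) :
    opWords (L.flatMap f) = L.flatMap fun a => opWords (f a) := by
  simp [opWords, List.flatMap_assoc]

/-- Write the reference vertices. -/
def refsProg : Prog :=
  .const 16 0 ;;
    .loop 16 18 (emit [0, 0, 0, 1, 1, 0, 0, 0, 0, 1, 0, 1, 1, 0, 0, 0] (.op .add 16 16 1))

theorem opWords_refOps (p : ℕ) : opWords (refOps p) =
    (List.replicate p ()).flatMap fun _ => [0, 0, 0, 1, 1, 0, 0, 0, 0, 1, 0, 1, 1, 0, 0, 0] := by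
  induction p with
  | zero => rfl
  | succ p ih =>
    rw [refOps, List.replicate_succ, List.flatten_cons, ← refOps, opWords_append, ih,
      List.replicate_succ, List.flatMap_cons]
    simp [opWords, LinOp.words]

theorem runs_refsProg (hs : Writes x W m h p s (opWords (refOps p) ++ todo)) (hB : W.length ≤ B)
    (hp : p ≤ B) : Runs B refsProg s (p * 34 + 2) fun s' => Writes x W m h p s' todo := by
  refine Runs.seq_const (t := p * 34 + 1) (by simp) ?_
  rw [opWords_refOps] at hs
  have key := Runs.loop_list (B := B) (y := 16) (z := 18) (t := 33)
    (P := emit [0, 0, 0, 1, 1, 0, 0, 0, 0, 1, 0, 1, 1, 0, 0, 0] (.op .add 16 16 1))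
    (fun (L : List Unit) s => Writes x W m h p s ((L.flatMap fun _ =>
      [0, 0, 0, 1, 1, 0, 0, 0, 0, 1, 0, 1, 1, 0, 0, 0]) ++ todo) ∧
      (0 ≤ s.reg 16 ∧ s.reg 16 + L.length = p)) ?_ ?_ (List.replicate p ()) (s.setReg 16 0)
      ⟨hs.setReg _ (by norm_num), by simp⟩
  · exact key.mono (by simp) fun s' h => h.1
  · rintro a L s ⟨hs, h0, hj⟩
    rw [List.length_cons, Nat.cast_succ] at hj
    refine ⟨by rw [hs.budget]; omega, ?_⟩
    rw [List.flatMap_cons, List.append_assoc] at hs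
    refine (runs_emit (t := 1) hs (by decide) ?_ hB fun s' hs' hreg => ?_).mono_time (by simp)
    · simp [hs.const]
    · have h16 := hreg 16 (by norm_num)
      refine Runs.op (s.reg 16 + 1) ?_ ?_ ⟨hs'.setReg _ (by norm_num), ?_, ?_⟩
      · simp [Op.eval, h16, hs'.const]
      · rw [abs_of_nonneg (by omega)]; omega
      · simp; omega
      · simp; omega
  · rintro s ⟨hs, h0, hj⟩
    rw [hs.budget]
    simp at hj
    omega

/-- Write one block of operations for each class; `tm` names the registers that hold the words of the
block. -/
def layerProg (tm : List ℕ) : Prog :=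
  .const 8 8 ;; .const 16 0 ;;
    .loop 16 17 (emit tm (.op .add 8 8 1 ;; .op .add 16 16 1))

theorem runs_layerProg {tm : List ℕ} (f : ℕ → List ℤ) (h12 : 12 ∉ tm)
    (htm : ∀ (s : State) (i : ℕ), (∀ c < 8, s.reg c = c) → s.reg 8 = 8 + i → tm.map s.reg = f i)
    (hs : Writes x W m h p s ((List.range h).flatMap f ++ todo)) (hB : W.length ≤ B)
    (hh : h + 8 ≤ B) :
    Runs B (layerProg tm) s (h * (2 * tm.length + 3) + 3) fun s' => Writes x W m h p s' todo := by
  refine Runs.mono (t := h * (2 + 2 * tm.length + 1) + 1 + 1 + 1)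
    (Q := fun s' => ∃ i, ([] : List ℕ) = List.range' i (h - i) ∧ i ≤ h ∧ s'.reg 8 = 8 + i ∧
      s'.reg 16 = i ∧ Writes x W m h p s' ([] ++ todo))
    (Runs.seq_const (by simp; omega) (Runs.seq_const (by simp) ?_)) (by
      rw [show 2 + 2 * tm.length + 1 = 2 * tm.length + 3 by ring]) fun s' ⟨_, _, _, _, _, h⟩ => h
  have key := Runs.loop_list (B := B) (y := 16) (z := 17) (t := 2 + 2 * tm.length)
    (P := emit tm (.op .add 8 8 1 ;; .op .add 16 16 1))
    (fun (L : List ℕ) s => ∃ i, L = List.range' i (h - i) ∧ i ≤ h ∧ s.reg 8 = 8 + i ∧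
      s.reg 16 = i ∧ Writes x W m h p s (L.flatMap f ++ todo)) ?_ ?_ (List.range h)
      ((s.setReg 8 8).setReg 16 0)
      ⟨0, by simp [List.range_eq_range'], by omega, by simp, by simp,
        (hs.setReg _ (by norm_num)).setReg _ (by norm_num)⟩
  · simpa using key
  · rintro a L s ⟨i, hL, hi, h8, h16, hs⟩
    have hlt : i < h := by
      by_contra hcon
      rw [show h - i = 0 by omega] at hL
      simp at hL
    obtain ⟨j, hj⟩ : ∃ j, h - i = j + 1 := ⟨h - i - 1, by omega⟩
    rw [hj, List.range'_succ, List.cons.injEq] at hL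
    obtain ⟨rfl, rfl⟩ := hL
    refine ⟨by rw [hs.classes, h16]; exact_mod_cast hlt, ?_⟩
    rw [List.flatMap_cons, List.append_assoc] at hs
    refine runs_emit (t := 2) hs h12 (htm s a hs.const h8) hB fun s' hs' hreg => ?_
    have e8 := hreg 8 (by norm_num)
    have e16 := hreg 16 (by norm_num)
    refine (Runs.seq_op (t := 1) (8 + a + 1) ?_ ?_ (Runs.op (a + 1) ?_ ?_
      ⟨a + 1, ?_, hlt, ?_, ?_, (hs'.setReg _ (by norm_num)).setReg _ (by norm_num)⟩))
    · simp [Op.eval, e8, h8, hs'.const]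
    · rw [abs_of_nonneg (by omega)]; omega
    · simp [Op.eval, e16, h16, hs'.const]
    · rw [abs_of_nonneg (by omega)]; omega
    · rw [show h - (a + 1) = j by omega]
    · simp; omega
    · simp
  · rintro s ⟨i, hL, hi, h8, h16, hs⟩
    rw [hs.classes, h16]
    have : h - i = 0 := by
      have := congrArg List.length hL
      simpa using this.symm
    omega

/-- The word of a literal. -/
def litWord (l : ℕ × Bool) : ℤ := 2 * (l.1 : ℤ) + if l.2 then 1 else 0

/-- The words of a clause. -/
def clauseWords (K : List (ℕ × Bool)) : List ℤ := (K.length : ℤ) :: K.map litWord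

/-- The registers that hold the words for a literal. -/
def literalRegs : List ℕ :=
  [0, 3, 0, 1, 1, 0, 0, 0, 0, 4, 0, 1, 1, 0, 0, 0, 2, 3, 9, 0, 2, 4, 9, 0, 2, 3, 4, 0, 2, 3, 8, 0,
    0, 5, 0, 1, 1, 0, 0, 0, 0, 6, 0, 1, 1, 0, 0, 0, 2, 5, 1, 0, 2, 5, 6, 0, 2, 5, 7, 0,
    2, 10, 11, 0, 3, 4, 8, 0, 3, 3, 2, 0, 3, 6, 2, 0, 3, 5, 7, 0]

theorem map_literalRegs {i : ℕ} {b t : Bool} (hc : ∀ c < 8, s.reg c = c) (h8 : s.reg 8 = 8 + i)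
    (h9 : s.reg 9 = refLabel b) (h10 : s.reg 10 = if b then 5 else 6)
    (h11 : s.reg 11 = if t then 3 else 4) :
    literalRegs.map s.reg = opWords (literalOps i b t) := by
  cases b <;> cases t <;>
    simp [literalRegs, opWords, literalOps, LinOp.words, hc, h8, h9, h10, h11]

/-- Write the operations for the literals of a clause. The word `2 v + s` of a literal is split into
the variable `v = 2 i + b` and the sign `s`. -/
def literalsProg : Prog :=
  .loop 19 20 (
    .load 21 0 15 ;; .op .add 15 15 1 ;; .op .div 9 21 2 ;; .op .mul 10 9 2 ;; .op .sub 11 21 10 ;;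
    .op .sub 11 4 11 ;; .op .div 8 9 2 ;; .op .mul 10 8 2 ;; .op .sub 9 9 10 ;; .op .sub 10 6 9 ;;
    .const 23 8 ;; .op .add 8 8 23 ;; emit literalRegs (.op .add 19 19 1))

theorem runs_literalsProg {n : ℕ} (K : List (ℕ × Bool)) (hK : ∀ l ∈ K, l.1 < n)
    (hs : Writes x W m h p s (K.flatMap (fun l => opWords (litOps l)) ++ todo))
    (h19 : s.reg 19 = 0) (h20 : s.reg 20 = K.length) (h15 : 0 ≤ s.reg 15)
    (hx : Holds (listArr x) (s.reg 15) (K.map litWord)) (hB : W.length ≤ B)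
    (hn : 2 * n + 8 ≤ B) (hlen : s.reg 15 + K.length ≤ B) :
    Runs B literalsProg s (K.length * 174 + 1) fun s' => Writes x W m h p s' todo ∧
      s'.reg 15 = s.reg 15 + K.length ∧ s'.reg 16 = s.reg 16 := by
  have key := Runs.loop_list (B := B) (y := 19) (z := 20) (t := 173)
    (P := .load 21 0 15 ;; .op .add 15 15 1 ;; .op .div 9 21 2 ;; .op .mul 10 9 2 ;;
      .op .sub 11 21 10 ;; .op .sub 11 4 11 ;; .op .div 8 9 2 ;; .op .mul 10 8 2 ;;
      .op .sub 9 9 10 ;; .op .sub 10 6 9 ;; .const 23 8 ;; .op .add 8 8 23 ;;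
      emit literalRegs (.op .add 19 19 1))
    (fun (L : List (ℕ × Bool)) u => (∀ l ∈ L, l.1 < n) ∧
      Writes x W m h p u (L.flatMap (fun l => opWords (litOps l)) ++ todo) ∧
      u.reg 16 = s.reg 16 ∧ u.reg 15 + L.length = s.reg 15 + K.length ∧ s.reg 15 ≤ u.reg 15 ∧
      u.reg 20 = K.length ∧ u.reg 19 + L.length = K.length ∧ 0 ≤ u.reg 19 ∧
      Holds (listArr x) (u.reg 15) (L.map litWord)) ?_ ?_ K s
      ⟨hK, hs, rfl, rfl, le_rfl, h20, by rw [h19, zero_add], h19.ge, hx⟩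
  · refine key.mono (by omega) ?_
    rintro u ⟨-, hu, u16, u15, -⟩
    exact ⟨hu, by simpa using u15, u16⟩
  · rintro ⟨v, t⟩ L u ⟨hL, hu, u16, u15, hle, u20, u19, hpos, hold⟩
    rw [List.length_cons, Nat.cast_succ] at u15 u19
    refine ⟨by omega, ?_⟩
    obtain ⟨hw, hold⟩ := hold
    have hv : v < n := hL (v, t) (by simp)
    rw [List.flatMap_cons, List.append_assoc] at hu
    have c1 := hu.const 1 (by norm_num)
    have c2 := hu.const 2 (by norm_num)
    have c4 := hu.const 4 (by norm_num)
    have c6 := hu.const 6 (by norm_num)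
    obtain ⟨τ, hτ, hτ0, hτ1⟩ : ∃ τ : ℤ, (if t = true then (1 : ℤ) else 0) = τ ∧ 0 ≤ τ ∧ τ ≤ 1 := by
      cases t <;> simp
    rw [litWord, hτ] at hw
    have hdiv : (2 * (v : ℤ) + τ) / 2 = v := by omega
    have hb1 : |((v : ℕ) : ℤ) / 2| ≤ B := by rw [abs_of_nonneg (by omega)]; omega
    refine Runs.mono_time (t := 1 + 2 * literalRegs.length + 12) ?_ (by simp [literalRegs])
    refine Runs.seq_load (2 * v + τ) (by rw [hu.input, hw]) ?_
    refine Runs.seq_op (u.reg 15 + 1) (by simp [Op.eval, c1]) (by rw [abs_of_nonneg] <;> omega) ?_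
    refine Runs.seq_op v (by simp [Op.eval, c2, hdiv]) (by rw [abs_of_nonneg] <;> omega) ?_
    refine Runs.seq_op (v * 2) (by simp [Op.eval, c2]) (by rw [abs_of_nonneg] <;> omega) ?_
    refine Runs.seq_op τ (by simp [Op.eval]; ring) (by rw [abs_of_nonneg] <;> omega) ?_
    refine Runs.seq_op (4 - τ) (by simp [Op.eval, c4]) (by rw [abs_of_nonneg] <;> omega) ?_
    refine Runs.seq_op (v / 2) (by simp [Op.eval, c2]) hb1 ?_
    refine Runs.seq_op (v / 2 * 2) (by simp [Op.eval, c2]) (by rw [abs_of_nonneg] <;> omega) ?_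
    refine Runs.seq_op (v - v / 2 * 2) (by simp [Op.eval]) (by rw [abs_of_nonneg] <;> omega) ?_
    refine Runs.seq_op (6 - (v - v / 2 * 2)) (by simp [Op.eval, c6])
      (by rw [abs_of_nonneg] <;> omega) ?_
    refine Runs.seq_const (by simp; omega) ?_
    refine Runs.seq_op (8 + v / 2) (by simp [Op.eval]; ring) (by rw [abs_of_nonneg] <;> omega) ?_
    refine runs_emit (ws := opWords (litOps (v, t))) (t := 1)
      ((((((((((((hu.setReg _ (by norm_num)).setReg _ (by norm_num)).setReg _ (by norm_num)).setReg _
      (by norm_num)).setReg _ (by norm_num)).setReg _ (by norm_num)).setReg _ (by norm_num)).setReg _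
      (by norm_num)).setReg _ (by norm_num)).setReg _ (by norm_num)).setReg _ (by norm_num)).setReg _
      (by norm_num)) (by decide) ?_ hB fun u' hu' hreg => ?_
    · refine map_literalRegs ?_ ?_ ?_ ?_ ?_
      · intro c hc
        have := hu.const c hc
        simp only [State.setReg_reg]
        rw [if_neg, if_neg, if_neg, if_neg, if_neg, if_neg, if_neg, if_neg, if_neg, if_neg, if_neg,
          if_neg, this] <;> omega
      · simp
      · rcases Nat.mod_two_eq_zero_or_one v with h | h <;> simp [h, refLabel] <;> omega
      · rcases Nat.mod_two_eq_zero_or_one v with h | h <;> simp [h] <;> omega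
      · simp [← hτ]; cases t <;> simp
    · have e15 := hreg 15 (by norm_num)
      have e16 := hreg 16 (by norm_num)
      have e19 := hreg 19 (by norm_num)
      have e20 := hreg 20 (by norm_num)
      simp only [State.setReg_reg] at e15 e16 e19 e20
      norm_num at e15 e16 e19 e20
      refine Runs.op (u.reg 19 + 1) (by simp [Op.eval, e19, hu'.const])
        (by rw [abs_of_nonneg] <;> omega) ⟨fun l hl => hL l (by simp [hl]),
          hu'.setReg _ (by norm_num), ?_, ?_, ?_, ?_, ?_, ?_, ?_⟩
      · simp [e16, u16]
      · simp [e15]; omega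
      · simp [e15]; omega
      · simp [e20, u20]
      · simp; omega
      · simp; omega
      · simpa [e15] using hold
  · rintro u ⟨-, hu, u16, u15, hle, u20, u19, -⟩
    simp at u19
    omega

/-- Write the operations for the clauses. -/
def clausesProg : Prog :=
  .const 15 2 ;; .const 16 0 ;;
    .loop 16 14 (.load 20 0 15 ;; .op .add 15 15 1 ;; .const 19 0 ;;
      emit [0, 5, 0, 1, 1, 0, 0, 0, 2, 5, 0, 0, 2, 5, 1, 0, 3, 5, 2, 0] (literalsProg ;;
      emit [3, 7, 2, 0] (.op .add 16 16 1)))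

theorem opWords_clauseOps (K : List (ℕ × Bool)) : opWords (clauseOps K) =
    [0, 5, 0, 1, 1, 0, 0, 0, 2, 5, 0, 0, 2, 5, 1, 0, 3, 5, 2, 0] ++
      (K.flatMap (fun l => opWords (litOps l)) ++ [3, 7, 2, 0]) := by
  rw [clauseOps, opWords_append, opWords_append, opWords_flatMap]
  simp [opWords, forcedOps, LinOp.words]

/-- The number `ℓ` bounds the lengths of the clauses; in the application it is the length of the
input. -/
theorem runs_clausesProg {n ℓ : ℕ} (Ks : List (List (ℕ × Bool)))
    (hK : ∀ K ∈ Ks, K.length ≤ ℓ ∧ ∀ l ∈ K, l.1 < n) (hm : Ks.length = m)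
    (hs : Writes x W m h p s (opWords (Ks.flatMap clauseOps) ++ todo))
    (hx : Holds (listArr x) 2 (Ks.flatMap clauseWords)) (hB : W.length ≤ B)
    (hn : 2 * n + 8 ≤ B) (hlen : 2 + (Ks.flatMap clauseWords).length ≤ B) :
    Runs B clausesProg s (m * (ℓ * 174 + 54) + 3) fun s' => Writes x W m h p s' todo := by
  subst hm
  rw [opWords_flatMap] at hs
  have hlen2 : Ks.length ≤ (Ks.flatMap clauseWords).length := by
    clear hlen hx hs hK
    induction Ks with
    | nil => simp
    | cons K Ks ih => rw [List.flatMap_cons, List.length_append, List.length_cons, clauseWords,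
                        List.length_cons]; omega
  refine Runs.mono_time (t := Ks.length * (ℓ * 174 + 54) + 1 + 1 + 1)
    (Runs.seq_const (by simp; omega) (Runs.seq_const (by simp) ?_)) (by omega)
  rw [show ℓ * 174 + 54 = ℓ * 174 + 53 + 1 from rfl]
  refine Runs.mono (Runs.loop_list (t := ℓ * 174 + 53)
    (fun (L : List (List (ℕ × Bool))) u => (∀ K ∈ L, K.length ≤ ℓ ∧ ∀ l ∈ K, l.1 < n) ∧
      Writes x W Ks.length h p u (L.flatMap (fun K => opWords (clauseOps K)) ++ todo) ∧
      0 ≤ u.reg 15 ∧ u.reg 15 + (L.flatMap clauseWords).length ≤ B ∧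
      u.reg 16 + L.length = Ks.length ∧ 0 ≤ u.reg 16 ∧
      Holds (listArr x) (u.reg 15) (L.flatMap clauseWords)) ?_ ?_ Ks
      ((s.setReg 15 2).setReg 16 0)
      ⟨hK, (hs.setReg _ (by norm_num)).setReg _ (by norm_num), by simp, ?_, by simp, by simp,
        by simpa using hx⟩) le_rfl fun s' h => h.2.1
  · rintro K L u ⟨hL, hu, u15, u15', u16, hpos, hold⟩
    rw [List.length_cons, Nat.cast_succ] at u16
    refine ⟨by rw [hu.clauses]; omega, ?_⟩
    rw [List.flatMap_cons, List.append_assoc, opWords_clauseOps, List.append_assoc,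
      List.append_assoc] at hu
    rw [List.flatMap_cons, clauseWords, List.length_append, List.length_cons, List.length_map]
      at u15'
    push_cast at u15'
    rw [List.flatMap_cons, clauseWords, List.cons_append] at hold
    obtain ⟨hw, hold⟩ := hold
    rw [holds_append, List.length_map] at hold
    obtain ⟨hlits, hold⟩ := hold
    obtain ⟨hKℓ, hKn⟩ := hL K (by simp)
    have c1 := hu.const 1 (by norm_num)
    refine Runs.mono_time (t := (K.length * 174 + 1 + (1 + 8)) + 40 + 3) ?_ (by omega)
    refine Runs.seq_load K.length (by rw [hu.input, hw]) ?_
    refine Runs.seq_op (u.reg 15 + 1) (by simp [Op.eval, c1]) (by rw [abs_of_nonneg] <;> omega) ?_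
    refine Runs.seq_const (by simp) ?_
    have hu2 := ((hu.setReg (r := 20) K.length (by norm_num)).setReg (r := 15) (u.reg 15 + 1)
      (by norm_num)).setReg (r := 19) 0 (by norm_num)
    refine runs_emit hu2 (by decide) ?_ hB fun u' hu' hreg => ?_
    · simp [hu.const]
    · have e15 := hreg 15 (by norm_num)
      have e16 := hreg 16 (by norm_num)
      have e19 := hreg 19 (by norm_num)
      have e20 := hreg 20 (by norm_num)
      simp only [State.setReg_reg] at e15 e16 e19 e20
      norm_num at e15 e16 e19 e20
      refine Runs.seq (t := K.length * 174 + 1) (t' := 1 + 8) ((runs_literalsProg K hKn hu' e19 e20 (by omega) (by rwa [e15]) hB hn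
        (by omega)).mono le_rfl ?_)
      rintro v ⟨hv, v15, v16⟩
      refine runs_emit (t := 1) hv (by decide) (by simp [hv.const]) hB fun v' hv' hreg' => ?_
      have f15 := hreg' 15 (by norm_num)
      have f16 := hreg' 16 (by norm_num)
      have h15 : v'.reg 15 = u.reg 15 + 1 + K.length := by rw [f15, v15, e15]
      have h16 : v'.reg 16 = u.reg 16 := by rw [f16, v16, e16]
      refine Runs.op (u.reg 16 + 1) (by simp [Op.eval, h16, hv'.const])
        (by rw [abs_of_nonneg] <;> omega) ⟨fun l hl => hL l (by simp [hl]),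
          hv'.setReg _ (by norm_num), ?_, ?_, ?_, ?_, ?_⟩
      · simp [h15]; omega
      · simp [h15]; simp at u15'; omega
      · simp; omega
      · simp; omega
      · simpa [h15] using hold
  · rintro u ⟨-, hu, -, -, u16, -⟩
    rw [hu.clauses]
    simp at u16
    omega
  · rw [show ((s.setReg 15 2).setReg 16 0).reg 15 = 2 by simp]
    exact_mod_cast hlen

/-- The registers that hold the words for the creation of a class. -/
def initRegs : List ℕ :=
  [0, 4, 0, 1, 1, 0, 0, 0, 2, 4, 1, 0, 3, 4, 8, 0, 0, 4, 0, 1, 1, 0, 0, 0, 2, 4, 0, 0, 3, 4, 8, 0]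

/-- The registers that hold the words for the final vertices of a class. -/
def finalRegs : List ℕ :=
  [0, 4, 0, 1, 1, 0, 0, 0, 2, 4, 1, 0, 2, 4, 8, 0, 3, 4, 2, 0,
    0, 4, 0, 1, 1, 0, 0, 0, 2, 4, 0, 0, 2, 4, 8, 0, 3, 4, 2, 0]

/-- The reduction: a program that writes an instance into the array `1`, where a shifted program finds
its input; `hdr` names the registers that hold the words before the expression. -/
def reductionProg (hdr : List ℕ) : Prog :=
  .op .add 22 0 1 ;; .const 0 0 ;; .const 1 1 ;; .const 2 2 ;; .const 3 3 ;; .const 4 4 ;;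
  .const 5 5 ;; .const 6 6 ;; .const 7 7 ;; .load 13 0 0 ;; .load 14 0 1 ;;
  .op .add 17 13 1 ;; .op .div 17 17 2 ;; .op .sub 18 22 2 ;; .op .sub 18 18 14 ;;
  .op .add 18 18 17 ;; .op .mul 18 18 2 ;; .const 21 8 ;; .op .add 21 21 17 ;;
  emit (hdr ++ [0, 0, 0, 1, 0, 1, 0, 1, 1, 0, 0, 0]) (refsProg ;;
  emit [2, 0, 1, 0] (layerProg initRegs ;; clausesProg ;; layerProg finalRegs ;; .op .add 24 12 0))

/-- The words of a formula. -/
def satWords (n : ℕ) (Ks : List (List (ℕ × Bool))) : List ℤ :=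
  (n : ℤ) :: (Ks.length : ℤ) :: Ks.flatMap clauseWords

theorem length_satWords (n : ℕ) (Ks : List (List (ℕ × Bool))) :
    (satWords n Ks).length = 2 + Ks.length + (Ks.map List.length).sum := by
  have : (Ks.flatMap clauseWords).length = Ks.length + (Ks.map List.length).sum := by
    induction Ks with
    | nil => rfl
    | cons K Ks ih =>
      rw [List.flatMap_cons, List.length_append, ih]
      simp [clauseWords]
      ring
  simp [satWords, this]
  ring

/-- The words of the instance that the reduction constructs. -/
def instWords (hw : List ℤ) (h p : ℕ) (Ks : List (List (ℕ × Bool))) : List ℤ :=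
  hw ++ ([0, 0, 0, 1] ++ opWords (bodyOps h p Ks))

theorem opWords_initOps (h : ℕ) : opWords (initOps h) = (List.range h).flatMap fun i =>
    opWords (layerInitOps i true ++ layerInitOps i false) := opWords_flatMap _ _

theorem opWords_finalOps (h : ℕ) : opWords (finalOps h) = (List.range h).flatMap fun i =>
    opWords (layerFinalOps i true ++ layerFinalOps i false) := opWords_flatMap _ _

theorem instWords_eq (hw : List ℤ) (h p : ℕ) (Ks : List (List (ℕ × Bool))) :
    instWords hw h p Ks = (hw ++ [0, 0, 0, 1, 0, 1, 0, 1, 1, 0, 0, 0]) ++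
      (opWords (refOps p) ++ ([2, 0, 1, 0] ++ (opWords (initOps h) ++
      (opWords (Ks.flatMap clauseOps) ++ (opWords (finalOps h) ++ []))))) := by
  simp [instWords, bodyOps, opWords, LinOp.words]

/-- From the words of a formula, the reduction program prepares a copy of the initial state of a program
whose input is the instance. -/
theorem runs_reductionProg {n : ℕ} (Ks : List (List (ℕ × Bool)))
    (hK : ∀ K ∈ Ks, ∀ l ∈ K, l.1 < n) (hh : h = (n + 1) / 2)
    (hp : p = 2 * h + 2 * (Ks.map List.length).sum) {hdr : List ℕ} {hw : List ℤ} (h12 : 12 ∉ hdr)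
    (hhdr : ∀ s : State, s.reg 18 = p → s.reg 21 = h + 8 → hdr.map s.reg = hw)
    (hB : (instWords hw h p Ks).length ≤ B) (hn : 2 * n + p + 8 ≤ B)
    (hlen : (satWords n Ks).length ≤ B) :
    Runs B (reductionProg hdr) (initState (satWords n Ks))
      (100 + 2 * hdr.length + p * 34 + h * 150 + Ks.length * ((satWords n Ks).length * 174 + 54))
      fun u => Copy 24 (initState (instWords hw h p Ks)) u ∧ (∀ c < 8, u.reg c = c) ∧
        u.reg 18 = p := by
  have hlen' := length_satWords n Ks
  set ℓ := (satWords n Ks).length with hℓ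
  set L := (Ks.map List.length).sum with hL
  have hKℓ : ∀ K ∈ Ks, K.length ≤ ℓ ∧ ∀ l ∈ K, l.1 < n := fun K hK' => by
    have : K.length ≤ L := List.le_sum_of_mem (List.mem_map_of_mem hK')
    exact ⟨by omega, hK K hK'⟩
  have hx0 : listArr (satWords n Ks) 0 = n := by simp [listArr, satWords]
  have hx1 : listArr (satWords n Ks) 1 = Ks.length := by simp [listArr, satWords]
  have harr : (initState (satWords n Ks)).arr 0 = listArr (satWords n Ks) := initState_arr_zero _
  refine Runs.mono_time (t := ((1 + (h * (2 * finalRegs.length + 3) + 3) +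
    (Ks.length * (ℓ * 174 + 54) + 3) + (h * (2 * initRegs.length + 3) + 3) + 8) + (p * 34 + 2)) +
    2 * (hdr ++ [0, 0, 0, 1, 0, 1, 0, 1, 1, 0, 0, 0]).length + 19) ?_ (by
      simp only [List.length_append, List.length_cons, List.length_nil, finalRegs, initRegs]
      omega)
  refine Runs.seq_op ℓ (by simp [Op.eval, initState, hℓ]) (by rw [abs_of_nonneg] <;> omega) ?_
  refine Runs.seq_const (by simp) ?_
  refine Runs.seq_const (by simp; omega) ?_
  refine Runs.seq_const (by simp; omega) ?_
  refine Runs.seq_const (by simp; omega) ?_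
  refine Runs.seq_const (by simp; omega) ?_
  refine Runs.seq_const (by simp; omega) ?_
  refine Runs.seq_const (by simp; omega) ?_
  refine Runs.seq_const (by simp; omega) ?_
  refine Runs.seq_load n (by simp [harr, hx0]) ?_
  refine Runs.seq_load Ks.length (by simp [harr, hx1]) ?_
  refine Runs.seq_op (n + 1) (by simp [Op.eval]) (by rw [abs_of_nonneg] <;> omega) ?_
  refine Runs.seq_op h (by simp [Op.eval]; omega) (by rw [abs_of_nonneg] <;> omega) ?_
  refine Runs.seq_op (ℓ - 2) (by simp [Op.eval]) (by rw [abs_of_nonneg] <;> omega) ?_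
  refine Runs.seq_op L (by simp [Op.eval]; omega) (by rw [abs_of_nonneg] <;> omega) ?_
  refine Runs.seq_op (L + h) (by simp [Op.eval]) (by rw [abs_of_nonneg] <;> omega) ?_
  refine Runs.seq_op p (by simp [Op.eval]; omega) (by rw [abs_of_nonneg] <;> omega) ?_
  refine Runs.seq_const (by simp; omega) ?_
  refine Runs.seq_op (8 + h) (by simp [Op.eval]) (by rw [abs_of_nonneg] <;> omega) ?_
  refine runs_emit (x := satWords n Ks) (W := instWords hw h p Ks) (m := Ks.length) (h := h) (p := p)
    ⟨?_, ?_, ?_, ?_, ?_, ?_, ?_, [], (instWords_eq _ _ _ _).symm, ?_, ?_⟩ ?_ ?_ hB fun s₁ hs₁ _ => ?_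
  · intro c hc
    interval_cases c <;> simp
  · simpa using harr
  · intro a
    funext i
    simp [initState]
  · intro r hr
    simp only [State.setReg_reg, initState]
    repeat rw [if_neg (by omega)]
  · simp
  · simp
  · simp
  · simp [initState]
  · funext i
    simp [initState, listArr]
  · simp [h12]
  · rw [List.map_append, hhdr _ (by simp) (by simp; ring)]
    simp
  · refine Runs.mono_time (Runs.seq ((runs_refsProg hs₁ hB (by omega)).mono le_rfl fun s₂ hs₂ => ?_))
      (by rw [add_comm])
    refine runs_emit hs₂ (by decide) (by simp [hs₂.const]) hB fun s₃ hs₃ _ => ?_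
    rw [opWords_initOps] at hs₃
    refine Runs.mono_time (Runs.seq ((runs_layerProg _ (by decide) ?_ hs₃ hB (by omega)).mono le_rfl
      fun s₄ hs₄ => Runs.seq ((runs_clausesProg Ks hKℓ rfl hs₄ ?_ hB (by omega) ?_).mono le_rfl
      fun s₅ hs₅ => ?_))) (t := (h * (2 * initRegs.length + 3) + 3) + ((Ks.length * (ℓ * 174 + 54) + 3)
      + ((h * (2 * finalRegs.length + 3) + 3) + 1))) (by omega)
    · intro s i hc h8
      simp [initRegs, layerInitOps, opWords, LinOp.words, hc, h8, refLabel]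
    · have := holds_initState (satWords n Ks)
      rw [initState_arr_zero] at this
      exact this.2.2
    · rw [hℓ] at hlen
      simp only [satWords, List.length_cons] at hlen
      omega
    · rw [opWords_finalOps] at hs₅
      refine Runs.seq ((runs_layerProg _ (by decide) ?_ hs₅ hB (by omega)).mono le_rfl
        fun s₆ hs₆ => ?_)
      · intro s i hc h8
        simp [finalRegs, layerFinalOps, opWords, LinOp.words, hc, h8, refLabel]
      · obtain ⟨W', hW, h12', harr'⟩ := hs₆.output
        rw [List.append_nil] at hW
        subst hW
        refine Runs.op (instWords hw h p Ks).length ?_ (by simpa using hB) ⟨⟨?_, ?_⟩, ?_, ?_⟩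
        · simp [Op.eval, h12', hs₆.const]
        · rintro (_ | r)
          · simp [initState]
          · simp [initState, hs₆.regs]
        · rintro (_ | a)
          · rw [State.setReg_arr, harr', initState_arr_zero]
          · rw [State.setReg_arr, hs₆.arrs]
            funext i
            simp [initState]
        · intro c hc
          rw [State.setReg_reg, if_neg (by omega), hs₆.const c hc]
        · simp [hs₆.budget]

end Writing

/-! ### Consequences for the Strong Exponential Time Hypothesis -/

theorem magnitude_append (L L' : List ℤ) : magnitude (L ++ L') = magnitude L + magnitude L' := by
  simp only [magnitude, List.length_append, List.map_append, List.sum_append]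
  ring

theorem length_le_magnitude (L : List ℤ) : L.length ≤ magnitude L := Nat.le_add_right _ _

theorem KExpr.magnitude_encode_le {k : ℕ} (e : KExpr k) :
    magnitude (e.encode fun _ => 1) ≤ 4 * e.size * (k + 2) := by
  induction e with
  | vertex i =>
    have := i.2
    simp [encode, weightWords, magnitude, size]
    omega
  | union e₁ e₂ ih₁ ih₂ =>
    simp only [encode, magnitude_append, size] at *
    have : magnitude [1, 0, 0, 0] = 5 := rfl
    rw [this]
    nlinarith
  | join i j hij e ih =>
    have hi := i.2
    have hj := j.2
    rw [show magnitude ((join i j hij e).encode fun _ => 1) = magnitude (e.encode fun _ => 1) +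
      magnitude [2, ((i : ℕ) : ℤ), ((j : ℕ) : ℤ), 0] from magnitude_append _ _, size]
    have : magnitude [2, ((i : ℕ) : ℤ), ((j : ℕ) : ℤ), 0] = 6 + i + j := by
      simp [magnitude]; ring
    have hmul : 4 * (e.size + 1) * (k + 2) = 4 * e.size * (k + 2) + (4 * k + 8) := by ring
    omega
  | rename i j e ih =>
    have hi := i.2
    have hj := j.2
    rw [show magnitude ((rename i j e).encode fun _ => 1) = magnitude (e.encode fun _ => 1) +
      magnitude [3, ((i : ℕ) : ℤ), ((j : ℕ) : ℤ), 0] from magnitude_append _ _, size]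
    have : magnitude [3, ((i : ℕ) : ℤ), ((j : ℕ) : ℤ), 0] = 7 + i + j := by
      simp [magnitude]; ring
    have hmul : 4 * (e.size + 1) * (k + 2) = 4 * e.size * (k + 2) + (4 * k + 8) := by ring
    omega

/-- The clauses of a formula, with natural numbers as variables. -/
def CNF.natClauses {q : ℕ} (φ : CNF q) : List (List (ℕ × Bool)) :=
  φ.clauses.map fun K => K.map fun l => ((l.1 : ℕ), l.2)

theorem CNF.encode_eq {q : ℕ} (φ : CNF q) : φ.encode = satWords φ.n φ.natClauses := by
  simp only [CNF.encode, satWords, natClauses, List.length_map, List.flatMap_map, clauseWords,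
    List.map_map]
  rfl

theorem CNF.lt_of_mem_natClauses {q : ℕ} (φ : CNF q) : ∀ K ∈ φ.natClauses, ∀ l ∈ K, l.1 < φ.n := by
  intro K hK l hl
  obtain ⟨K', -, rfl⟩ := List.mem_map.1 hK
  obtain ⟨l', -, rfl⟩ := List.mem_map.1 hl
  exact l'.1.2

theorem CNF.satisfiable_iff {q : ℕ} (φ : CNF q) :
    φ.Satisfiable ↔ ∃ x : ℕ → Bool, ∀ K ∈ φ.natClauses, ∃ l ∈ K, x l.1 = l.2 := by
  simp only [Satisfiable, natClauses, List.forall_mem_map]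
  constructor
  · rintro ⟨a, ha⟩
    refine ⟨fun v => if h : v < φ.n then a ⟨v, h⟩ else false, fun K hK => ?_⟩
    obtain ⟨l, hl, hal⟩ := ha K hK
    exact ⟨_, List.mem_map_of_mem hl, by simpa using hal⟩
  · rintro ⟨x, hx⟩
    refine ⟨fun v => x v, fun K hK => ?_⟩
    obtain ⟨_, hl, hxl⟩ := hx K hK
    obtain ⟨l, hl', rfl⟩ := List.mem_map.1 hl
    exact ⟨l, hl', hxl⟩

/-- A base below four beats `4 ^ (n / 2)`, since the reduction needs only about `n / 2` labels. -/
theorem exists_delta {ε : ℝ} (h0 : 0 < ε) (h4 : ε < 4) : ∃ δ : ℝ, 0 < δ ∧ δ < 1 ∧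
    ∀ n h : ℕ, h = (n + 1) / 2 → (4 - ε) ^ (h + 8) ≤ 4 ^ 9 * (2 : ℝ) ^ ((1 - δ) * n) := by
  set β := max (4 - ε) 2 with hβ
  have hβ2 : 2 ≤ β := le_max_right _ _
  have hβ4 : β < 4 := max_lt (by linarith) (by norm_num)
  have hpos : 0 < β := by linarith
  have hlog1 : 1 ≤ Real.logb 2 β := by
    rw [Real.le_logb_iff_rpow_le (by norm_num) hpos]; simpa using hβ2
  have hlog2 : Real.logb 2 β < 2 := by
    rw [Real.logb_lt_iff_lt_rpow (by norm_num) hpos]; norm_num; exact hβ4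
  refine ⟨1 - Real.logb 2 β / 2, by linarith, by linarith, fun n h hh => ?_⟩
  have hexp : (2 : ℝ) ^ ((1 - (1 - Real.logb 2 β / 2)) * n) = β ^ ((n : ℝ) / 2) := by
    rw [show (1 - (1 - Real.logb 2 β / 2)) * n = Real.logb 2 β * ((n : ℝ) / 2) by ring,
      Real.rpow_mul (by norm_num), Real.rpow_logb (by norm_num) (by norm_num) hpos]
  rw [hexp]
  calc (4 - ε) ^ (h + 8) ≤ β ^ (h + 8) :=
        pow_le_pow_left₀ (by linarith) (le_max_left _ _) _
    _ = β ^ ((h + 8 : ℕ) : ℝ) := (Real.rpow_natCast _ _).symm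
    _ ≤ β ^ ((9 : ℕ) + (n : ℝ) / 2) := by
        refine Real.rpow_le_rpow_of_exponent_le (by linarith) ?_
        have : 2 * h ≤ n + 1 := by omega
        have : 2 * (h : ℝ) ≤ n + 1 := by exact_mod_cast this
        push_cast
        linarith
    _ = β ^ 9 * β ^ ((n : ℝ) / 2) := by rw [Real.rpow_add hpos, Real.rpow_natCast]
    _ ≤ 4 ^ 9 * β ^ ((n : ℝ) / 2) := by
        gcongr

/-- A program that solves the instances of the reduction fast refutes the hypothesis. The program
`F` reads off the answer, where `hw k p` are the words before the expression. -/
theorem not_seth {P F : Prog} {hdr : List ℕ} (hw : ℕ → ℕ → List ℤ) (h12 : 12 ∉ hdr)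
    (hhdr : ∀ (h p : ℕ) (s : State), s.reg 18 = p → s.reg 21 = h + 8 →
      hdr.map s.reg = hw (h + 8) p)
    (hhdr2 : hdr.length ≤ 2) (hwm : ∀ k p, magnitude (hw k p) ≤ 2 + k + p)
    {ε : ℝ} (h0 : 0 < ε) (h4 : ε < 4) {C d d' : ℕ}
    (hP : ∀ (k : ℕ) (e : KExpr k) (p : ℕ), ∃ (t B : ℕ) (s : State),
      (t : ℝ) ≤ C * (4 - ε) ^ k * (e.size : ℝ) ^ d ∧
      (B : ℝ) ≤ (C * (4 - ε) ^ k * (e.size : ℝ) ^ d +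
        magnitude (hw k p ++ e.encode fun _ => 1) + 2) ^ d' ∧
      Exec B P (initState (hw k p ++ e.encode fun _ => 1)) t s ∧
      ∀ (B' : ℕ) (u : State), 1 ≤ B' → Copy 24 s u → (∀ c < 8, u.reg c = c) → u.reg 18 = p →
        Runs B' F u 3 fun v => v.reg 0 = 1 ↔ ∃ X : Finset e.Vert, IsOCT e.graph X ∧ X.card ≤ p) :
    ¬ SETH := by
  obtain ⟨δ, hδ0, hδ1, hδ⟩ := exists_delta h0 h4
  intro hS
  obtain ⟨q, hq⟩ := hS δ hδ0 hδ1
  refine hq ⟨reductionProg hdr ;; (P.shift 24 ;; F), C * 4 ^ 9 * 40 ^ d + 3000, d + 2, d' + 2,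
    fun φ => ?_⟩
  change CNF q at φ
  obtain ⟨h, hh⟩ : ∃ h, h = (φ.n + 1) / 2 := ⟨_, rfl⟩
  obtain ⟨p, hp⟩ : ∃ p, p = 2 * h + 2 * (φ.natClauses.map List.length).sum := ⟨_, rfl⟩
  obtain ⟨e, henc, hsize, hsat⟩ := exists_reduction h φ.natClauses
    (fun K hK l hl => by have := φ.lt_of_mem_natClauses K hK l hl; omega) hp
  obtain ⟨t, B, s, ht, hB, hexec, hans⟩ := hP (h + 8) e p
  have hinst : hw (h + 8) p ++ e.encode (fun _ => 1) = instWords (hw (h + 8) p) h p φ.natClauses := by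
    rw [henc]; rfl
  have hlen := length_satWords φ.n φ.natClauses
  have hmag : magnitude (hw (h + 8) p ++ e.encode fun _ => 1) ≤
      2 + (h + 8) + p + 4 * e.size * (h + 8 + 2) := by
    rw [magnitude_append]
    exact add_le_add (hwm _ _) e.magnitude_encode_le
  rw [hinst] at hB hexec hmag
  have hilen := length_le_magnitude (instWords (hw (h + 8) p) h p φ.natClauses)
  have hencode := φ.encode_eq
  simp only [qSAT]
  rw [hencode]
  -- all quantities that the reduction handles are quadratic in `N`
  obtain ⟨N, hN⟩ : ∃ N, N = φ.n + (satWords φ.n φ.natClauses).length := ⟨_, rfl⟩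
  have hN2 : 2 ≤ N := by omega
  have hNN : 2 * N ≤ N * N := Nat.mul_le_mul_right _ hN2
  have hsizeN : e.size ≤ 40 * N := by omega
  have hmagN : magnitude (instWords (hw (h + 8) p) h p φ.natClauses) ≤ 1200 * (N * N) := by
    have : 4 * e.size * (h + 8 + 2) ≤ 4 * (40 * N) * (7 * N) :=
      Nat.mul_le_mul (by omega) (by omega)
    have e1 : 4 * (40 * N) * (7 * N) = 1120 * (N * N) := by ring
    omega
  have hclN : φ.natClauses.length * ((satWords φ.n φ.natClauses).length * 174 + 54) ≤
      N * (N * 174 + 54) := Nat.mul_le_mul (by omega) (by omega)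
  have e2 : N * (N * 174 + 54) = 174 * (N * N) + 54 * N := by ring
  set B₀ := B + (1200 * (N * N) + 20 * N) with hB₀
  obtain ⟨t₁, u, ht₁, hex₁, hcopy, hconst, hbudget⟩ := runs_reductionProg (B := B₀) φ.natClauses
    φ.lt_of_mem_natClauses hh hp h12 (hhdr h p) (by omega) (by omega) (by omega)
  obtain ⟨v, hex₂, hcopy', hreg⟩ := hexec.shift 24 u hcopy
  obtain ⟨t₃, w, ht₃, hex₃, hcorrect⟩ := hans B₀ v (by omega) hcopy'
    (fun c hc => by rw [hreg c (by omega), hconst c hc]) (by rw [hreg 18 (by norm_num), hbudget])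
  have htN : t₁ + t₃ ≤ 400 * (N * N) := by omega
  have hE : (1 : ℝ) ≤ (2 : ℝ) ^ ((1 - δ) * φ.n) :=
    Real.one_le_rpow (by norm_num) (mul_nonneg (by linarith) (Nat.cast_nonneg _))
  have hNr : ((φ.n : ℝ) + (satWords φ.n φ.natClauses).length) = N := by rw [hN]; push_cast; rfl
  have hN1 : (1 : ℝ) ≤ N := by exact_mod_cast (by omega : 1 ≤ N)
  have hE' := hδ φ.n h hh
  rw [hNr, show ((C * 4 ^ 9 * 40 ^ d + 3000 : ℕ) : ℝ) = C * 4 ^ 9 * 40 ^ d + 3000 by push_cast; ring]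
  generalize (2 : ℝ) ^ ((1 - δ) * φ.n) = E at *
  -- the time of the given program
  have hT : C * (4 - ε) ^ (h + 8) * (e.size : ℝ) ^ d ≤
      C * 4 ^ 9 * 40 ^ d * E * (N : ℝ) ^ (d + 2) := by
    have hsr : (e.size : ℝ) ≤ 40 * N := by exact_mod_cast hsizeN
    calc C * (4 - ε) ^ (h + 8) * (e.size : ℝ) ^ d
        ≤ C * (4 ^ 9 * E) * (40 * N) ^ d := by gcongr
      _ = C * 4 ^ 9 * 40 ^ d * E * (N : ℝ) ^ d := by rw [mul_pow]; ring
      _ ≤ C * 4 ^ 9 * 40 ^ d * E * (N : ℝ) ^ (d + 2) := by gcongr; omega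
  have hEN : (N : ℝ) * N ≤ E * (N : ℝ) ^ (d + 2) := by
    calc (N : ℝ) * N = 1 * (N : ℝ) ^ 2 := by ring
      _ ≤ E * (N : ℝ) ^ (d + 2) := by gcongr; omega
  rw [show (C * 4 ^ 9 * 40 ^ d + 3000) * E * (N : ℝ) ^ (d + 2) =
    C * 4 ^ 9 * 40 ^ d * E * (N : ℝ) ^ (d + 2) + 3000 * (E * (N : ℝ) ^ (d + 2)) by ring]
  have hT0 : 0 ≤ C * 4 ^ 9 * 40 ^ d * E * (N : ℝ) ^ (d + 2) := by positivity
  have hNN0 : (0 : ℝ) ≤ N * N := by positivity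
  refine ⟨t₁ + (t + t₃), B₀, w, ?_, ?_,
    .seq hex₁ (.seq (hex₂.mono (Nat.le_add_right _ _)) hex₃), ?_⟩
  · have : (t₁ : ℝ) + t₃ ≤ 400 * (N * N) := by exact_mod_cast htN
    push_cast
    linarith
  · set X := C * 4 ^ 9 * 40 ^ d * E * (N : ℝ) ^ (d + 2) + 3000 * (E * (N : ℝ) ^ (d + 2)) +
      magnitude (satWords φ.n φ.natClauses) + 2 with hX
    have hmr : (magnitude (instWords (hw (h + 8) p) h p φ.natClauses) : ℝ) ≤ 1200 * (N * N) := by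
      exact_mod_cast hmagN
    have hm0 : (0 : ℝ) ≤ magnitude (satWords φ.n φ.natClauses) := Nat.cast_nonneg _
    have hX2 : 2 ≤ X := by linarith
    have hBX : (B : ℝ) ≤ X ^ d' := by
      refine hB.trans (pow_le_pow_left₀ ?_ (by linarith) _)
      have : (0 : ℝ) ≤ C * (4 - ε) ^ (h + 8) * (e.size : ℝ) ^ d := by
        have : 0 ≤ 4 - ε := by linarith
        positivity
      positivity
    have hrest : (1200 * (N * N) + 20 * N : ℝ) ≤ X := by
      have : (N : ℝ) ≤ N * N := by nlinarith
      linarith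
    have hX1 : 1 ≤ X := by linarith
    calc (B₀ : ℝ) = B + (1200 * (N * N) + 20 * N) := by rw [hB₀]; push_cast; ring
      _ ≤ X ^ (d' + 1) + X ^ (d' + 1) := by
        refine add_le_add (hBX.trans (pow_le_pow_right₀ hX1 (by omega))) (hrest.trans ?_)
        exact le_self_pow₀ hX1 (by omega)
      _ = 2 * X ^ (d' + 1) := by ring
      _ ≤ X * X ^ (d' + 1) := by gcongr
      _ = X ^ (d' + 2) := by ring
  · rw [hcorrect, hsat, φ.satisfiable_iff]

/-- Test whether the register `0` of the shifted program is `1`. -/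
def decisionFinish : Prog := .ite 0 24 (.ite 24 2 (.const 0 1) (.const 0 0)) (.const 0 0)

/-- Test whether the minimum weight is at most the budget. -/
def weightedFinish : Prog := .ite 18 25 (.const 0 0) (.const 0 1)

theorem not_seth_of_decisionOCT {ε : ℝ} (h0 : 0 < ε) (h4 : ε < 4)
    (hP : ∃ (P : Prog) (C d : ℕ), decisionOCT.SolvedBy P fun I : DecisionInst =>
      C * (4 - ε) ^ I.k * (I.e.size : ℝ) ^ d) : ¬ SETH := by
  obtain ⟨P, C, d, d', hP⟩ := hP
  refine not_seth (P := P) (F := decisionFinish) (hdr := [21, 18]) (fun k p => [(k : ℤ), (p : ℤ)])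
    (by decide) (fun h p s h18 h21 => by simp [h18, h21]) (by simp)
    (fun k p => by simp [magnitude]; omega) h0 h4 (C := C) (d := d) (d' := d') fun k e p => ?_
  obtain ⟨t, B, s, ht, hB, hexec, hans⟩ := hP ⟨k, e, p⟩
  refine ⟨t, B, s, ht, hB, hexec, fun B' u hB' hcopy hconst _ => ?_⟩
  have hr : u.reg 24 = s.reg 0 := hcopy.reg 0
  have hans : s.reg 0 = 1 ↔ ∃ X : Finset e.Vert, IsOCT e.graph X ∧ X.card ≤ p := hans
  rw [← hans]
  refine Runs.ite (t := 2) (fun h₁ => Runs.ite (t := 1) (fun h₂ => Runs.const (by simpa using hB') ?_)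
    fun h₂ => Runs.const (by simp) ?_) fun h₁ => (Runs.const (by simp) ?_).mono_time (by norm_num)
  all_goals
    rw [hconst 0 (by norm_num), hr] at h₁
    try rw [hconst 2 (by norm_num), hr] at h₂
    simp
    omega

theorem not_seth_of_weightedOCT {ε : ℝ} (h0 : 0 < ε) (h4 : ε < 4)
    (hP : ∃ (P : Prog) (C d : ℕ), weightedOCT.SolvedBy P fun I : WeightedInst =>
      C * (4 - ε) ^ I.k * (I.e.size : ℝ) ^ d) : ¬ SETH := by
  obtain ⟨P, C, d, d', hP⟩ := hP
  refine not_seth (P := P) (F := weightedFinish) (hdr := [21]) (fun k _ => [(k : ℤ)])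
    (by decide) (fun h p s h18 h21 => by simp [h21]) (by simp)
    (fun k p => by simp [magnitude]; omega) h0 h4 (C := C) (d := d) (d' := d') fun k e p => ?_
  obtain ⟨t, B, s, ht, hB, hexec, m, ⟨⟨X, hX, hXm⟩, hmin⟩, hans⟩ := hP ⟨k, e, fun _ => 1⟩
  refine ⟨t, B, s, ht, hB, hexec, fun B' u hB' hcopy hconst h18 => ?_⟩
  have hcard : ∀ Y : Finset e.Vert, (∑ _v ∈ Y, (1 : WithTop ℤ)) = ((Y.card : ℤ) : WithTop ℤ) := by
    intro Y
    rw [Finset.sum_const, nsmul_one]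
    rfl
  dsimp only at X hX hXm hmin
  rw [hcard] at hXm
  subst hXm
  have hr : u.reg 25 = X.card := by
    rw [show (25 : ℕ) = 1 + 24 from rfl, hcopy.reg 1]
    exact (congrArg Prod.snd hans).trans rfl
  have hiff : (∃ Y : Finset e.Vert, IsOCT e.graph Y ∧ Y.card ≤ p) ↔ X.card ≤ p := by
    constructor
    · rintro ⟨Y, hY, hYp⟩
      have := hmin ⟨Y, hY, rfl⟩
      rw [hcard, WithTop.coe_le_coe, Nat.cast_le] at this
      exact this.trans hYp
    · exact fun h => ⟨X, hX, h⟩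
  rw [hiff]
  refine Runs.mono_time (Runs.ite (t := 1) (fun h₁ => Runs.const (by simp) ?_)
    fun h₁ => Runs.const (by simpa using hB') ?_) (by norm_num)
  all_goals
    rw [h18, hr] at h₁
    simp
    omega

end OCT

theorem theorem3 :
    (∃ (P : OCT.Prog) (C d : ℕ),
      OCT.weightedOCT.SolvedBy P fun I : OCT.WeightedInst =>
        C * (4 : ℝ) ^ I.k * (I.k : ℝ) ^ d * I.e.size) ∧
    (∀ ε : ℝ, 0 < ε → ε < 4 →
      (∃ (P : OCT.Prog) (C d : ℕ),
        OCT.weightedOCT.SolvedBy P fun I : OCT.WeightedInst =>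
          C * (4 - ε) ^ I.k * (I.e.size : ℝ) ^ d) → ¬ OCT.SETH) ∧
    (∀ ε : ℝ, 0 < ε → ε < 4 →
      (∃ (P : OCT.Prog) (C d : ℕ),
        OCT.decisionOCT.SolvedBy P fun I : OCT.DecisionInst =>
          C * (4 - ε) ^ I.k * (I.e.size : ℝ) ^ d) → ¬ OCT.SETH) :=
  ⟨OCT.weightedOCT_solvedBy, fun _ h0 h4 => OCT.not_seth_of_weightedOCT h0 h4,
    fun _ h0 h4 => OCT.not_seth_of_decisionOCT h0 h4⟩
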